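/- Let $k$ be an algebraically closed field, $N\simeq\mathbb Z^n$ a lattice with dual lattice $M$, and $\Sigma$ a smooth complete fan in $N_{\mathbb R}$. Let $R(\Sigma)$ be the set of smooth fans subdividing $\Sigma$, ordered by subdivision ($\Sigma''\ge\Sigma'$ if $\Sigma''$ subdivides $\Sigma'$). A toric $b$-divisor on the toric variety $X_\Sigma$ is a family $\boldsymbol D=(D_{\Sigma'})_{\Sigma'\in R(\Sigma)}$ of toric $\mathbb Q$-divisors $D_{\Sigma'}=\sum_{\tau\in\Sigma'(1)}a_\tau D_\tau$ on $X_{\Sigma'}$ that is compatible under push-forward. It is nef if $D_{\Sigma'}$ is nef (i.e. has a concave support function) for all $\Sigma'$ in a cofinal subset of $R(\Sigma)$, and Cartier if there is $\Sigma'\in R(\Sigma)$ such that $D_{\Sigma''}$ is the pull-back of $D_{\Sigma'}$ for all $\Sigma''\ge\Sigma'$. Put $$H^0(X_\Sigma,\mathcal O(\boldsymbol D))=\{f\in k(X_\Sigma)^\times : \operatorname{div}_{\Sigma'}(f)+\lfloor D_{\Sigma'}\rfloor\ge 0 \text{ for all }\Sigma'\in R(\Sigma)\}\cup\{0\},\qquad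 b\text{-}R(\boldsymbol D)=\bigoplus_{\ell\ge 0}H^0(X_\Sigma,\mathcal O(\ell\boldsymbol D)).$$ Let $\boldsymbol D$ be a nef toric $b$-divisor on $X_\Sigma$. Then there is a (unique) continuous, conical, concave function $\phi\colon N_{\mathbb R}\to\mathbb R$ with $\phi(v_\tau)=-a_\tau$ for all rays $\tau$ of all $\Sigma'\in R(\Sigma)$, where $v_\tau$ is the primitive generator of $\tau$. Let $\Delta_\phi=\{m\in M_{\mathbb R} : \langle m,v\rangle-\phi(v)\text{ is bounded below for }v\in N_{\mathbb R}\}$ be its stability set. Then: 1. $\boldsymbol D$ is Cartier if and only if $\Delta_\phi$ is a rational polytope (the convex hull of finitely many points of $M_{\mathbb Q}$). 2. If $\boldsymbol D$ is Cartier, then $b\text{-}R(\boldsymbol D)$ is a finitely generated $k$-algebra. 3. Suppose that $n\le 2$ or that the affine hull of $\Delta_\phi$ is spanned by points of $M_{\mathbb Q}$ (for instance, that $\Delta_\phi$ has non-empty interior, i.e. that $\boldsymbol D$ is big). If $b\text{-}R(\boldsymbol D)$ is a finitely generated $k$-algebra, then $\boldsymbol D$ is Cartier. In particular, under the assumption of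 3, $b\text{-}R(\boldsymbol D)$ is finitely generated if and only if $\boldsymbol D$ is Cartier, if and only if $\Delta_\phi$ is a rational polytope. -/

import Mathlib

open scoped Polynomial

noncomputable section

namespace ToricB

/-! ### Lattices

The lattice is `N = ℤⁿ`, with dual lattice `M = ℤⁿ`; the pairing is the dot product. -/

/-- The inclusion `N → N_ℝ` (and `M → M_ℝ`). -/
def toReal {n : ℕ} (v : Fin n → ℤ) : Fin n → ℝ := fun i => (v i : ℝ)

/-- The inclusion `M_ℚ → M_ℝ`. -/
def ratToReal {n : ℕ} (q : Fin n → ℚ) : Fin n → ℝ := fun i => (q i : ℝ)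

/-- Primitive lattice vectors (in particular nonzero). -/
def IsPrimitive {n : ℕ} (v : Fin n → ℤ) : Prop :=
  ∀ (d : ℤ) (w : Fin n → ℤ), v = d • w → IsUnit d

/-! ### Fans -/

/-- Cones in `N_ℝ`. -/
abbrev Cone (n : ℕ) := PointedCone ℝ (Fin n → ℝ)

/-- A cone is smooth if it is spanned by part of a `ℤ`-basis of `N`. Such a cone is
automatically rational, polyhedral and strongly convex. -/
def IsSmoothCone {n : ℕ} (σ : Cone n) : Prop :=
  ∃ (b : Module.Basis (Fin n) ℤ (Fin n → ℤ)) (s : Set (Fin n)),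
    σ = PointedCone.hull ℝ ((fun i => toReal (b i)) '' s)

/-- The ray spanned by a lattice vector. -/
def rayCone {n : ℕ} (v : Fin n → ℤ) : Cone n := PointedCone.hull ℝ {toReal v}

/-- Smooth complete fans in `N_ℝ`. -/
structure Fan (n : ℕ) where
  /-- the cones of the fan -/
  cones : Set (Cone n)
  finite : cones.Finite
  smooth : ∀ σ ∈ cones, IsSmoothCone σ
  face_mem : ∀ σ ∈ cones, ∀ τ : Cone n, τ.IsFaceOf σ → τ ∈ cones
  inter_face : ∀ σ ∈ cones, ∀ τ ∈ cones, (σ ⊓ τ).IsFaceOf σ ∧ (σ ⊓ τ).IsFaceOf τ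
  complete : ∀ x : Fin n → ℝ, ∃ σ ∈ cones, x ∈ σ

/-- `Σ(1)`, each ray being represented by its primitive generator. -/
def Fan.rays {n : ℕ} (S : Fan n) : Set (Fin n → ℤ) :=
  {v | IsPrimitive v ∧ rayCone v ∈ S.cones}

/-- `S'` is a subdivision of `S` (both have support `N_ℝ`). -/
def Fan.Subdivides {n : ℕ} (S' S : Fan n) : Prop :=
  ∀ σ' ∈ S'.cones, ∃ σ ∈ S.cones, σ' ≤ σ

/-- `R(Σ)`: the smooth fans subdividing `Σ`. -/
abbrev Model {n : ℕ} (S : Fan n) := {S' : Fan n // S'.Subdivides S}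

/-! ### Toric divisors -/

/-- Toric `ℚ`-Weil divisors `∑ a_τ D_τ` on the toric variety of `S`. The rays are finitely many,
and all Weil divisors are Cartier, since the fan is smooth. -/
abbrev ToricDivisor {n : ℕ} (S : Fan n) := S.rays → ℚ

open Classical in
/-- Push-forward of toric divisors along the morphism given by a subdivision `S''` of `S'`:
`D_τ` goes to `D_τ` if `τ` is a ray of `S'`, and to `0` otherwise. -/
def pushforward {n : ℕ} {S'' S' : Fan n} (D : ToricDivisor S'') : ToricDivisor S' :=
  fun v => if h : (v : Fin n → ℤ) ∈ S''.rays then D ⟨v, h⟩ else 0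

/-- `ψ` is the virtual support function of the toric divisor `D`: it is continuous, it is given
on every cone by an element of `M_ℚ`, and `ψ (v_τ) = - a_τ` for every ray. -/
structure IsSupportFunction {n : ℕ} {S : Fan n} (D : ToricDivisor S) (ψ : (Fin n → ℝ) → ℝ) :
    Prop where
  continuous : Continuous ψ
  linear : ∀ σ ∈ S.cones, ∃ m : Fin n → ℚ, ∀ u ∈ σ, ψ u = ratToReal m ⬝ᵥ u
  ray : ∀ v : S.rays, ψ (toReal (v : Fin n → ℤ)) = -(D v : ℝ)

/-- A toric divisor is nef: its support function is concave. -/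
def ToricDivisor.IsNef {n : ℕ} {S : Fan n} (D : ToricDivisor S) : Prop :=
  ∃ ψ, IsSupportFunction D ψ ∧ ConcaveOn ℝ Set.univ ψ

/-- `D''` (on a subdivision `S''` of `S'`) is the pull-back of `D'`: pulling back a toric
`ℚ`-Cartier divisor does not change its support function. -/
def IsPullback {n : ℕ} {S'' S' : Fan n} (D'' : ToricDivisor S'') (D' : ToricDivisor S') : Prop :=
  ∃ ψ, IsSupportFunction D' ψ ∧ IsSupportFunction D'' ψ

/-! ### Toric b-divisors -/

/-- Toric (Weil) b-divisors with `ℚ`-coefficients: elements of the inverse limit, under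
push-forward, of the groups of toric divisors on all models. -/
structure BDivisor {n : ℕ} (S : Fan n) where
  /-- the incarnation on a model -/
  inc : ∀ S' : Model S, ToricDivisor S'.1
  compat : ∀ S'' S' : Model S, S''.1.Subdivides S'.1 → pushforward (inc S'') = inc S'

/-- The multiple `ℓ D`. -/
def BDivisor.mul {n : ℕ} {S : Fan n} (l : ℕ) (D : BDivisor S) : BDivisor S where
  inc S' v := l * D.inc S' v
  compat S'' S' h := by
    funext v
    have := congrFun (D.compat S'' S' h) v
    simp only [pushforward] at this ⊢
    split_ifs at this ⊢ with hv <;> simp [← this]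

/-- Nef toric b-divisors: the incarnations are nef on a cofinal set of models. -/
def BDivisor.IsNef {n : ℕ} {S : Fan n} (D : BDivisor S) : Prop :=
  ∃ C : Set (Model S), (∀ S' : Model S, ∃ S'' ∈ C, S''.1.Subdivides S'.1) ∧
    ∀ S' ∈ C, (D.inc S').IsNef

/-- Cartier toric b-divisors: those determined on some model. -/
def BDivisor.IsCartier {n : ℕ} {S : Fan n} (D : BDivisor S) : Prop :=
  ∃ S' : Model S, ∀ S'' : Model S, S''.1.Subdivides S'.1 → IsPullback (D.inc S'') (D.inc S')

/-- `φ` is the concave function of the b-divisor `D`: the continuous concave extension to `N_ℝ`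
of the conical function on `N_ℚ` that takes the value `- a_τ` at `v_τ`, for the rays `τ` of all
models (every primitive lattice vector occurs among the `v_τ`). -/
structure BDivisor.IsConcaveFunction {n : ℕ} {S : Fan n} (D : BDivisor S)
    (φ : (Fin n → ℝ) → ℝ) : Prop where
  continuous : Continuous φ
  concave : ConcaveOn ℝ Set.univ φ
  conical : ∀ (t : ℝ) (x : Fin n → ℝ), 0 ≤ t → φ (t • x) = t * φ x
  ray : ∀ (S' : Model S) (v : S'.1.rays), φ (toReal (v : Fin n → ℤ)) = -(D.inc S' v : ℝ)

/-! ### Convex sets in `M_ℝ` -/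

/-- The stability set of a concave function. -/
def stabilitySet {n : ℕ} (φ : (Fin n → ℝ) → ℝ) : Set (Fin n → ℝ) :=
  {m | BddBelow (Set.range fun v => m ⬝ᵥ v - φ v)}

/-- Rational polytopes: convex hulls of finitely many points of `M_ℚ`. -/
def IsRationalPolytope {n : ℕ} (P : Set (Fin n → ℝ)) : Prop :=
  ∃ s : Finset (Fin n → ℚ), P = convexHull ℝ (ratToReal '' (s : Set (Fin n → ℚ)))

/-- The affine hull of `P` is a rational affine subspace, i.e. it is spanned by points of `M_ℚ`. -/
def HasRationalAffineHull {n : ℕ} (P : Set (Fin n → ℝ)) : Prop :=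
  ∃ s : Set (Fin n → ℚ), affineSpan ℝ (ratToReal '' s) = affineSpan ℝ P

/-! ### Rational functions and global sections

The toric variety `X` of a fan is covered by the affine charts `Spec k[σ^∨ ∩ M]`, all of them
with function field `k(X) = Frac k[M]`. A prime divisor of `X` is a prime ideal of height one of
the ring of a chart; `X` being normal, its local ring is a discrete valuation ring of `k(X)`. -/

/-- The ring `k[M]` of the torus. -/
abbrev TorusRing (k : Type*) [Field k] (n : ℕ) := AddMonoidAlgebra k (Fin n → ℤ)

/-- The field `k(X)`. -/
abbrev FunctionField (k : Type*) [Field k] (n : ℕ) := FractionRing (TorusRing k n)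

/-- The character `χ^m`. -/
def character (k : Type*) [Field k] {n : ℕ} (m : Fin n → ℤ) : TorusRing k n :=
  AddMonoidAlgebra.single m 1

/-- The ring `k[σ^∨ ∩ M]`. -/
def chart (k : Type*) [Field k] {n : ℕ} (σ : Cone n) : Subalgebra k (TorusRing k n) :=
  Algebra.adjoin k {f | ∃ m : Fin n → ℤ, (∀ u ∈ σ, 0 ≤ toReal m ⬝ᵥ u) ∧ f = character k m}

/-- `V` is the localization of the chart ring `A` at `p`, as a subring of `k(X)`. -/
def IsLocalRingAt {k : Type*} [Field k] {n : ℕ} (A : Subalgebra k (TorusRing k n)) (p : Ideal A)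
    (V : ValuationSubring (FunctionField k n)) : Prop :=
  ∀ f : FunctionField k n, f ∈ V ↔ ∃ a b : A, b ∉ p ∧
    f * algebraMap (TorusRing k n) (FunctionField k n) (b : TorusRing k n) =
      algebraMap (TorusRing k n) (FunctionField k n) (a : TorusRing k n)

/-- `V` is the local ring of a prime divisor of the toric variety of `S`. -/
def IsPrimeDivisor {k : Type*} [Field k] {n : ℕ} (S : Fan n)
    (V : ValuationSubring (FunctionField k n)) : Prop :=
  ∃ σ ∈ S.cones, ∃ p : Ideal (chart k σ), p.IsPrime ∧ p.height = 1 ∧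
    IsLocalRingAt (chart k σ) p V

/-- The ideal of the toric prime divisor `D_τ` in the ring of the chart of the ray `τ = ℝ≥0 v`. -/
def toricIdeal (k : Type*) [Field k] {n : ℕ} (v : Fin n → ℤ) : Ideal (chart k (rayCone v)) :=
  Ideal.span {a | ∃ m : Fin n → ℤ, 0 < m ⬝ᵥ v ∧ (a : TorusRing k n) = character k m}

/-- `V` is the local ring of the toric prime divisor `D_τ`, where `v = v_τ`. -/
def IsToricPrime {k : Type*} [Field k] {n : ℕ} (v : Fin n → ℤ)
    (V : ValuationSubring (FunctionField k n)) : Prop :=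
  IsLocalRingAt (chart k (rayCone v)) (toricIdeal k v) V

/-- The normalized discrete valuation of `V` is at least `j` at `f`; here `ϖ` is a uniformizer. -/
def OrdGE {K : Type*} [Field K] (V : ValuationSubring K) (j : ℤ) (f : K) : Prop :=
  ∀ ϖ : V, Irreducible ϖ → V.valuation f ≤ V.valuation (ϖ : K) ^ j

/-- `div f + ⌊D⌋ ≥ 0` on the toric variety of `S` (or `f = 0`): the coefficient of `⌊D⌋` is
`⌊a_τ⌋` along `D_τ` and zero along all other prime divisors. -/
def IsSection {k : Type*} [Field k] {n : ℕ} {S : Fan n} (D : ToricDivisor S)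
    (f : FunctionField k n) : Prop :=
  ∀ V : ValuationSubring (FunctionField k n), IsPrimeDivisor S V →
    (∀ v : S.rays, IsToricPrime (v : Fin n → ℤ) V → OrdGE V (-⌊D v⌋) f) ∧
    ((∀ v : S.rays, ¬ IsToricPrime (v : Fin n → ℤ) V) → OrdGE V 0 f)

section helpers

variable {K : Type*} [Field K] {V : ValuationSubring K}

theorem ordGE_zero (j : ℤ) : OrdGE V j 0 := fun ϖ _ => by simp

theorem OrdGE.add {j : ℤ} {f g : K} (hf : OrdGE V j f) (hg : OrdGE V j g) : OrdGE V j (f + g) :=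
  fun ϖ h => (V.valuation.map_add f g).trans (max_le (hf ϖ h) (hg ϖ h))

theorem OrdGE.mul {i j : ℤ} {f g : K} (hf : OrdGE V i f) (hg : OrdGE V j g) :
    OrdGE V (i + j) (f * g) := fun ϖ h => by
  have h0 : V.valuation (ϖ : K) ≠ 0 := by
    rw [Valuation.ne_zero_iff]
    exact fun h' => h.ne_zero (Subtype.ext h')
  rw [map_mul, zpow_add₀ h0]
  exact mul_le_mul' (hf ϖ h) (hg ϖ h)

theorem OrdGE.mono {i j : ℤ} (hij : j ≤ i) {f : K} (hf : OrdGE V i f) : OrdGE V j f :=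
  fun ϖ h => by
  have h0 : V.valuation (ϖ : K) ≠ 0 := by
    rw [Valuation.ne_zero_iff]
    exact fun h' => h.ne_zero (Subtype.ext h')
  refine (hf ϖ h).trans ?_
  exact zpow_le_zpow_right_of_le_one₀ (zero_lt_iff.mpr h0) (V.valuation_le_one ϖ) hij

theorem ordGE_of_mem {f : K} (hf : f ∈ V) : OrdGE V 0 f := fun ϖ _ => by
  simpa using (V.valuation_le_one_iff f).2 hf

variable {k : Type*} [Field k] {n : ℕ} {S : Fan n}

theorem IsPrimeDivisor.algebraMap_mem {V : ValuationSubring (FunctionField k n)}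
    (hV : IsPrimeDivisor S V) (c : k) : algebraMap k (FunctionField k n) c ∈ V := by
  obtain ⟨σ, -, p, hp, -, h⟩ := hV
  refine (h _).2 ⟨algebraMap k _ c, 1, fun h1 => hp.ne_top ((Ideal.eq_top_iff_one p).2 h1), ?_⟩
  simp only [OneMemClass.coe_one, map_one, mul_one, Subalgebra.coe_algebraMap]
  exact IsScalarTower.algebraMap_apply k (TorusRing k n) (FunctionField k n) c

theorem IsSection.mul {D D' : ToricDivisor S} {f g : FunctionField k n} (hf : IsSection D f)
    (hg : IsSection D' g) : IsSection (D + D') (f * g) := fun V hV => by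
  refine ⟨fun v hv => ?_, fun h => ?_⟩
  · refine (((hf V hV).1 v hv).mul ((hg V hV).1 v hv)).mono ?_
    have := Int.le_floor_add (D v) (D' v)
    simp only [Pi.add_apply]
    omega
  · simpa using ((hf V hV).2 h).mul ((hg V hV).2 h)

theorem isSection_zero_algebraMap (c : k) :
    IsSection (0 : ToricDivisor S) (algebraMap k (FunctionField k n) c) := fun V hV => by
  have := ordGE_of_mem (hV.algebraMap_mem c)
  exact ⟨fun v _ => by simpa using this, fun _ => this⟩

end helpers

/-- `H⁰(X, O(D))` for a toric b-divisor `D`: the rational functions `f` with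
`b-div f + ⌊D⌋ ≥ 0`, together with `0`. -/
def BDivisor.H0 (k : Type*) [Field k] {n : ℕ} {S : Fan n} (D : BDivisor S) :
    Submodule k (FunctionField k n) where
  carrier := {f | ∀ S' : Model S, IsSection (D.inc S') f}
  zero_mem' _ _ _ := ⟨fun _ _ => ordGE_zero _, fun _ => ordGE_zero _⟩
  add_mem' hf hg S' V hV :=
    ⟨fun v hv => ((hf S' V hV).1 v hv).add ((hg S' V hV).1 v hv),
      fun h => ((hf S' V hV).2 h).add ((hg S' V hV).2 h)⟩
  smul_mem' c f hf S' := by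
    have := (isSection_zero_algebraMap (S := S'.1) c).mul (hf S')
    rwa [zero_add, ← Algebra.smul_def] at this

/-- The ring `b-R(D) = ⊕_ℓ H⁰(X, O(ℓ D))`, with `t` keeping track of the degree: the
polynomials `∑ f_ℓ t^ℓ` with `f_ℓ ∈ H⁰(X, O(ℓ D))`. -/
def BDivisor.sectionRing (k : Type*) [Field k] {n : ℕ} {S : Fan n} (D : BDivisor S) :
    Subalgebra k (FunctionField k n)[X] where
  carrier := {F | ∀ l : ℕ, F.coeff l ∈ (BDivisor.mul l D).H0 k}
  add_mem' hF hG l := by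
    rw [Polynomial.coeff_add]
    exact Submodule.add_mem _ (hF l) (hG l)
  mul_mem' := by
    intro F G hF hG l
    rw [Polynomial.coeff_mul]
    refine Submodule.sum_mem _ fun x hx S' => ?_
    have := (hF x.1 S').mul (hG x.2 S')
    have hx : x.1 + x.2 = l := Finset.HasAntidiagonal.mem_antidiagonal.1 hx
    convert this using 1
    funext v
    simp [BDivisor.mul, ← hx, add_mul]
  algebraMap_mem' c l := by
    rw [Polynomial.algebraMap_apply, Polynomial.coeff_C]
    split_ifs with h
    · subst h
      intro S'
      convert isSection_zero_algebraMap (S := S'.1) c using 1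
      funext v
      simp [BDivisor.mul]
    · exact Submodule.zero_mem _

end ToricB

end

/-!
A nef toric b-divisor has concave support functions on a cofinal set of models. Along this directed
set they increase on every vector, and their supremum is the function `φ`. Being Cartier means that
`φ` is linear on the cones of one model. A conical concave function is of this kind exactly when it
is the minimum of finitely many rational linear forms, that is, when its stability set is a rational
polytope; the model on which it becomes linear is found by subdividing along the hyperplanes on
which two of the forms agree.

The orders along the toric divisors and the units on the torus show that `b-R(D)` is spanned by the
monomials `χ^m t^l` with `m ∈ l Δ_φ`, so it is finitely generated exactly when the semigroup of
these pairs `(l, m)` is. Gordan's lemma settles the case of a rational polytope. Conversely, the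
slopes `m / l` of finitely many generators span a rational polytope containing all rational points
of `Δ_φ`, and these are dense when the affine hull of `Δ_φ` is rational. For `n ≤ 2` it always is,
because `φ` takes rational values at lattice points.
-/

noncomputable section

namespace ToricB

section PositiveCombinations

variable {R E ι : Type*} [Field R] [LinearOrder R] [IsStrictOrderedRing R] [AddCommGroup E]
  [Module R E] {v : ι → E} {s t : Set ι}

theorem linearCombination_mem_hull_image {c : ι →₀ R} (hc : ∀ i, 0 ≤ c i)
    (hcs : (c.support : Set ι) ⊆ s) :
    Finsupp.linearCombination R v c ∈ PointedCone.hull R (v '' s) := by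
  rw [Finsupp.linearCombination_apply]
  exact Submodule.sum_mem _ fun i hi =>
    (PointedCone.hull R _).smul_mem (hc i) (Submodule.subset_span ⟨i, hcs hi, rfl⟩)

theorem mem_hull_image_iff {x : E} :
    x ∈ PointedCone.hull R (v '' s) ↔ ∃ c : ι →₀ R, (∀ i, 0 ≤ c i) ∧
      (c.support : Set ι) ⊆ s ∧ Finsupp.linearCombination R v c = x := by
  refine ⟨fun hx => ?_, fun ⟨c, hc, hcs, hcx⟩ => hcx ▸ linearCombination_mem_hull_image hc hcs⟩
  obtain ⟨c, hcs, rfl⟩ := (Finsupp.mem_span_image_iff_linearCombination _).1 hx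
  refine ⟨c.mapRange Subtype.val rfl, fun i => (c i).2, fun i hi => ?_, ?_⟩
  · exact (Finsupp.mem_supported _ c).1 hcs (Finsupp.support_mapRange hi)
  · rw [Finsupp.linearCombination_apply, Finsupp.linearCombination_apply,
      Finsupp.sum_mapRange_index fun i => zero_smul R (v i)]
    rfl

theorem isFaceOf_hull_image (hs : LinearIndepOn R v s) (hts : t ⊆ s) :
    (PointedCone.hull R (v '' t)).IsFaceOf (PointedCone.hull R (v '' s)) := by
  classical
  refine .of_mem_of_add_mem_left (Submodule.span_mono (Set.image_mono hts)) ?_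
  intro x y hx hy hxy
  obtain ⟨c, hc, hcs, rfl⟩ := mem_hull_image_iff.1 hx
  obtain ⟨d, hd, hds, rfl⟩ := mem_hull_image_iff.1 hy
  obtain ⟨e, -, het, hcde⟩ := mem_hull_image_iff.1 hxy
  have hsum : c + d = e := linearIndepOn_iffₛ.1 hs _ (add_mem hcs hds) _ (het.trans hts)
    (by rw [map_add, hcde])
  refine linearCombination_mem_hull_image hc fun i hi => het ?_
  have hpos : 0 < c i + d i :=
    add_pos_of_pos_of_nonneg ((hc i).lt_of_ne' (Finsupp.mem_support_iff.1 hi)) (hd i)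
  exact Finsupp.mem_support_iff.2 (by rw [← hsum]; exact hpos.ne')

variable {τ : PointedCone R E}

theorem mem_of_isFaceOf_hull_image (hτ : τ.IsFaceOf (PointedCone.hull R (v '' s)))
    {c : ι →₀ R} (hc : ∀ i, 0 ≤ c i) (hcs : (c.support : Set ι) ⊆ s)
    (hcτ : Finsupp.linearCombination R v c ∈ τ) {i : ι} (hi : i ∈ c.support) : v i ∈ τ := by
  rw [Finsupp.linearCombination_apply, Finsupp.sum, ← Finset.sum_attach] at hcτ
  refine hτ.mem_of_sum_smul_mem (f := fun j : c.support => v j) (c := fun j => c j)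
    (fun j => Submodule.subset_span ⟨j, hcs j.2, rfl⟩) (fun j => hc j) hcτ ⟨i, hi⟩ ?_
  exact (hc i).lt_of_ne' (Finsupp.mem_support_iff.1 hi)

theorem eq_hull_image_of_isFaceOf (hτ : τ.IsFaceOf (PointedCone.hull R (v '' s))) :
    τ = PointedCone.hull R (v '' {i ∈ s | v i ∈ τ}) := by
  apply le_antisymm
  · intro x hx
    obtain ⟨c, hc, hcs, rfl⟩ := mem_hull_image_iff.1 (hτ.le hx)
    exact linearCombination_mem_hull_image hc fun i hi =>
      ⟨hcs hi, mem_of_isFaceOf_hull_image hτ hc hcs hx hi⟩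
  · rw [PointedCone.hull, Submodule.span_le]
    rintro _ ⟨i, hi, rfl⟩
    exact hi.2

end PositiveCombinations

variable {n : ℕ}

/-! ### Lattice vectors -/

theorem toReal_injective : Function.Injective (toReal : (Fin n → ℤ) → Fin n → ℝ) :=
  fun _ _ h => funext fun i => Int.cast_injective (congrFun h i)

theorem toReal_zero : toReal (0 : Fin n → ℤ) = 0 := by
  ext; simp [toReal]

theorem toReal_add (v w : Fin n → ℤ) : toReal (v + w) = toReal v + toReal w := by
  ext; simp [toReal]

theorem toReal_neg (v : Fin n → ℤ) : toReal (-v) = -toReal v := by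
  ext; simp [toReal]

theorem toReal_sub (v w : Fin n → ℤ) : toReal (v - w) = toReal v - toReal w := by
  ext; simp [toReal]

theorem toReal_smul (d : ℤ) (v : Fin n → ℤ) : toReal (d • v) = (d : ℝ) • toReal v := by
  ext; simp [toReal]

theorem toReal_dotProduct (m v : Fin n → ℤ) : toReal m ⬝ᵥ toReal v = ((m ⬝ᵥ v : ℤ) : ℝ) := by
  simp [dotProduct, toReal]

theorem toReal_single (j : Fin n) : toReal (Pi.single j 1) = Pi.single j 1 := by
  ext i
  simp [toReal, Pi.single_apply]

/-- The dual basis, in the lattice `M`, of a basis of the lattice `N`. -/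
def dualVec (b : Module.Basis (Fin n) ℤ (Fin n → ℤ)) (i : Fin n) : Fin n → ℤ :=
  (dotProductEquiv ℤ (Fin n)).symm (b.coord i)

theorem dualVec_dotProduct (b : Module.Basis (Fin n) ℤ (Fin n → ℤ)) (i : Fin n) (w : Fin n → ℤ) :
    dualVec b i ⬝ᵥ w = b.repr w i :=
  LinearMap.congr_fun ((dotProductEquiv ℤ (Fin n)).apply_symm_apply (b.coord i)) w

theorem dualVec_dotProduct_basis (b : Module.Basis (Fin n) ℤ (Fin n → ℤ)) (i j : Fin n) :
    dualVec b i ⬝ᵥ b j = if j = i then 1 else 0 := by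
  rw [dualVec_dotProduct, b.repr_self, Finsupp.single_apply]

theorem sum_dualVec_smul (b : Module.Basis (Fin n) ℤ (Fin n → ℤ)) (x : Fin n → ℝ) :
    ∑ i, (toReal (dualVec b i) ⬝ᵥ x) • toReal (b i) = x := by
  let L : (Fin n → ℝ) →ₗ[ℝ] Fin n → ℝ :=
    ∑ i, (dotProductEquiv ℝ (Fin n) (toReal (dualVec b i))).smulRight (toReal (b i))
  have hL (y : Fin n → ℝ) : L y = ∑ i, (toReal (dualVec b i) ⬝ᵥ y) • toReal (b i) := by
    simp [L]
  have hone : L = LinearMap.id := by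
    refine LinearMap.pi_ext' fun j => LinearMap.ext_ring ?_
    have hrepr := congrArg toReal (b.sum_repr (Pi.single j 1))
    rw [toReal_single] at hrepr
    simp only [LinearMap.comp_apply, LinearMap.coe_single, LinearMap.id_apply, hL,
      ← toReal_single j, toReal_dotProduct, dualVec_dotProduct]
    rw [toReal_single, ← hrepr]
    ext l
    simp [toReal]
  rw [← hL, hone, LinearMap.id_apply]

theorem exists_forall_eq_dotProduct (f : (Fin n → ℝ) →ₗ[ℝ] ℝ) :
    ∃ m : Fin n → ℝ, ∀ x, f x = m ⬝ᵥ x :=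
  ⟨(dotProductEquiv ℝ (Fin n)).symm f, fun x =>
    (LinearMap.congr_fun ((dotProductEquiv ℝ (Fin n)).apply_symm_apply f) x).symm⟩

theorem IsPrimitive.ne_zero {v : Fin n → ℤ} (hv : IsPrimitive v) : v ≠ 0 :=
  fun h => not_isUnit_zero (hv 0 0 (by simpa using h))

theorem isPrimitive_of_dotProduct_eq_one {v m : Fin n → ℤ} (h : m ⬝ᵥ v = 1) : IsPrimitive v := by
  rintro d w rfl
  rw [dotProduct_smul, smul_eq_mul] at h
  exact .of_mul_eq_one _ h

theorem exists_isPrimitive_smul {w : Fin n → ℤ} (hw : w ≠ 0) :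
    ∃ (g : ℤ) (v : Fin n → ℤ), 0 < g ∧ IsPrimitive v ∧ w = g • v := by
  obtain ⟨i, hi⟩ := Function.ne_iff.1 hw
  have hgcd : Finset.univ.gcd w ≠ 0 :=
    fun h => hi (Finset.gcd_eq_zero_iff.1 h i (Finset.mem_univ i))
  obtain ⟨v, hwv, hv⟩ := Finset.extract_gcd w ⟨i, Finset.mem_univ i⟩
  refine ⟨Finset.univ.gcd w, v, ?_, ?_, funext fun j => hwv j (Finset.mem_univ j)⟩
  · have hnorm : normalize (Finset.univ.gcd w) = Finset.univ.gcd w := Finset.normalize_gcd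
    exact lt_of_le_of_ne (Int.nonneg_of_normalize_eq_self hnorm) hgcd.symm
  · rintro d u rfl
    exact isUnit_of_dvd_one (hv ▸ Finset.dvd_gcd fun j _ => ⟨u j, rfl⟩)

theorem IsPrimitive.eq_of_toReal_eq_smul {g v m : Fin n → ℤ} (hg : IsPrimitive g)
    (hm : m ⬝ᵥ v = 1) {t : ℝ} (ht : 0 ≤ t) (h : toReal g = t • toReal v) : g = v := by
  have hmg : ((m ⬝ᵥ g : ℤ) : ℝ) = t := by
    rw [← toReal_dotProduct, h, dotProduct_smul, toReal_dotProduct, hm, Int.cast_one, smul_eq_mul,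
      mul_one]
  have hgv : g = (m ⬝ᵥ g) • v := toReal_injective (by rw [toReal_smul, hmg, h])
  have hpos : 0 ≤ m ⬝ᵥ g := by exact_mod_cast hmg.symm ▸ ht
  have hone : m ⬝ᵥ g = 1 := (Int.isUnit_iff.1 (hg _ _ hgv)).resolve_right (by omega)
  rwa [hone, one_smul] at hgv

/-! ### Unimodular cones -/

/-- The combination of lattice vectors with given real coefficients. -/
abbrev realize : ((Fin n → ℤ) →₀ ℝ) →ₗ[ℝ] (Fin n → ℝ) := Finsupp.linearCombination ℝ toReal

theorem realize_single (v : Fin n → ℤ) (t : ℝ) :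
    realize (Finsupp.single v t) = t • toReal v :=
  Finsupp.linearCombination_single ..

theorem realize_eq_sum {F : Finset (Fin n → ℤ)} {c : (Fin n → ℤ) →₀ ℝ} (hc : c.support ⊆ F) :
    realize c = ∑ v ∈ F, c v • toReal v := by
  rw [realize, Finsupp.linearCombination_apply,
    Finsupp.sum_of_support_subset c hc (fun v t => t • toReal v) fun _ _ => zero_smul ..]

/-- The cone spanned by a finite set of lattice vectors. -/
abbrev coneOf (F : Finset (Fin n → ℤ)) : Cone n :=
  PointedCone.hull ℝ (toReal '' (F : Set (Fin n → ℤ)))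

theorem mem_coneOf {F : Finset (Fin n → ℤ)} {x : Fin n → ℝ} :
    x ∈ coneOf F ↔ ∃ c : (Fin n → ℤ) →₀ ℝ, (∀ v, 0 ≤ c v) ∧ c.support ⊆ F ∧ realize c = x := by
  simp only [mem_hull_image_iff, Finset.coe_subset]

theorem toReal_mem_coneOf {F : Finset (Fin n → ℤ)} {v : Fin n → ℤ} (hv : v ∈ F) :
    toReal v ∈ coneOf F := Submodule.subset_span ⟨v, hv, rfl⟩

theorem coneOf_le {F : Finset (Fin n → ℤ)} {σ : Cone n} :
    coneOf F ≤ σ ↔ ∀ v ∈ F, toReal v ∈ σ :=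
  Submodule.span_le.trans Set.image_subset_iff

theorem coneOf_mono {F G : Finset (Fin n → ℤ)} (h : F ⊆ G) : coneOf F ≤ coneOf G :=
  coneOf_le.2 fun _ hv => toReal_mem_coneOf (h hv)

theorem coneOf_singleton (v : Fin n → ℤ) : coneOf {v} = rayCone v := by
  rw [coneOf, rayCone, Finset.coe_singleton, Set.image_singleton]

theorem mem_rayCone {v : Fin n → ℤ} {x : Fin n → ℝ} :
    x ∈ rayCone v ↔ ∃ t : ℝ, 0 ≤ t ∧ x = t • toReal v := by
  refine Submodule.mem_span_singleton.trans ⟨?_, ?_⟩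
  · rintro ⟨t, rfl⟩
    exact ⟨t, t.2, rfl⟩
  · rintro ⟨t, ht, rfl⟩
    exact ⟨⟨t, ht⟩, rfl⟩

/-- Finite sets of lattice vectors that are part of a basis of the lattice. -/
def IsUnimodular (F : Finset (Fin n → ℤ)) : Prop :=
  ∃ b : Module.Basis (Fin n) ℤ (Fin n → ℤ), ∀ v ∈ F, v ∈ Set.range b

theorem IsUnimodular.mono {F G : Finset (Fin n → ℤ)} (hG : IsUnimodular G) (h : F ⊆ G) :
    IsUnimodular F :=
  hG.imp fun _ hb v hv => hb v (h hv)

theorem IsUnimodular.exists_dual {F : Finset (Fin n → ℤ)} (hF : IsUnimodular F)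
    {v : Fin n → ℤ} (hv : v ∈ F) : ∃ m : Fin n → ℤ, m ⬝ᵥ v = 1 ∧ (∀ w ∈ F, w ≠ v → m ⬝ᵥ w = 0) ∧
      ∀ c : (Fin n → ℤ) →₀ ℝ, c.support ⊆ F → toReal m ⬝ᵥ realize c = c v := by
  obtain ⟨b, hb⟩ := hF
  obtain ⟨i, rfl⟩ := hb v hv
  have hone : dualVec b i ⬝ᵥ b i = 1 := by rw [dualVec_dotProduct_basis, if_pos rfl]
  have hzero : ∀ w ∈ F, w ≠ b i → dualVec b i ⬝ᵥ w = 0 := by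
    intro w hw hne
    obtain ⟨j, rfl⟩ := hb w hw
    rw [dualVec_dotProduct_basis, if_neg fun hji => hne (congrArg b hji)]
  refine ⟨dualVec b i, hone, hzero, fun c hc => ?_⟩
  rw [realize_eq_sum hc, dotProduct_sum, Finset.sum_eq_single_of_mem (b i) hv]
  · simp [toReal_dotProduct, hone]
  · intro w hw hne
    simp [toReal_dotProduct, hzero w hw hne]

theorem IsUnimodular.realize_inj {F : Finset (Fin n → ℤ)} (hF : IsUnimodular F)
    {c d : (Fin n → ℤ) →₀ ℝ} (hc : c.support ⊆ F) (hd : d.support ⊆ F)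
    (h : realize c = realize d) : c = d := by
  ext v
  by_cases hv : v ∈ F
  · obtain ⟨m, -, -, hm⟩ := hF.exists_dual hv
    rw [← hm c hc, ← hm d hd, h]
  · rw [Finsupp.notMem_support_iff.1 fun h' => hv (hc h'),
      Finsupp.notMem_support_iff.1 fun h' => hv (hd h')]

theorem IsUnimodular.linearIndepOn {F : Finset (Fin n → ℤ)} (hF : IsUnimodular F) :
    LinearIndepOn ℝ toReal (F : Set (Fin n → ℤ)) :=
  linearIndepOn_iffₛ.2 fun _ hc _ hd h =>
    hF.realize_inj (Finset.coe_subset.1 hc) (Finset.coe_subset.1 hd) h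

theorem IsUnimodular.isPrimitive {F : Finset (Fin n → ℤ)} (hF : IsUnimodular F)
    {v : Fin n → ℤ} (hv : v ∈ F) : IsPrimitive v := by
  obtain ⟨m, hm, -⟩ := hF.exists_dual hv
  exact isPrimitive_of_dotProduct_eq_one hm

theorem isFaceOf_coneOf {F G : Finset (Fin n → ℤ)} (hF : IsUnimodular F) (h : G ⊆ F) :
    (coneOf G).IsFaceOf (coneOf F) :=
  isFaceOf_hull_image hF.linearIndepOn (Finset.coe_subset.2 h)

theorem toReal_mem_of_realize_mem {F : Finset (Fin n → ℤ)} {τ : Cone n}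
    (hτ : τ.IsFaceOf (coneOf F)) {c : (Fin n → ℤ) →₀ ℝ} (hc : ∀ v, 0 ≤ c v)
    (hcs : c.support ⊆ F) (h : realize c ∈ τ) {v : Fin n → ℤ} (hv : v ∈ c.support) :
    toReal v ∈ τ :=
  mem_of_isFaceOf_hull_image hτ hc (Finset.coe_subset.2 hcs) h hv

open Classical in
theorem eq_coneOf_of_isFaceOf {F : Finset (Fin n → ℤ)} {τ : Cone n}
    (hτ : τ.IsFaceOf (coneOf F)) : τ = coneOf (F.filter fun v => toReal v ∈ τ) := by
  rw [coneOf, Finset.coe_filter]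
  exact eq_hull_image_of_isFaceOf hτ

theorem mem_of_isFaceOf_rayCone {F : Finset (Fin n → ℤ)} (hF : IsUnimodular F)
    {v m : Fin n → ℤ} (hm : m ⬝ᵥ v = 1) (hface : (rayCone v).IsFaceOf (coneOf F)) : v ∈ F := by
  have hv : toReal v ∈ rayCone v := mem_rayCone.2 ⟨1, zero_le_one, (one_smul ..).symm⟩
  obtain ⟨c, hc, hcs, hcv⟩ := mem_coneOf.1 (hface.le hv)
  have hne : c.support.Nonempty := by
    rw [Finsupp.support_nonempty_iff]
    rintro rfl
    rw [map_zero, ← toReal_zero] at hcv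
    exact (isPrimitive_of_dotProduct_eq_one hm).ne_zero (toReal_injective hcv).symm
  obtain ⟨g, hg⟩ := hne
  obtain ⟨t, ht, hgt⟩ := mem_rayCone.1 (toReal_mem_of_realize_mem hface hc hcs (hcv ▸ hv) hg)
  rw [← (hF.isPrimitive (hcs hg)).eq_of_toReal_eq_smul hm ht hgt]
  exact hcs hg

theorem subset_of_coneOf_eq {F G : Finset (Fin n → ℤ)} (hF : IsUnimodular F)
    (hG : IsUnimodular G) (h : coneOf F = coneOf G) : F ⊆ G := by
  intro v hv
  obtain ⟨m, hm, -⟩ := hF.exists_dual hv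
  refine mem_of_isFaceOf_rayCone hG hm ?_
  rw [← coneOf_singleton, ← h]
  exact isFaceOf_coneOf hF (Finset.singleton_subset_iff.2 hv)

theorem coneOf_injOn : Set.InjOn (coneOf (n := n)) {F | IsUnimodular F} :=
  fun _ hF _ hG h => (subset_of_coneOf_eq hF hG h).antisymm (subset_of_coneOf_eq hG hF h.symm)

theorem isSmoothCone_iff {σ : Cone n} : IsSmoothCone σ ↔ ∃ F, IsUnimodular F ∧ coneOf F = σ := by
  classical
  constructor
  · rintro ⟨b, s, rfl⟩
    refine ⟨s.toFinset.image b, ⟨b, fun v hv => ?_⟩, ?_⟩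
    · obtain ⟨i, -, rfl⟩ := Finset.mem_image.1 hv
      exact ⟨i, rfl⟩
    · rw [coneOf, Finset.coe_image, Set.coe_toFinset, Set.image_image]
  · rintro ⟨F, ⟨b, hb⟩, rfl⟩
    refine ⟨b, b ⁻¹' F, ?_⟩
    rw [coneOf, ← Set.image_image toReal b, Set.image_preimage_eq_of_subset hb]

/-! ### Smooth complete fans as simplicial complexes -/

/-- A smooth complete fan, given by the sets of primitive generators of its cones: every point of
the space is a combination, with positive coefficients, of the elements of exactly one of them. -/
structure UnimodularComplex (n : ℕ) where
  faces : Set (Finset (Fin n → ℤ))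
  finite : faces.Finite
  unimodular : ∀ F ∈ faces, IsUnimodular F
  down_closed : ∀ F ∈ faces, ∀ G ⊆ F, G ∈ faces
  exists_rep : ∀ x : Fin n → ℝ, ∃ c : (Fin n → ℤ) →₀ ℝ,
    (∀ v, 0 ≤ c v) ∧ c.support ∈ faces ∧ realize c = x
  rep_unique : ∀ c d : (Fin n → ℤ) →₀ ℝ, (∀ v, 0 ≤ c v) → c.support ∈ faces → (∀ v, 0 ≤ d v) →
    d.support ∈ faces → realize c = realize d → c = d

theorem UnimodularComplex.coneOf_inf (K : UnimodularComplex n) [DecidableEq (Fin n → ℤ)]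
    {F G : Finset (Fin n → ℤ)} (hF : F ∈ K.faces) (hG : G ∈ K.faces) :
    coneOf F ⊓ coneOf G = coneOf (F ∩ G) := by
  apply le_antisymm
  · rintro x ⟨hxF, hxG⟩
    obtain ⟨c, hc, hcs, rfl⟩ := mem_coneOf.1 hxF
    obtain ⟨d, hd, hds, hcd⟩ := mem_coneOf.1 hxG
    obtain rfl : d = c :=
      K.rep_unique d c hd (K.down_closed G hG _ hds) hc (K.down_closed F hF _ hcs) hcd
    exact mem_coneOf.2 ⟨d, hd, Finset.subset_inter hcs hds, rfl⟩
  · exact le_inf (coneOf_mono Finset.inter_subset_left) (coneOf_mono Finset.inter_subset_right)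

/-- The fan of a complex. -/
def UnimodularComplex.toFan (K : UnimodularComplex n) : Fan n where
  cones := coneOf '' K.faces
  finite := K.finite.image _
  smooth := by
    rintro _ ⟨F, hF, rfl⟩
    exact isSmoothCone_iff.2 ⟨F, K.unimodular F hF, rfl⟩
  face_mem := by
    classical
    rintro _ ⟨F, hF, rfl⟩ τ hτ
    rw [eq_coneOf_of_isFaceOf hτ]
    exact ⟨_, K.down_closed F hF _ (Finset.filter_subset _ _), rfl⟩
  inter_face := by
    classical
    rintro _ ⟨F, hF, rfl⟩ _ ⟨G, hG, rfl⟩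
    rw [K.coneOf_inf hF hG]
    exact ⟨isFaceOf_coneOf (K.unimodular F hF) Finset.inter_subset_left,
      isFaceOf_coneOf (K.unimodular G hG) Finset.inter_subset_right⟩
  complete x := by
    obtain ⟨c, hc, hcs, rfl⟩ := K.exists_rep x
    exact ⟨_, ⟨_, hcs, rfl⟩, mem_coneOf.2 ⟨c, hc, subset_rfl, rfl⟩⟩

theorem Fan.exists_rep (S : Fan n) (x : Fin n → ℝ) : ∃ c : (Fin n → ℤ) →₀ ℝ,
    (∀ v, 0 ≤ c v) ∧ (IsUnimodular c.support ∧ coneOf c.support ∈ S.cones) ∧ realize c = x := by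
  obtain ⟨σ, hσ, hx⟩ := S.complete x
  obtain ⟨F, hF, rfl⟩ := isSmoothCone_iff.1 (S.smooth σ hσ)
  obtain ⟨c, hc, hcs, rfl⟩ := mem_coneOf.1 hx
  exact ⟨c, hc, ⟨hF.mono hcs, S.face_mem _ hσ _ (isFaceOf_coneOf hF hcs)⟩, rfl⟩

theorem Fan.coneOf_le_of_realize_mem (S : Fan n) {c : (Fin n → ℤ) →₀ ℝ} (hc : ∀ v, 0 ≤ c v)
    (hcs : coneOf c.support ∈ S.cones) {τ : Cone n} (hτ : τ ∈ S.cones) (h : realize c ∈ τ) :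
    coneOf c.support ≤ τ := by
  have hmem : realize c ∈ coneOf c.support := mem_coneOf.2 ⟨c, hc, subset_rfl, rfl⟩
  exact coneOf_le.2 fun v hv =>
    (toReal_mem_of_realize_mem (S.inter_face _ hcs _ hτ).1 hc subset_rfl ⟨hmem, h⟩ hv).2

/-- The complex of a fan. -/
def Fan.toComplex (S : Fan n) : UnimodularComplex n where
  faces := {F | IsUnimodular F ∧ coneOf F ∈ S.cones}
  finite := by
    refine Set.Finite.of_finite_image (f := coneOf) (S.finite.subset ?_)
      (coneOf_injOn.mono fun F hF => hF.1)
    rintro _ ⟨F, hF, rfl⟩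
    exact hF.2
  unimodular F hF := hF.1
  down_closed F hF G hG := ⟨hF.1.mono hG, S.face_mem _ hF.2 _ (isFaceOf_coneOf hF.1 hG)⟩
  exists_rep := S.exists_rep
  rep_unique c d hc hcs hd hds h := by
    have hcd : coneOf c.support ≤ coneOf d.support := S.coneOf_le_of_realize_mem hc hcs.2 hds.2
      (h ▸ mem_coneOf.2 ⟨d, hd, subset_rfl, rfl⟩)
    have hdc : coneOf d.support ≤ coneOf c.support := S.coneOf_le_of_realize_mem hd hds.2 hcs.2
      (h ▸ mem_coneOf.2 ⟨c, hc, subset_rfl, rfl⟩)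
    exact hcs.1.realize_inj subset_rfl (coneOf_injOn hcs.1 hds.1 (hcd.antisymm hdc)).ge h

theorem Fan.toComplex_toFan_cones (S : Fan n) : S.toComplex.toFan.cones = S.cones := by
  ext σ
  constructor
  · rintro ⟨F, hF, rfl⟩
    exact hF.2
  · intro hσ
    obtain ⟨F, hF, rfl⟩ := isSmoothCone_iff.1 (S.smooth σ hσ)
    exact ⟨F, ⟨hF, hσ⟩, rfl⟩

theorem Fan.Subdivides.refl (S : Fan n) : S.Subdivides S := fun σ hσ => ⟨σ, hσ, le_rfl⟩

theorem Fan.Subdivides.trans {S S' S'' : Fan n} (h : S''.Subdivides S') (h' : S'.Subdivides S) :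
    S''.Subdivides S := by
  intro σ hσ
  obtain ⟨τ, hτ, hστ⟩ := h σ hσ
  obtain ⟨ρ, hρ, hτρ⟩ := h' τ hτ
  exact ⟨ρ, hρ, hστ.trans hτρ⟩

/-! ### Star subdivisions -/

theorem IsUnimodular.transvection {F G : Finset (Fin n → ℤ)} (hG : IsUnimodular G)
    {a b : Fin n → ℤ} (ha : a ∈ G) (hb : b ∈ G) (hab : a ≠ b)
    (h : ∀ v ∈ F, v = a + b ∨ (v ∈ G ∧ v ≠ b)) : IsUnimodular F := by
  obtain ⟨B, hB⟩ := hG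
  obtain ⟨i, rfl⟩ := hB a ha
  obtain ⟨j, rfl⟩ := hB b hb
  have hij : i ≠ j := fun hij => hab (congrArg B hij)
  let e : (Fin n → ℤ) ≃ₗ[ℤ] (Fin n → ℤ) :=
    LinearEquiv.transvection (f := B.coord j) (v := B i) (by simp [hij])
  have he (l : Fin n) : e (B l) = B l + B.coord j (B l) • B i := rfl
  refine ⟨B.map e, fun v hv => ?_⟩
  rcases h v hv with rfl | ⟨hvG, hvb⟩
  · exact ⟨j, by simp [he, add_comm]⟩
  · obtain ⟨l, rfl⟩ := hB v hvG
    have hlj : l ≠ j := fun hlj => hvb (congrArg B hlj)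
    exact ⟨l, by simp [he, hlj]⟩

/-- Moving the amount `t` from the coefficients of `a` and `b` to the coefficient of `a + b`. -/
def transfer (a b : Fin n → ℤ) (t : ℝ) (c : (Fin n → ℤ) →₀ ℝ) : (Fin n → ℤ) →₀ ℝ :=
  c - Finsupp.single a t - Finsupp.single b t + Finsupp.single (a + b) t

section Transfer

variable {a b : Fin n → ℤ} (t : ℝ) (c : (Fin n → ℤ) →₀ ℝ)

theorem realize_transfer : realize (transfer a b t c) = realize c := by
  simp only [transfer, map_add, map_sub, realize_single, toReal_add, smul_add]
  abel

theorem transfer_zero : transfer a b 0 c = c := by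
  simp [transfer]

theorem transfer_left (hb : b ≠ 0) (hne : a ≠ b) : transfer a b t c a = c a - t := by
  simp [transfer, hne, hb]

theorem transfer_right (ha : a ≠ 0) (hne : a ≠ b) : transfer a b t c b = c b - t := by
  simp [transfer, hne, ha]

theorem transfer_add (ha : a ≠ 0) (hb : b ≠ 0) : transfer a b t c (a + b) = c (a + b) + t := by
  simp [transfer, ha, hb]

theorem transfer_of_ne {v : Fin n → ℤ} (hva : v ≠ a) (hvb : v ≠ b) (hvab : v ≠ a + b) :
    transfer a b t c v = c v := by
  simp [transfer, hva, hvb, hvab]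

variable {t c}

theorem transfer_nonneg (ha : a ≠ 0) (hb : b ≠ 0) (hne : a ≠ b) (hc : ∀ v, 0 ≤ c v)
    (hta : t ≤ c a) (htb : t ≤ c b) (ht : 0 ≤ c (a + b) + t) (v : Fin n → ℤ) :
    0 ≤ transfer a b t c v := by
  rcases eq_or_ne v a with rfl | hva
  · rwa [transfer_left t c hb hne, sub_nonneg]
  rcases eq_or_ne v b with rfl | hvb
  · rwa [transfer_right t c ha hne, sub_nonneg]
  rcases eq_or_ne v (a + b) with rfl | hvab
  · rwa [transfer_add t c ha hb]
  rw [transfer_of_ne t c hva hvb hvab]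
  exact hc v

theorem erase_support_transfer_subset [DecidableEq (Fin n → ℤ)] :
    (transfer a b t c).support.erase (a + b) ⊆
      insert a (insert b (c.support.erase (a + b))) := by
  intro v hv
  obtain ⟨hvab, hv⟩ := Finset.mem_erase.1 hv
  rcases eq_or_ne v a with rfl | hva
  · exact Finset.mem_insert_self ..
  rcases eq_or_ne v b with rfl | hvb
  · exact Finset.mem_insert_of_mem (Finset.mem_insert_self ..)
  rw [Finsupp.mem_support_iff, transfer_of_ne t c hva hvb hvab, ← Finsupp.mem_support_iff] at hv
  exact Finset.mem_insert_of_mem (Finset.mem_insert_of_mem (Finset.mem_erase.2 ⟨hvab, hv⟩))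

end Transfer

namespace UnimodularComplex

variable (K : UnimodularComplex n) {a b : Fin n → ℤ}

theorem ne_zero {F : Finset (Fin n → ℤ)} (hF : F ∈ K.faces) {v : Fin n → ℤ} (hv : v ∈ F) :
    v ≠ 0 :=
  ((K.unimodular F hF).isPrimitive hv).ne_zero

open Classical in
theorem add_notMem (hne : a ≠ b) (hab : {a, b} ∈ K.faces) {F : Finset (Fin n → ℤ)}
    (hF : F ∈ K.faces) : a + b ∉ F := by
  intro hw
  have hb : b ≠ 0 := K.ne_zero hab (by simp)
  have hsingle (v w : Fin n → ℤ) : 0 ≤ Finsupp.single v (1 : ℝ) w :=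
    Finsupp.single_nonneg.2 zero_le_one w
  have hcoeff : Finsupp.single (a + b) (1 : ℝ) = Finsupp.single a 1 + Finsupp.single b 1 := by
    refine K.rep_unique _ _ (hsingle _) (K.down_closed F hF _ ?_)
      (fun v => add_nonneg (hsingle a v) (hsingle b v)) (K.down_closed _ hab _ ?_) ?_
    · exact Finsupp.support_single_subset.trans (Finset.singleton_subset_iff.2 hw)
    · exact Finsupp.support_add.trans (Finset.union_subset_union
        Finsupp.support_single_subset Finsupp.support_single_subset)
    · simp only [map_add, realize_single, toReal_add, one_smul]
  have hval := DFunLike.congr_fun hcoeff a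
  simp [hb, hne.symm] at hval

open Classical in
/-- The sets of generators of the cones of the star subdivision at `a + b`. -/
def starFaces (a b : Fin n → ℤ) : Set (Finset (Fin n → ℤ)) :=
  {F | ¬ (a ∈ F ∧ b ∈ F) ∧
    (F ∈ K.faces ∨ (a + b ∈ F ∧ insert a (insert b (F.erase (a + b))) ∈ K.faces))}

theorem starFaces_finite (a b : Fin n → ℤ) : (K.starFaces a b).Finite := by
  classical
  refine (K.finite.biUnion fun G _ => (insert (a + b) G).powerset.finite_toSet).subset ?_
  rintro F ⟨-, hF | ⟨-, hF⟩⟩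
  · exact Set.mem_biUnion hF (Finset.mem_coe.2 (Finset.mem_powerset.2 (Finset.subset_insert _ _)))
  · refine Set.mem_biUnion hF (Finset.mem_coe.2 (Finset.mem_powerset.2 fun v hv => ?_))
    by_cases h : v = a + b <;> simp [h, hv]

theorem starFaces_down_closed {F G : Finset (Fin n → ℤ)} (hF : F ∈ K.starFaces a b) (hG : G ⊆ F) :
    G ∈ K.starFaces a b := by
  classical
  refine ⟨fun h => hF.1 ⟨hG h.1, hG h.2⟩, ?_⟩
  rcases hF.2 with hF | ⟨-, hF⟩
  · exact .inl (K.down_closed F hF G hG)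
  by_cases hw : a + b ∈ G
  · exact .inr ⟨hw, K.down_closed _ hF _ (Finset.insert_subset_insert _
      (Finset.insert_subset_insert _ (Finset.erase_subset_erase _ hG)))⟩
  · refine .inl (K.down_closed _ hF _ fun v hv => ?_)
    have hvw : v ≠ a + b := fun h => hw (h ▸ hv)
    simp [hvw, hG hv]

theorem starFaces_unimodular (hne : a ≠ b) {F : Finset (Fin n → ℤ)} (hF : F ∈ K.starFaces a b) :
    IsUnimodular F := by
  classical
  obtain ⟨hn, hF | ⟨-, hF⟩⟩ := hF
  · exact K.unimodular F hF
  by_cases hbF : b ∈ F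
  · have haF : a ∉ F := fun h => hn ⟨h, hbF⟩
    refine (K.unimodular _ hF).transvection (a := b) (b := a) (by simp) (by simp) hne.symm
      fun v hv => ?_
    rw [add_comm b a]
    exact or_iff_not_imp_left.2 fun h => ⟨by simp [h, hv], fun hva => haF (hva ▸ hv)⟩
  · refine (K.unimodular _ hF).transvection (a := a) (b := b) (by simp) (by simp) hne
      fun v hv => ?_
    exact or_iff_not_imp_left.2 fun h => ⟨by simp [h, hv], fun hvb => hbF (hvb ▸ hv)⟩

open Classical in
theorem exists_starFaces_rep (hne : a ≠ b) (hab : {a, b} ∈ K.faces) (x : Fin n → ℝ) :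
    ∃ c : (Fin n → ℤ) →₀ ℝ, (∀ v, 0 ≤ c v) ∧ c.support ∈ K.starFaces a b ∧ realize c = x := by
  have ha : a ≠ 0 := K.ne_zero hab (by simp)
  have hb : b ≠ 0 := K.ne_zero hab (by simp)
  obtain ⟨c, hc, hcs, rfl⟩ := K.exists_rep x
  have hcw : c (a + b) = 0 := Finsupp.notMem_support_iff.1 (K.add_notMem hne hab hcs)
  set t := min (c a) (c b)
  have ht0 : 0 ≤ t := le_min (hc a) (hc b)
  refine ⟨transfer a b t c, transfer_nonneg ha hb hne hc (min_le_left _ _) (min_le_right _ _)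
    (by rwa [hcw, zero_add]), ⟨?_, ?_⟩, realize_transfer t c⟩
  · rw [Finsupp.mem_support_iff, Finsupp.mem_support_iff, transfer_left t c hb hne,
      transfer_right t c ha hne, sub_ne_zero, sub_ne_zero]
    rintro ⟨hta, htb⟩
    exact (min_choice (c a) (c b)).elim (fun h => hta h.symm) fun h => htb h.symm
  rcases ht0.eq_or_lt with h0 | h0
  · rw [← h0, transfer_zero]
    exact .inl hcs
  refine .inr ⟨?_, K.down_closed _ hcs _ ?_⟩
  · rw [Finsupp.mem_support_iff, transfer_add t c ha hb, hcw, zero_add]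
    exact h0.ne'
  · have hac : a ∈ c.support := Finsupp.mem_support_iff.2 (h0.trans_le (min_le_left _ _)).ne'
    have hbc : b ∈ c.support := Finsupp.mem_support_iff.2 (h0.trans_le (min_le_right _ _)).ne'
    refine Finset.insert_subset hac (Finset.insert_subset hbc
      (erase_support_transfer_subset.trans ?_))
    exact Finset.insert_subset hac (Finset.insert_subset hbc (Finset.erase_subset _ _))

open Classical in
theorem support_transfer_mem_faces (hne : a ≠ b) (hab : {a, b} ∈ K.faces)
    {c : (Fin n → ℤ) →₀ ℝ} (hcs : c.support ∈ K.starFaces a b) :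
    (transfer a b (-c (a + b)) c).support ∈ K.faces := by
  have hw := transfer_add (-c (a + b)) c (K.ne_zero hab (v := a) (by simp))
    (K.ne_zero hab (v := b) (by simp))
  rw [add_neg_cancel, ← Finsupp.notMem_support_iff] at hw
  rcases hcs.2 with h | ⟨-, h⟩
  · rwa [Finsupp.notMem_support_iff.1 (K.add_notMem hne hab h), neg_zero, transfer_zero]
  · rw [← Finset.erase_eq_of_notMem hw]
    exact K.down_closed _ h _ erase_support_transfer_subset

open Classical in
theorem apply_add_eq_min_transfer (hne : a ≠ b) (hab : {a, b} ∈ K.faces)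
    {c : (Fin n → ℤ) →₀ ℝ} (hc : ∀ v, 0 ≤ c v) (hcs : c.support ∈ K.starFaces a b) :
    c (a + b) = min (transfer a b (-c (a + b)) c a) (transfer a b (-c (a + b)) c b) := by
  rw [transfer_left _ c (K.ne_zero hab (v := b) (by simp)) hne,
    transfer_right _ c (K.ne_zero hab (v := a) (by simp)) hne, sub_neg_eq_add, sub_neg_eq_add]
  have hzero : c a = 0 ∨ c b = 0 := by
    by_contra! h
    exact hcs.1 ⟨Finsupp.mem_support_iff.2 h.1, Finsupp.mem_support_iff.2 h.2⟩
  rcases hzero with h | h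
  · rw [h, zero_add, min_eq_left (le_add_of_nonneg_left (hc b))]
  · rw [h, zero_add, min_eq_right (le_add_of_nonneg_left (hc a))]

open Classical in
theorem starFaces_rep_unique (hne : a ≠ b) (hab : {a, b} ∈ K.faces)
    {c d : (Fin n → ℤ) →₀ ℝ} (hc : ∀ v, 0 ≤ c v) (hcs : c.support ∈ K.starFaces a b)
    (hd : ∀ v, 0 ≤ d v) (hds : d.support ∈ K.starFaces a b) (h : realize c = realize d) :
    c = d := by
  have hnonneg {e : (Fin n → ℤ) →₀ ℝ} (he : ∀ v, 0 ≤ e v) (v : Fin n → ℤ) :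
      0 ≤ transfer a b (-e (a + b)) e v :=
    transfer_nonneg (K.ne_zero hab (by simp)) (K.ne_zero hab (by simp)) hne he
      ((neg_nonpos.2 (he _)).trans (he _)) ((neg_nonpos.2 (he _)).trans (he _))
      (add_neg_cancel _).ge v
  have htransfer : transfer a b (-c (a + b)) c = transfer a b (-d (a + b)) d :=
    K.rep_unique _ _ (hnonneg hc) (K.support_transfer_mem_faces hne hab hcs) (hnonneg hd)
      (K.support_transfer_mem_faces hne hab hds) (by rw [realize_transfer, realize_transfer, h])
  have hsum : c (a + b) = d (a + b) := by
    rw [K.apply_add_eq_min_transfer hne hab hc hcs, htransfer,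
      ← K.apply_add_eq_min_transfer hne hab hd hds]
  simpa [transfer, hsum] using htransfer

open Classical in
/-- The star subdivision along a two-dimensional cone. -/
def star (hne : a ≠ b) (hab : {a, b} ∈ K.faces) : UnimodularComplex n where
  faces := K.starFaces a b
  finite := K.starFaces_finite a b
  unimodular _ hF := K.starFaces_unimodular hne hF
  down_closed _ hF _ hG := K.starFaces_down_closed hF hG
  exists_rep := K.exists_starFaces_rep hne hab
  rep_unique _ _ hc hcs hd hds h := K.starFaces_rep_unique hne hab hc hcs hd hds h

open Classical in
theorem star_subdivides (hne : a ≠ b) (hab : {a, b} ∈ K.faces) :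
    (K.star hne hab).toFan.Subdivides K.toFan := by
  rintro _ ⟨F, ⟨-, hF | ⟨-, hF⟩⟩, rfl⟩
  · exact ⟨_, ⟨F, hF, rfl⟩, le_rfl⟩
  · refine ⟨_, ⟨_, hF, rfl⟩, coneOf_le.2 fun v hv => ?_⟩
    by_cases h : v = a + b
    · rw [h, toReal_add]
      exact add_mem (toReal_mem_coneOf (by simp)) (toReal_mem_coneOf (by simp))
    · exact toReal_mem_coneOf (by simp [h, hv])

end UnimodularComplex

/-! ### Subdividing along hyperplanes -/

/-- The cone lies on one side of the hyperplane orthogonal to `m`. -/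
def OneSided (m : Fin n → ℤ) (σ : Cone n) : Prop :=
  (∀ u ∈ σ, 0 ≤ toReal m ⬝ᵥ u) ∨ (∀ u ∈ σ, toReal m ⬝ᵥ u ≤ 0)

theorem OneSided.mono {m : Fin n → ℤ} {σ τ : Cone n} (h : OneSided m τ) (hle : σ ≤ τ) :
    OneSided m σ :=
  h.imp (fun h u hu => h u (hle hu)) (fun h u hu => h u (hle hu))

theorem OneSided.neg {m : Fin n → ℤ} {σ : Cone n} (h : OneSided m σ) : OneSided (-m) σ := by
  simpa only [OneSided, toReal_neg, neg_dotProduct, neg_nonneg, neg_nonpos] using h.symm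

theorem dotProduct_nonneg_of_mem_coneOf {m : Fin n → ℤ} {F : Finset (Fin n → ℤ)}
    (h : ∀ v ∈ F, 0 ≤ m ⬝ᵥ v) {u : Fin n → ℝ} (hu : u ∈ coneOf F) : 0 ≤ toReal m ⬝ᵥ u := by
  obtain ⟨c, hc, hcs, rfl⟩ := mem_coneOf.1 hu
  rw [realize_eq_sum hcs, dotProduct_sum]
  refine Finset.sum_nonneg fun v hv => ?_
  rw [dotProduct_smul, toReal_dotProduct, smul_eq_mul]
  exact mul_nonneg (hc v) (by exact_mod_cast h v hv)

theorem dotProduct_nonpos_of_mem_coneOf {m : Fin n → ℤ} {F : Finset (Fin n → ℤ)}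
    (h : ∀ v ∈ F, m ⬝ᵥ v ≤ 0) {u : Fin n → ℝ} (hu : u ∈ coneOf F) : toReal m ⬝ᵥ u ≤ 0 := by
  have hneg := dotProduct_nonneg_of_mem_coneOf (m := -m)
    (fun v hv => by rw [neg_dotProduct]; exact neg_nonneg.2 (h v hv)) hu
  rwa [toReal_neg, neg_dotProduct, neg_nonneg] at hneg

theorem OneSided.dotProduct_nonneg {m : Fin n → ℤ} {c : (Fin n → ℤ) →₀ ℝ} (hc : ∀ v, 0 ≤ c v)
    (h : OneSided m (coneOf c.support)) (h0 : 0 ≤ toReal m ⬝ᵥ realize c) {u : Fin n → ℝ}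
    (hu : u ∈ coneOf c.support) : 0 ≤ toReal m ⬝ᵥ u := by
  refine h.elim (fun h => h u hu) fun h => dotProduct_nonneg_of_mem_coneOf (fun v hv => ?_) hu
  have hterm : ∀ w ∈ c.support, c w * (toReal m ⬝ᵥ toReal w) ≤ 0 := fun w hw =>
    mul_nonpos_of_nonneg_of_nonpos (hc w) (h _ (toReal_mem_coneOf hw))
  rw [realize_eq_sum subset_rfl, dotProduct_sum] at h0
  simp only [dotProduct_smul, smul_eq_mul] at h0
  have hzero := (Finset.sum_eq_zero_iff_of_nonpos hterm).1 ((Finset.sum_nonpos hterm).antisymm h0)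
  have hmv := (mul_eq_zero.1 (hzero v hv)).resolve_left (Finsupp.mem_support_iff.1 hv)
  rw [toReal_dotProduct] at hmv
  exact_mod_cast hmv.ge

namespace UnimodularComplex

open Classical in
/-- The edges `(a, b)` that cross the hyperplane orthogonal to `m`, with `a` on the positive
side. -/
def crossing (K : UnimodularComplex n) (m : Fin n → ℤ) : Set ((Fin n → ℤ) × (Fin n → ℤ)) :=
  {p | {p.1, p.2} ∈ K.faces ∧ 0 < m ⬝ᵥ p.1 ∧ m ⬝ᵥ p.2 < 0}

variable {K : UnimodularComplex n} {m : Fin n → ℤ}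

variable (K m) in
theorem crossing_finite : (K.crossing m).Finite := by
  classical
  refine (K.finite.biUnion fun F _ => Finset.finite_toSet (F ×ˢ F)).subset ?_
  rintro ⟨a, b⟩ ⟨h, -⟩
  exact Set.mem_biUnion h (by simp)

theorem mem_crossing_of_mem_faces {F : Finset (Fin n → ℤ)} (hF : F ∈ K.faces)
    {a b : Fin n → ℤ} (ha : a ∈ F) (hb : b ∈ F) (hma : 0 < m ⬝ᵥ a) (hmb : m ⬝ᵥ b < 0) :
    (a, b) ∈ K.crossing m :=
  ⟨K.down_closed F hF _ (Finset.insert_subset ha (Finset.singleton_subset_iff.2 hb)), hma, hmb⟩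

theorem oneSided_of_crossing_eq_empty (h : K.crossing m = ∅) {σ : Cone n}
    (hσ : σ ∈ K.toFan.cones) : OneSided m σ := by
  obtain ⟨F, hF, rfl⟩ := hσ
  by_cases hnonneg : ∀ v ∈ F, 0 ≤ m ⬝ᵥ v
  · exact .inl fun u hu => dotProduct_nonneg_of_mem_coneOf hnonneg hu
  push Not at hnonneg
  obtain ⟨b, hb, hmb⟩ := hnonneg
  refine .inr fun u hu => dotProduct_nonpos_of_mem_coneOf (fun a ha => ?_) hu
  by_contra! hma
  exact h.subset (mem_crossing_of_mem_faces hF ha hb hma hmb)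

theorem mem_crossing_star {a b : Fin n → ℤ} {N : ℤ}
    (hN : ∀ p ∈ K.crossing m, m ⬝ᵥ p.1 - m ⬝ᵥ p.2 ≤ N) (hab : (a, b) ∈ K.crossing m)
    (hne : a ≠ b) {p : (Fin n → ℤ) × (Fin n → ℤ)} (hp : p ∈ (K.star hne hab.1).crossing m) :
    (p ∈ K.crossing m ∧ p ≠ (a, b)) ∨ m ⬝ᵥ p.1 - m ⬝ᵥ p.2 < N := by
  classical
  obtain ⟨x, y⟩ := p
  obtain ⟨⟨hn, hF⟩, hx : 0 < m ⬝ᵥ x, hy : m ⬝ᵥ y < 0⟩ := hp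
  have ha : 0 < m ⬝ᵥ a := hab.2.1
  have hb : m ⬝ᵥ b < 0 := hab.2.2
  have hmw : m ⬝ᵥ (a + b) = m ⬝ᵥ a + m ⬝ᵥ b := dotProduct_add _ _ _
  rcases hF with hF | ⟨hw, hF⟩
  · refine .inl ⟨⟨hF, hx, hy⟩, fun h => hn ?_⟩
    obtain ⟨rfl, rfl⟩ := Prod.mk.inj h
    exact ⟨Finset.mem_insert_self .., Finset.mem_insert_of_mem (Finset.mem_singleton_self _)⟩
  right
  rcases Finset.mem_insert.1 hw with rfl | hw
  · have hyw : y ≠ a + b := fun h => by rw [h] at hy; omega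
    have hle : m ⬝ᵥ a - m ⬝ᵥ y ≤ N :=
      hN (a, y) (mem_crossing_of_mem_faces hF (by simp) (by simp [hyw]) ha hy)
    change m ⬝ᵥ (a + b) - m ⬝ᵥ y < N
    omega
  · obtain rfl := Finset.mem_singleton.1 hw
    have hxw : x ≠ a + b := fun h => by rw [h] at hx; omega
    have hle : m ⬝ᵥ x - m ⬝ᵥ b ≤ N :=
      hN (x, b) (mem_crossing_of_mem_faces hF (by simp [hxw]) (by simp) hx hb)
    change m ⬝ᵥ x - m ⬝ᵥ (a + b) < N
    omega

theorem exists_subdivides_crossing_lt {N : ℤ}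
    (hK : ∀ p ∈ K.crossing m, m ⬝ᵥ p.1 - m ⬝ᵥ p.2 ≤ N) :
    ∃ K' : UnimodularComplex n, K'.toFan.Subdivides K.toFan ∧
      ∀ p ∈ K'.crossing m, m ⬝ᵥ p.1 - m ⬝ᵥ p.2 < N := by
  induction hc : {p ∈ K.crossing m | m ⬝ᵥ p.1 - m ⬝ᵥ p.2 = N}.ncard
    using Nat.strong_induction_on generalizing K with
  | _ c ih =>
    by_cases hex : ∃ p ∈ K.crossing m, m ⬝ᵥ p.1 - m ⬝ᵥ p.2 = N
    · obtain ⟨⟨a, b⟩, hab, hN⟩ := hex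
      have hne : a ≠ b := by
        rintro rfl
        exact hab.2.1.not_gt hab.2.2
      have hstar : ∀ p ∈ (K.star hne hab.1).crossing m, _ := fun p =>
        mem_crossing_star hK hab hne
      have hfewer : {p ∈ (K.star hne hab.1).crossing m | m ⬝ᵥ p.1 - m ⬝ᵥ p.2 = N}.ncard < c := by
        rw [← hc]
        refine Set.ncard_lt_ncard (Set.ssubset_iff_exists.2 ⟨?_, (a, b), ⟨hab, hN⟩, ?_⟩)
          ((K.crossing_finite m).subset (Set.sep_subset _ _))
        · exact fun p hp => ⟨((hstar p hp.1).resolve_right hp.2.not_lt).1, hp.2⟩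
        · exact fun hp => ((hstar _ hp.1).resolve_right hp.2.not_lt).2 rfl
      obtain ⟨K', hsub, hK'⟩ := ih _ hfewer
        (fun p hp => (hstar p hp).elim (fun h => hK p h.1) le_of_lt) rfl
      exact ⟨K', hsub.trans (K.star_subdivides hne hab.1), hK'⟩
    · push Not at hex
      exact ⟨K, .refl _, fun p hp => (hK p hp).lt_of_ne (hex p hp)⟩

theorem exists_subdivides_crossing_eq_empty {N : ℕ}
    (hK : ∀ p ∈ K.crossing m, m ⬝ᵥ p.1 - m ⬝ᵥ p.2 ≤ N) :
    ∃ K' : UnimodularComplex n, K'.toFan.Subdivides K.toFan ∧ K'.crossing m = ∅ := by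
  induction N generalizing K with
  | zero =>
    refine ⟨K, .refl _, Set.eq_empty_of_forall_notMem fun p hp => ?_⟩
    have hle := hK p hp
    have hpos := hp.2.1
    have hneg := hp.2.2
    omega
  | succ N ih =>
    obtain ⟨K₁, hsub₁, hK₁⟩ := exists_subdivides_crossing_lt hK
    obtain ⟨K₂, hsub₂, hK₂⟩ := ih (K := K₁) fun p hp =>
      Int.lt_add_one_iff.1 (by exact_mod_cast hK₁ p hp)
    exact ⟨K₂, hsub₂.trans hsub₁, hK₂⟩

end UnimodularComplex

theorem Fan.exists_subdivides_oneSided (S : Fan n) (T : Finset (Fin n → ℤ)) :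
    ∃ S' : Fan n, S'.Subdivides S ∧ ∀ σ ∈ S'.cones, ∀ m ∈ T, OneSided m σ := by
  classical
  induction T using Finset.induction_on with
  | empty => exact ⟨S, .refl _, fun _ _ m hm => absurd hm (Finset.notMem_empty m)⟩
  | insert m T _ ih =>
    obtain ⟨S', hS', hT⟩ := ih
    obtain ⟨N, hN⟩ :=
      ((S'.toComplex.crossing_finite m).image fun p => m ⬝ᵥ p.1 - m ⬝ᵥ p.2).bddAbove
    obtain ⟨K, hK, hempty⟩ := UnimodularComplex.exists_subdivides_crossing_eq_empty
      (N := N.toNat) fun p hp => (hN ⟨p, hp, rfl⟩).trans (Int.self_le_toNat N)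
    rw [Fan.Subdivides, S'.toComplex_toFan_cones] at hK
    refine ⟨K.toFan, Fan.Subdivides.trans hK hS', fun σ hσ m' hm' => ?_⟩
    rcases Finset.mem_insert.1 hm' with rfl | hm'
    · exact UnimodularComplex.oneSided_of_crossing_eq_empty hempty hσ
    · obtain ⟨τ, hτ, hle⟩ := hK σ hσ
      exact (hT τ hτ m' hm').mono hle

/-! ### Models -/

theorem mem_hull_basis_iff {b : Module.Basis (Fin n) ℤ (Fin n → ℤ)} {s : Set (Fin n)}
    {x : Fin n → ℝ} :
    x ∈ PointedCone.hull ℝ ((fun i => toReal (b i)) '' s) ↔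
      ∀ i, 0 ≤ toReal (dualVec b i) ⬝ᵥ x ∧ (i ∉ s → toReal (dualVec b i) ⬝ᵥ x = 0) := by
  refine ⟨fun hx i => ?_, fun hx => ?_⟩
  · obtain ⟨c, hc, hcs, rfl⟩ := mem_hull_image_iff.1 hx
    have hci : toReal (dualVec b i) ⬝ᵥ
        Finsupp.linearCombination ℝ (fun i => toReal (b i)) c = c i := by
      rw [Finsupp.linearCombination_apply, Finsupp.sum_fintype c
        (fun i t => t • toReal (b i)) fun _ => zero_smul .., dotProduct_sum]
      simp [toReal_dotProduct, dualVec_dotProduct_basis]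
    rw [hci]
    exact ⟨hc i, fun hi => Finsupp.notMem_support_iff.1 fun h => hi (hcs h)⟩
  · rw [← sum_dualVec_smul b x]
    refine Submodule.sum_mem _ fun i _ => ?_
    by_cases hi : i ∈ s
    · exact (PointedCone.hull ℝ _).smul_mem (hx i).1
        (PointedCone.subset_hull (Set.mem_image_of_mem _ hi))
    · rw [(hx i).2 hi, zero_smul]
      exact Submodule.zero_mem _

theorem exists_nonneg_support_eq (F : Finset (Fin n → ℤ)) :
    ∃ c : (Fin n → ℤ) →₀ ℝ, (∀ v, 0 ≤ c v) ∧ c.support = F := by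
  classical
  refine ⟨Finsupp.indicator F fun _ _ => 1, fun v => ?_, ?_⟩
  · rw [Finsupp.indicator_apply]
    split_ifs <;> simp
  · ext v
    simp [Finsupp.indicator_apply]

theorem Fan.exists_common_subdivision (S S' : Fan n) :
    ∃ S'' : Fan n, S''.Subdivides S ∧ S''.Subdivides S' := by
  classical
  have : Nonempty (Module.Basis (Fin n) ℤ (Fin n → ℤ)) := ⟨Pi.basisFun ℤ (Fin n)⟩
  choose! b s hbs using S'.smooth
  obtain ⟨S'', hS, hT⟩ := S.exists_subdivides_oneSided
    (S'.finite.toFinset.biUnion fun σ => Finset.univ.image (dualVec (b σ)))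
  refine ⟨S'', hS, fun σ hσ => ?_⟩
  obtain ⟨F, hF, rfl⟩ := isSmoothCone_iff.1 (S''.smooth σ hσ)
  obtain ⟨c, hc, rfl⟩ := exists_nonneg_support_eq F
  obtain ⟨τ, hτ, hx⟩ := S'.complete (realize c)
  refine ⟨τ, hτ, fun u hu => ?_⟩
  rw [hbs τ hτ, mem_hull_basis_iff] at hx ⊢
  intro i
  have hside : OneSided (dualVec (b τ) i) (coneOf c.support) := hT _ hσ _ (Finset.mem_biUnion.2
    ⟨τ, S'.finite.mem_toFinset.2 hτ, Finset.mem_image_of_mem _ (Finset.mem_univ i)⟩)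
  have hnonneg := hside.dotProduct_nonneg hc (hx i).1 hu
  refine ⟨hnonneg, fun hi => hnonneg.antisymm' ?_⟩
  have hneg := hside.neg.dotProduct_nonneg hc
    (by rw [toReal_neg, neg_dotProduct, (hx i).2 hi, neg_zero]) hu
  rwa [toReal_neg, neg_dotProduct, neg_nonneg] at hneg

/-! ### Rays -/

theorem toReal_mem_rayCone (v : Fin n → ℤ) : toReal v ∈ rayCone v :=
  PointedCone.subset_hull (Set.mem_singleton _)

theorem IsUnimodular.eq_of_mem_rayCone {F : Finset (Fin n → ℤ)} (hF : IsUnimodular F)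
    {g v : Fin n → ℤ} (hg : g ∈ F) (hv : IsPrimitive v) (h : toReal g ∈ rayCone v) : v = g := by
  obtain ⟨m, hm, -⟩ := hF.exists_dual hg
  obtain ⟨t, ht, hgt⟩ := mem_rayCone.1 h
  have ht0 : t ≠ 0 := by
    rintro rfl
    rw [zero_smul, ← toReal_zero] at hgt
    exact (hF.isPrimitive hg).ne_zero (toReal_injective hgt)
  exact hv.eq_of_toReal_eq_smul hm (inv_nonneg.2 ht) ((inv_smul_eq_iff₀ ht0).2 hgt).symm

theorem support_nonempty_of_realize_eq {c : (Fin n → ℤ) →₀ ℝ} {v : Fin n → ℤ} (hv : v ≠ 0)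
    (h : realize c = toReal v) : c.support.Nonempty := by
  rw [Finsupp.support_nonempty_iff]
  rintro rfl
  rw [map_zero, ← toReal_zero] at h
  exact hv (toReal_injective h).symm

theorem Fan.mem_rays_iff (S : Fan n) {v : Fin n → ℤ} :
    v ∈ S.rays ↔ IsUnimodular {v} ∧ coneOf {v} ∈ S.cones := by
  rw [coneOf_singleton]
  refine ⟨fun ⟨hv, hS⟩ => ⟨?_, hS⟩, fun ⟨hv, hS⟩ =>
    ⟨hv.isPrimitive (Finset.mem_singleton_self v), hS⟩⟩
  obtain ⟨F, hF, hFv⟩ := isSmoothCone_iff.1 (S.smooth _ hS)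
  obtain ⟨c, -, hcs, hcv⟩ := mem_coneOf.1 (hFv ▸ toReal_mem_rayCone v)
  obtain ⟨g, hg⟩ := support_nonempty_of_realize_eq hv.ne_zero hcv
  have hvg : v = g := hF.eq_of_mem_rayCone (hcs hg) hv (hFv ▸ toReal_mem_coneOf (hcs hg))
  exact hF.mono (Finset.singleton_subset_iff.2 (hvg ▸ hcs hg))

theorem Fan.mem_rays_of_mem_face (S : Fan n) {F : Finset (Fin n → ℤ)} (hF : IsUnimodular F)
    (hS : coneOf F ∈ S.cones) {v : Fin n → ℤ} (hv : v ∈ F) : v ∈ S.rays :=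
  S.mem_rays_iff.2 (S.toComplex.down_closed F ⟨hF, hS⟩ _ (Finset.singleton_subset_iff.2 hv))

theorem Fan.mem_rays_of_realize (S : Fan n) {c : (Fin n → ℤ) →₀ ℝ} {v : Fin n → ℤ}
    (hv : IsPrimitive v) (hcs : IsUnimodular c.support ∧ coneOf c.support ∈ S.cones)
    (hcv : realize c = toReal v) (h : ∀ g ∈ c.support, toReal g ∈ rayCone v) : v ∈ S.rays := by
  obtain ⟨g, hg⟩ := support_nonempty_of_realize_eq hv.ne_zero hcv
  rw [hcs.1.eq_of_mem_rayCone hg hv (h g hg)]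
  exact S.mem_rays_of_mem_face hcs.1 hcs.2 hg

theorem Fan.Subdivides.rays_subset {S S' : Fan n} (h : S'.Subdivides S) : S.rays ⊆ S'.rays := by
  intro v hv
  obtain ⟨c, hc, hcs, hcv⟩ := S'.exists_rep (toReal v)
  refine S'.mem_rays_of_realize hv.1 hcs hcv fun g hg => ?_
  obtain ⟨σ, hσ, hle⟩ := h _ hcs.2
  have hvc : toReal v ∈ coneOf c.support := hcv ▸ mem_coneOf.2 ⟨c, hc, subset_rfl, rfl⟩
  have hface : (rayCone v ⊓ σ ⊓ coneOf c.support).IsFaceOf (coneOf c.support) := by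
    have := (S.inter_face _ hv.2 _ hσ).2.inf (PointedCone.IsFaceOf.refl (coneOf c.support))
    rwa [inf_eq_right.2 hle] at this
  have hmem : realize c ∈ rayCone v ⊓ σ ⊓ coneOf c.support :=
    hcv ▸ ⟨⟨toReal_mem_rayCone v, hle hvc⟩, hvc⟩
  exact (toReal_mem_of_realize_mem hface hc subset_rfl hmem hg).1.1

theorem toReal_minor_dotProduct (v : Fin n → ℤ) (i j : Fin n) (x : Fin n → ℝ) :
    toReal (v i • (Pi.single j 1 : Fin n → ℤ) - v j • (Pi.single i 1 : Fin n → ℤ)) ⬝ᵥ x =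
      toReal v i * x j - toReal v j * x i := by
  rw [toReal_sub, toReal_smul, toReal_smul, toReal_single, toReal_single, sub_dotProduct,
    smul_dotProduct, smul_dotProduct, single_one_dotProduct, single_one_dotProduct]
  rfl

theorem exists_eq_smul_of_minors_eq {ι K : Type*} [Field K] {x y : ι → K} (hx : x ≠ 0)
    (h : ∀ i j, x i * y j = x j * y i) : ∃ t : K, y = t • x := by
  obtain ⟨i, hi⟩ := Function.ne_iff.1 hx
  refine ⟨y i / x i, funext fun j => ?_⟩
  rw [Pi.smul_apply, smul_eq_mul, div_mul_eq_mul_div, eq_div_iff hi]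
  linear_combination h i j

/- If the carrier cone of `v` lies on one side of all hyperplanes `v_i x_j = v_j x_i`, which
contain `v`, then it lies in all of them. -/
theorem Fan.exists_subdivides_mem_rays (S : Fan n) {v : Fin n → ℤ} (hv : IsPrimitive v) :
    ∃ S' : Fan n, S'.Subdivides S ∧ v ∈ S'.rays := by
  classical
  obtain ⟨S', hS', hT⟩ := S.exists_subdivides_oneSided
    (Finset.univ.image fun p : Fin n × Fin n =>
      v p.1 • (Pi.single p.2 1 : Fin n → ℤ) - v p.2 • (Pi.single p.1 1 : Fin n → ℤ))
  obtain ⟨c, hc, hcs, hcv⟩ := S'.exists_rep (toReal v)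
  refine ⟨S', hS', S'.mem_rays_of_realize hv hcs hcv fun g hg => ?_⟩
  have hminor : ∀ i j : Fin n, 0 ≤ toReal v i * toReal g j - toReal v j * toReal g i := by
    intro i j
    rw [← toReal_minor_dotProduct]
    refine (hT _ hcs.2 _ (Finset.mem_image_of_mem _ (Finset.mem_univ (i, j)))).dotProduct_nonneg
      hc ?_ (toReal_mem_coneOf hg)
    rw [toReal_minor_dotProduct, hcv, mul_comm, sub_self]
  have hv0 : toReal v ≠ 0 := toReal_zero (n := n) ▸ toReal_injective.ne hv.ne_zero
  obtain ⟨t, ht⟩ := exists_eq_smul_of_minors_eq hv0 fun i j =>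
    le_antisymm (sub_nonneg.1 (hminor j i)) (sub_nonneg.1 (hminor i j))
  obtain ⟨m, hm, -, hmc⟩ := hcs.1.exists_dual hg
  have htc : t * c g = 1 := by
    rw [← hmc c subset_rfl, hcv, ← smul_eq_mul, ← dotProduct_smul, ← ht, toReal_dotProduct, hm,
      Int.cast_one]
  exact mem_rayCone.2 ⟨t, (pos_of_mul_pos_left (htc ▸ one_pos) (hc g)).le, ht⟩

/-! ### Conical functions -/

section IsConical

variable {E : Type*} [AddCommGroup E] [Module ℝ E]

/-- Functions that are homogeneous of degree one for nonnegative factors. -/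
def IsConical (f : E → ℝ) : Prop :=
  ∀ (t : ℝ) (x : E), 0 ≤ t → f (t • x) = t * f x

variable {f : E → ℝ}

theorem IsConical.map_zero (hf : IsConical f) : f 0 = 0 := by
  simpa using hf 0 0 le_rfl

theorem IsConical.concaveOn (hf : IsConical f) (h : ∀ x y, f x + f y ≤ f (x + y)) :
    ConcaveOn ℝ Set.univ f := by
  refine ⟨convex_univ, fun x _ y _ a b ha hb _ => ?_⟩
  rw [smul_eq_mul, smul_eq_mul, ← hf a x ha, ← hf b y hb]
  exact h _ _

theorem IsConical.add_le (hf : IsConical f) (hc : ConcaveOn ℝ Set.univ f) (x y : E) :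
    f x + f y ≤ f (x + y) := by
  have h := hc.2 (Set.mem_univ ((2 : ℝ) • x)) (Set.mem_univ ((2 : ℝ) • y)) one_half_pos.le
    one_half_pos.le (add_halves 1)
  have half : ∀ z : E, (1 / 2 : ℝ) • (2 : ℝ) • z = z := fun z => by
    rw [one_div, inv_smul_smul₀ two_ne_zero]
  rw [half, half, hf 2 x two_pos.le, hf 2 y two_pos.le] at h
  simpa using h

theorem IsConical.sum_le (hf : IsConical f) (hc : ConcaveOn ℝ Set.univ f) {ι : Type*} (s : Finset ι)
    (x : ι → E) : ∑ i ∈ s, f (x i) ≤ f (∑ i ∈ s, x i) := by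
  classical
  induction s using Finset.induction_on with
  | empty => simp [hf.map_zero]
  | insert i s hi ih =>
    rw [Finset.sum_insert hi, Finset.sum_insert hi]
    exact (add_le_add_right ih _).trans (hf.add_le hc _ _)

theorem IsConical.le_neg_map_neg (hf : IsConical f) (hc : ConcaveOn ℝ Set.univ f) (x : E) :
    f x ≤ -f (-x) := by
  have := hf.add_le hc x (-x)
  rw [add_neg_cancel, hf.map_zero] at this
  exact le_neg_iff_add_nonpos_right.2 this

end IsConical

section DirectedSupremum

variable {E ι : Type*} [AddCommGroup E] [Module ℝ E] {ψ : ι → E → ℝ}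

theorem isConical_iSup (hcon : ∀ i, IsConical (ψ i)) : IsConical fun x => ⨆ i, ψ i x :=
  fun t x ht => (iSup_congr fun i => hcon i t x ht).trans (Real.mul_iSup_of_nonneg ht _).symm

variable [Nonempty ι]

theorem bddAbove_range_of_directed (hcon : ∀ i, IsConical (ψ i))
    (hconc : ∀ i, ConcaveOn ℝ Set.univ (ψ i)) (hdir : Directed (· ≤ ·) ψ) (x : E) :
    BddAbove (Set.range fun i => ψ i x) := by
  obtain ⟨i₀⟩ := ‹Nonempty ι›
  refine ⟨-ψ i₀ (-x), ?_⟩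
  rintro _ ⟨i, rfl⟩
  obtain ⟨j, hij, hi₀j⟩ := hdir i i₀
  exact (hij x).trans (((hcon j).le_neg_map_neg (hconc j) x).trans (neg_le_neg (hi₀j (-x))))

theorem concaveOn_iSup_of_directed (hcon : ∀ i, IsConical (ψ i))
    (hconc : ∀ i, ConcaveOn ℝ Set.univ (ψ i)) (hdir : Directed (· ≤ ·) ψ) :
    ConcaveOn ℝ Set.univ fun x => ⨆ i, ψ i x := by
  refine (isConical_iSup hcon).concaveOn fun x y => ciSup_add_ciSup_le fun i j => ?_
  obtain ⟨l, hil, hjl⟩ := hdir i j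
  exact (add_le_add (hil x) (hjl y)).trans (((hcon l).add_le (hconc l) x y).trans
    (le_ciSup (bddAbove_range_of_directed hcon hconc hdir (x + y)) l))

end DirectedSupremum

theorem exists_toReal_eq_smul_ratToReal (q : Fin n → ℚ) :
    ∃ (N : ℕ) (m : Fin n → ℤ), 0 < N ∧ toReal m = (N : ℝ) • ratToReal q := by
  refine ⟨∏ i, (q i).den, fun i => (q i).num * ∏ j ∈ Finset.univ.erase i, ((q j).den : ℤ),
    Finset.prod_pos fun i _ => (q i).den_pos, funext fun i => ?_⟩
  simp only [toReal, ratToReal, Pi.smul_apply, smul_eq_mul]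
  rw [← Finset.mul_prod_erase Finset.univ _ (Finset.mem_univ i)]
  have hden : ((q i : ℚ) : ℝ) * ((q i).den : ℝ) = ((q i).num : ℝ) := by
    exact_mod_cast Rat.mul_den_eq_num (q i)
  push_cast
  rw [← hden]
  ring

theorem denseRange_ratToReal : DenseRange (ratToReal : (Fin n → ℚ) → Fin n → ℝ) :=
  DenseRange.piMap fun _ => Rat.denseRange_cast

section PrimitiveVectors

variable {f g : (Fin n → ℝ) → ℝ}

theorem IsConical.le_toReal_of_le_primitive (hf : IsConical f) (hg : IsConical g)
    (h : ∀ v : Fin n → ℤ, IsPrimitive v → f (toReal v) ≤ g (toReal v)) (w : Fin n → ℤ) :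
    f (toReal w) ≤ g (toReal w) := by
  by_cases hw : w = 0
  · rw [hw, toReal_zero, hf.map_zero, hg.map_zero]
  · obtain ⟨d, v, hd, hv, rfl⟩ := exists_isPrimitive_smul hw
    have hd' : (0 : ℝ) ≤ d := by exact_mod_cast hd.le
    rw [toReal_smul, hf _ _ hd', hg _ _ hd']
    exact mul_le_mul_of_nonneg_left (h v hv) hd'

theorem IsConical.le_of_le_primitive (hf : IsConical f) (hg : IsConical g) (hfc : Continuous f)
    (hgc : Continuous g) (h : ∀ v : Fin n → ℤ, IsPrimitive v → f (toReal v) ≤ g (toReal v))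
    (x : Fin n → ℝ) : f x ≤ g x := by
  refine denseRange_ratToReal.induction_on x (isClosed_le hfc hgc) fun q => ?_
  obtain ⟨N, m, hN, hm⟩ := exists_toReal_eq_smul_ratToReal q
  have hN' : (0 : ℝ) < N := by exact_mod_cast hN
  have hle := hf.le_toReal_of_le_primitive hg h m
  rw [hm, hf _ _ hN'.le, hg _ _ hN'.le] at hle
  exact le_of_mul_le_mul_left hle hN'

theorem IsConical.eq_of_eq_primitive (hf : IsConical f) (hg : IsConical g) (hfc : Continuous f)
    (hgc : Continuous g) (h : ∀ v : Fin n → ℤ, IsPrimitive v → f (toReal v) = g (toReal v)) :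
    f = g :=
  funext fun x => le_antisymm (hf.le_of_le_primitive hg hfc hgc (fun v hv => (h v hv).le) x)
    (hg.le_of_le_primitive hf hgc hfc (fun v hv => (h v hv).ge) x)

end PrimitiveVectors

/-! ### Support functions -/

section SupportFunction

variable {S : Fan n} {D : ToricDivisor S} {ψ : (Fin n → ℝ) → ℝ}

theorem IsSupportFunction.isConical (h : IsSupportFunction D ψ) : IsConical ψ := by
  intro t x ht
  obtain ⟨σ, hσ, hx⟩ := S.complete x
  obtain ⟨m, hm⟩ := h.linear σ hσ
  rw [hm _ (σ.smul_mem ht hx), hm x hx, dotProduct_smul, smul_eq_mul]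

theorem IsSupportFunction.apply_realize (h : IsSupportFunction D ψ) {c : (Fin n → ℤ) →₀ ℝ}
    (hc : ∀ v, 0 ≤ c v) (hcs : coneOf c.support ∈ S.cones) :
    ψ (realize c) = ∑ v ∈ c.support, c v * ψ (toReal v) := by
  obtain ⟨m, hm⟩ := h.linear _ hcs
  rw [hm _ (mem_coneOf.2 ⟨c, hc, subset_rfl, rfl⟩), realize_eq_sum subset_rfl, dotProduct_sum]
  refine Finset.sum_congr rfl fun v hv => ?_
  rw [dotProduct_smul, hm _ (toReal_mem_coneOf hv), smul_eq_mul]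

theorem IsSupportFunction.le (h : IsSupportFunction D ψ) {f : (Fin n → ℝ) → ℝ} (hf : IsConical f)
    (hc : ConcaveOn ℝ Set.univ f) (hr : ∀ v ∈ S.rays, ψ (toReal v) ≤ f (toReal v))
    (x : Fin n → ℝ) : ψ x ≤ f x := by
  obtain ⟨c, hc0, hcs, rfl⟩ := S.exists_rep x
  rw [h.apply_realize hc0 hcs.2, realize_eq_sum subset_rfl]
  refine le_trans (Finset.sum_le_sum fun v hv => ?_) (hf.sum_le hc _ _)
  rw [hf _ _ (hc0 v)]
  exact mul_le_mul_of_nonneg_left (hr v (S.mem_rays_of_mem_face hcs.1 hcs.2 hv)) (hc0 v)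

theorem IsSupportFunction.unique (h : IsSupportFunction D ψ) {ψ' : (Fin n → ℝ) → ℝ}
    (h' : IsSupportFunction D ψ') : ψ = ψ' := by
  funext x
  obtain ⟨c, hc0, hcs, rfl⟩ := S.exists_rep x
  rw [h.apply_realize hc0 hcs.2, h'.apply_realize hc0 hcs.2]
  refine Finset.sum_congr rfl fun v hv => ?_
  have hv' := S.mem_rays_of_mem_face hcs.1 hcs.2 hv
  rw [h.ray ⟨v, hv'⟩, h'.ray ⟨v, hv'⟩]

end SupportFunction

/-! ### The concave function of a nef b-divisor -/

section ConcaveFunction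

variable {S : Fan n}

theorem Model.exists_common (S₁ S₂ : Model S) :
    ∃ S₃ : Model S, S₃.1.Subdivides S₁.1 ∧ S₃.1.Subdivides S₂.1 := by
  obtain ⟨S₃, h₁, h₂⟩ := S₁.1.exists_common_subdivision S₂.1
  exact ⟨⟨S₃, h₁.trans S₁.2⟩, h₁, h₂⟩

theorem Model.exists_mem_rays (S₁ : Model S) {v : Fin n → ℤ} (hv : IsPrimitive v) :
    ∃ S₂ : Model S, S₂.1.Subdivides S₁.1 ∧ v ∈ S₂.1.rays := by
  obtain ⟨S₂, h₁, h₂⟩ := S₁.1.exists_subdivides_mem_rays hv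
  exact ⟨⟨S₂, h₁.trans S₁.2⟩, h₁, h₂⟩

theorem BDivisor.inc_eq_of_subdivides (D : BDivisor S) {S₁ S₂ : Model S}
    (h : S₂.1.Subdivides S₁.1) {v : Fin n → ℤ} (hv : v ∈ S₁.1.rays) :
    D.inc S₂ ⟨v, h.rays_subset hv⟩ = D.inc S₁ ⟨v, hv⟩ := by
  rw [← D.compat S₂ S₁ h, pushforward, dif_pos]

variable {D : BDivisor S}

theorem BDivisor.apply_ray_of_subdivides {S₁ S₂ : Model S} (h : S₂.1.Subdivides S₁.1)
    {ψ : (Fin n → ℝ) → ℝ} (hψ : IsSupportFunction (D.inc S₂) ψ) (v : S₁.1.rays) :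
    ψ (toReal v) = -(D.inc S₁ v : ℝ) := by
  rw [hψ.ray ⟨v, h.rays_subset v.2⟩, D.inc_eq_of_subdivides h v.2]

theorem BDivisor.supportFunction_mono {S₁ S₂ : Model S} (h : S₂.1.Subdivides S₁.1)
    {ψ₁ ψ₂ : (Fin n → ℝ) → ℝ} (h₁ : IsSupportFunction (D.inc S₁) ψ₁)
    (h₂ : IsSupportFunction (D.inc S₂) ψ₂) (hconc : ConcaveOn ℝ Set.univ ψ₂) : ψ₁ ≤ ψ₂ :=
  h₁.le h₂.isConical hconc fun v hv =>
    ((h₁.ray ⟨v, hv⟩).trans (apply_ray_of_subdivides h h₂ ⟨v, hv⟩).symm).le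

theorem BDivisor.IsNef.exists_isConcaveFunction (hD : D.IsNef) :
    ∃ φ : (Fin n → ℝ) → ℝ, D.IsConcaveFunction φ := by
  obtain ⟨C, hC, hnef⟩ := hD
  choose ψ hψ hconc using fun S' : C => hnef S' S'.2
  have hmono : ∀ S₁ S₂ : C, S₂.1.1.Subdivides S₁.1.1 → ψ S₁ ≤ ψ S₂ := fun S₁ S₂ h =>
    supportFunction_mono h (hψ S₁) (hψ S₂) (hconc S₂)
  have hcommon : ∀ S₁ S₂ : Model S, ∃ S₃ : C, S₃.1.1.Subdivides S₁.1 ∧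
      S₃.1.1.Subdivides S₂.1 := by
    intro S₁ S₂
    obtain ⟨S₃, h₁, h₂⟩ := Model.exists_common S₁ S₂
    obtain ⟨S₄, hS₄, h⟩ := hC S₃
    exact ⟨⟨S₄, hS₄⟩, h.trans h₁, h.trans h₂⟩
  have hdir : Directed (· ≤ ·) ψ := fun S₁ S₂ => by
    obtain ⟨S₃, h₁, h₂⟩ := hcommon S₁ S₂
    exact ⟨S₃, hmono S₁ S₃ h₁, hmono S₂ S₃ h₂⟩
  have hcon : ∀ S' : C, IsConical (ψ S') := fun S' => (hψ S').isConical
  obtain ⟨S₀, -⟩ := hcommon ⟨S, Fan.Subdivides.refl S⟩ ⟨S, Fan.Subdivides.refl S⟩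
  have : Nonempty C := ⟨S₀⟩
  have hφ := concaveOn_iSup_of_directed hcon hconc hdir
  refine ⟨_, hφ.locallyLipschitz.continuous, hφ, isConical_iSup hcon, fun S' v => ?_⟩
  apply le_antisymm
  · refine ciSup_le fun S₁ => ?_
    obtain ⟨S₂, h₁, h₂⟩ := hcommon S₁ S'
    exact (hmono S₁ S₂ h₁ _).trans (apply_ray_of_subdivides h₂ (hψ S₂) v).le
  · obtain ⟨S₁, h, -⟩ := hcommon S' S'
    rw [← apply_ray_of_subdivides h (hψ S₁) v]
    exact le_ciSup (bddAbove_range_of_directed hcon hconc hdir _) S₁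

variable {φ : (Fin n → ℝ) → ℝ}

theorem BDivisor.IsConcaveFunction.isConical (h : D.IsConcaveFunction φ) : IsConical φ :=
  h.conical

theorem BDivisor.IsConcaveFunction.exists_rat (h : D.IsConcaveFunction φ) (w : Fin n → ℤ) :
    ∃ q : ℚ, φ (toReal w) = q := by
  by_cases hw : w = 0
  · exact ⟨0, by rw [hw, toReal_zero, h.isConical.map_zero, Rat.cast_zero]⟩
  · obtain ⟨d, v, hd, hv, rfl⟩ := exists_isPrimitive_smul hw
    obtain ⟨S', -, hv'⟩ := Model.exists_mem_rays ⟨S, Fan.Subdivides.refl S⟩ hv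
    refine ⟨d * -D.inc S' ⟨v, hv'⟩, ?_⟩
    rw [toReal_smul, h.conical _ _ (by exact_mod_cast hd.le), h.ray S' ⟨v, hv'⟩]
    norm_cast

theorem BDivisor.IsConcaveFunction.eq_of_isPullback (h : D.IsConcaveFunction φ) {S' : Model S}
    (hS' : ∀ S'' : Model S, S''.1.Subdivides S'.1 → IsPullback (D.inc S'') (D.inc S'))
    {ψ : (Fin n → ℝ) → ℝ} (hψ : IsSupportFunction (D.inc S') ψ) : φ = ψ := by
  refine h.isConical.eq_of_eq_primitive hψ.isConical h.continuous hψ.continuous fun v hv => ?_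
  obtain ⟨S'', hsub, hv'⟩ := S'.exists_mem_rays hv
  obtain ⟨ψ', hψ', hψ''⟩ := hS' S'' hsub
  rw [hψ.unique hψ', h.ray S'' ⟨v, hv'⟩, hψ''.ray ⟨v, hv'⟩]

theorem BDivisor.IsConcaveFunction.isCartier_iff (h : D.IsConcaveFunction φ) :
    D.IsCartier ↔ ∃ S' : Model S, ∀ σ ∈ S'.1.cones, ∃ m : Fin n → ℚ, ∀ u ∈ σ,
      φ u = ratToReal m ⬝ᵥ u := by
  constructor
  · rintro ⟨S', hS'⟩
    obtain ⟨ψ, hψ, -⟩ := hS' S' (Fan.Subdivides.refl _)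
    exact ⟨S', h.eq_of_isPullback hS' hψ ▸ hψ.linear⟩
  · rintro ⟨S', hS'⟩
    have hsupport : ∀ S'' : Model S, S''.1.Subdivides S'.1 →
        IsSupportFunction (D.inc S'') φ := by
      intro S'' hsub
      refine ⟨h.continuous, fun σ hσ => ?_, h.ray S''⟩
      obtain ⟨τ, hτ, hle⟩ := hsub σ hσ
      obtain ⟨m, hm⟩ := hS' τ hτ
      exact ⟨m, fun u hu => hm u (hle hu)⟩
    exact ⟨S', fun S'' hsub => ⟨φ, hsupport S' (Fan.Subdivides.refl _), hsupport S'' hsub⟩⟩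

end ConcaveFunction

/-! ### Stability sets -/

theorem IsConical.exists_linearMap_ge {E : Type*} [AddCommGroup E] [Module ℝ E] {f : E → ℝ}
    (hf : IsConical f) (hc : ConcaveOn ℝ Set.univ f) (x : E) :
    ∃ g : E →ₗ[ℝ] ℝ, (∀ y, f y ≤ g y) ∧ g x = f x := by
  have hx : ∀ t : ℝ, t • x = 0 → t • -f x = 0 := by
    intro t ht
    rcases smul_eq_zero.1 ht with rfl | rfl
    · exact zero_smul ..
    · rw [hf.map_zero, neg_zero, smul_zero]
  let p : E →ₗ.[ℝ] ℝ := LinearPMap.mkSpanSingleton' x (-f x) hx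
  have hp : ∀ y : p.domain, p y ≤ -f y := by
    rintro ⟨y, hy⟩
    obtain ⟨t, rfl⟩ := Submodule.mem_span_singleton.1 hy
    rw [LinearPMap.mkSpanSingleton'_apply, smul_eq_mul, mul_neg, RingHom.id_apply, neg_le_neg_iff]
    rcases le_total 0 t with ht | ht
    · exact (hf t x ht).le
    · have h := hf (-t) (-x) (neg_nonneg.2 ht)
      rw [neg_smul_neg] at h
      rw [h]
      nlinarith [hf.le_neg_map_neg hc x]
  obtain ⟨g, hgx, hg⟩ := exists_extension_of_le_sublinear p (fun y => -f y)
    (fun t ht y => by simp only [hf t y ht.le, mul_neg])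
    (fun y z => by linarith [hf.add_le hc y z]) hp
  refine ⟨-g, fun y => le_neg_of_le_neg (hg y), ?_⟩
  rw [LinearMap.neg_apply, hgx ⟨x, Submodule.mem_span_singleton_self x⟩, neg_eq_iff_eq_neg]
  exact LinearPMap.mkSpanSingleton'_apply_self ..

section StabilitySet

variable {φ : (Fin n → ℝ) → ℝ}

theorem IsConical.mem_stabilitySet (h : IsConical φ) {m : Fin n → ℝ} :
    m ∈ stabilitySet φ ↔ ∀ v, φ v ≤ m ⬝ᵥ v := by
  refine ⟨fun ⟨B, hB⟩ v => ?_, fun hm => ⟨0, ?_⟩⟩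
  · by_contra! hv
    obtain ⟨N, hN⟩ := exists_nat_gt (-B / (φ v - m ⬝ᵥ v))
    have hBN : B ≤ m ⬝ᵥ ((N : ℝ) • v) - φ ((N : ℝ) • v) := hB ⟨_, rfl⟩
    rw [h _ _ (Nat.cast_nonneg N), dotProduct_smul, smul_eq_mul] at hBN
    rw [div_lt_iff₀ (sub_pos.2 hv)] at hN
    linarith
  · rintro _ ⟨v, rfl⟩
    exact sub_nonneg.2 (hm v)

theorem IsConical.exists_mem_stabilitySet (h : IsConical φ) (hc : ConcaveOn ℝ Set.univ φ)
    (x : Fin n → ℝ) : ∃ m ∈ stabilitySet φ, m ⬝ᵥ x = φ x := by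
  obtain ⟨g, hg, hgx⟩ := h.exists_linearMap_ge hc x
  obtain ⟨m, hm⟩ := exists_forall_eq_dotProduct g
  exact ⟨m, h.mem_stabilitySet.2 fun v => hm v ▸ hg v, hm x ▸ hgx⟩

theorem IsConical.convex_stabilitySet (h : IsConical φ) : Convex ℝ (stabilitySet φ) := by
  intro x hx y hy a b ha hb hab
  rw [h.mem_stabilitySet] at hx hy ⊢
  intro v
  rw [add_dotProduct, smul_dotProduct, smul_dotProduct, smul_eq_mul, smul_eq_mul]
  calc φ v = a * φ v + b * φ v := by rw [← add_mul, hab, one_mul]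
    _ ≤ _ := by gcongr <;> apply_assumption

theorem IsConical.stabilitySet_eq_convexHull (h : IsConical φ) {s : Set (Fin n → ℝ)} (hs : s.Finite)
    (hle : ∀ m ∈ s, ∀ v, φ v ≤ m ⬝ᵥ v) (heq : ∀ v, ∃ m ∈ s, m ⬝ᵥ v = φ v) :
    stabilitySet φ = convexHull ℝ s := by
  refine Set.Subset.antisymm (fun x hx => ?_)
    (convexHull_min (fun m hm => h.mem_stabilitySet.2 (hle m hm)) h.convex_stabilitySet)
  by_contra hxs
  obtain ⟨f, u, hfx, hfs⟩ := geometric_hahn_banach_point_closed (convex_convexHull ℝ s)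
    (hs.isClosed_convexHull ℝ) hxs
  obtain ⟨v, hv⟩ := exists_forall_eq_dotProduct (f : (Fin n → ℝ) →ₗ[ℝ] ℝ)
  have hfv : ∀ m, f m = m ⬝ᵥ v := fun m => (hv m).trans (dotProduct_comm v m)
  obtain ⟨m, hm, hmv⟩ := heq v
  have hsep : φ v > x ⬝ᵥ v := by
    rw [← hmv, ← hfv, ← hfv]
    exact hfx.trans (hfs m (subset_convexHull ℝ s hm))
  exact hsep.not_ge (h.mem_stabilitySet.1 hx v)

end StabilitySet

/-! ### Rational polytopes and Cartier b-divisors -/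

theorem isClosed_of_isSmoothCone {σ : Cone n} (hσ : IsSmoothCone σ) :
    IsClosed (σ : Set (Fin n → ℝ)) := by
  obtain ⟨b, s, rfl⟩ := hσ
  have hinter : (PointedCone.hull ℝ ((fun i => toReal (b i)) '' s) : Set (Fin n → ℝ)) =
      ⋂ i, {x | 0 ≤ toReal (dualVec b i) ⬝ᵥ x} ∩
        {x | i ∉ s → toReal (dualVec b i) ⬝ᵥ x = 0} := by
    ext x
    simp only [SetLike.mem_coe, mem_hull_basis_iff, Set.mem_iInter, Set.mem_inter_iff,
      Set.mem_ofPred_eq]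
  rw [hinter]
  refine isClosed_iInter fun i => (isClosed_le (by fun_prop) (by fun_prop)).inter ?_
  by_cases hi : i ∈ s
  · simp [hi]
  · simpa [hi] using isClosed_eq (by fun_prop) (by fun_prop)

theorem Fan.dense_iUnion_interior (S : Fan n) :
    Dense (⋃ σ ∈ S.cones, interior (σ : Set (Fin n → ℝ))) :=
  dense_biUnion_interior_of_closed (fun σ hσ => isClosed_of_isSmoothCone (S.smooth σ hσ))
    S.finite.countable (Set.eq_univ_of_forall fun x =>
      let ⟨σ, hσ, hx⟩ := S.complete x
      Set.mem_iUnion₂.2 ⟨σ, hσ, hx⟩)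

theorem le_of_eqOn_of_mem_interior {E : Type*} [AddCommGroup E] [TopologicalSpace E] [Module ℝ E]
    [IsTopologicalAddGroup E] [ContinuousSMul ℝ E] {f : E → ℝ} (hf : ConcaveOn ℝ Set.univ f)
    (g : E →ₗ[ℝ] ℝ) {s : Set E} (hs : Set.EqOn f g s) {y : E} (hy : y ∈ interior s) (z : E) :
    f z ≤ g z := by
  have hmax : IsLocalMax (f - ⇑g) y := by
    filter_upwards [mem_interior_iff_mem_nhds.1 hy] with x hx
    rw [Pi.sub_apply, Pi.sub_apply, hs hx, hs (interior_subset hy), sub_self, sub_self]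
  have hle := IsMaxOn.of_isLocalMaxOn_of_concaveOn (Set.mem_univ y) (hmax.on Set.univ)
    (hf.sub (g.convexOn convex_univ)) (Set.mem_univ z)
  rw [Set.mem_ofPred_eq] at hle
  rwa [Pi.sub_apply, Pi.sub_apply, hs (interior_subset hy), sub_self, sub_nonpos] at hle

theorem exists_mem_apply_eq_of_dense {ι X Y : Type*} [TopologicalSpace X] [TopologicalSpace Y]
    [T2Space Y] {f : X → Y} (hf : Continuous f) {g : ι → X → Y} (hg : ∀ i, Continuous (g i))
    {G : Set ι} (hG : G.Finite) {s : Set X} (hs : Dense s) (h : ∀ y ∈ s, ∃ i ∈ G, g i y = f y)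
    (x : X) : ∃ i ∈ G, g i x = f x := by
  have hclosed : IsClosed (⋃ i ∈ G, {y | g i y = f y}) :=
    hG.isClosed_biUnion fun i _ => isClosed_eq (hg i) hf
  have hsub : s ⊆ ⋃ i ∈ G, {y | g i y = f y} := fun y hy => by
    simpa only [Set.mem_iUnion₂, exists_prop, Set.mem_ofPred_eq] using h y hy
  simpa only [Set.mem_iUnion₂, exists_prop, Set.mem_ofPred_eq] using
    hclosed.closure_subset_iff.2 hsub (hs x)

section Cartier

variable {S : Fan n} {D : BDivisor S} {φ : (Fin n → ℝ) → ℝ}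

theorem BDivisor.IsConcaveFunction.isRationalPolytope (h : D.IsConcaveFunction φ)
    (hD : D.IsCartier) : IsRationalPolytope (stabilitySet φ) := by
  obtain ⟨S', hS'⟩ := h.isCartier_iff.1 hD
  choose! m hm using hS'
  let G : Set (Fin n → ℚ) := m '' S'.1.cones ∩ {q | ∀ z, φ z ≤ ratToReal q ⬝ᵥ z}
  have hG : G.Finite := (S'.1.finite.image m).inter_of_left _
  refine ⟨hG.toFinset, ?_⟩
  rw [hG.coe_toFinset]
  refine h.isConical.stabilitySet_eq_convexHull (hG.image _) ?_ fun v => ?_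
  · rintro _ ⟨q, hq, rfl⟩
    exact hq.2
  · rw [Set.exists_mem_image]
    refine exists_mem_apply_eq_of_dense h.continuous (fun q => by fun_prop) hG
      S'.1.dense_iUnion_interior (fun y hy => ?_) v
    obtain ⟨σ, hσ, hy⟩ := Set.mem_iUnion₂.1 hy
    exact ⟨m σ, ⟨⟨σ, hσ, rfl⟩, le_of_eqOn_of_mem_interior h.concave
      (dotProductEquiv ℝ (Fin n) (ratToReal (m σ))) (hm σ hσ) hy⟩,
      (hm σ hσ y (interior_subset hy)).symm⟩

theorem IsConical.exists_mem_dotProduct_eq (h : IsConical φ) (hc : ConcaveOn ℝ Set.univ φ)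
    {s : Set (Fin n → ℝ)} (hs : stabilitySet φ = convexHull ℝ s) (v : Fin n → ℝ) :
    ∃ m ∈ s, m ⬝ᵥ v = φ v := by
  obtain ⟨p, hp, hpv⟩ := h.exists_mem_stabilitySet hc v
  obtain ⟨m, hm, hmv⟩ := (LinearMap.concaveOn (dotProductEquiv ℝ (Fin n) v)
    convex_univ).exists_le_of_mem_convexHull (Set.subset_univ s) (hs ▸ hp)
  rw [dotProductEquiv_apply_apply, dotProductEquiv_apply_apply, dotProduct_comm,
    dotProduct_comm v, hpv] at hmv
  exact ⟨m, hm, hmv.antisymm (h.mem_stabilitySet.1 (hs ▸ subset_convexHull ℝ s hm) v)⟩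

theorem OneSided.ratToReal_dotProduct_le {m : Fin n → ℤ} {p q : Fin n → ℚ} {N : ℕ} (hN : 0 < N)
    (hm : toReal m = (N : ℝ) • ratToReal (p - q)) {c : (Fin n → ℤ) →₀ ℝ} (hc : ∀ v, 0 ≤ c v)
    (h : OneSided m (coneOf c.support))
    (hle : ratToReal q ⬝ᵥ realize c ≤ ratToReal p ⬝ᵥ realize c) {u : Fin n → ℝ}
    (hu : u ∈ coneOf c.support) : ratToReal q ⬝ᵥ u ≤ ratToReal p ⬝ᵥ u := by
  have hN' : (0 : ℝ) < N := by exact_mod_cast hN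
  have hdot : ∀ x : Fin n → ℝ, toReal m ⬝ᵥ x =
      N * (ratToReal p ⬝ᵥ x - ratToReal q ⬝ᵥ x) := by
    intro x
    rw [hm, smul_dotProduct, smul_eq_mul, ← sub_dotProduct]
    congr 2
    ext i
    simp [ratToReal]
  have hmu := h.dotProduct_nonneg hc (by
    rw [hdot]
    exact mul_nonneg hN'.le (sub_nonneg.2 hle)) hu
  rw [hdot] at hmu
  exact sub_nonneg.1 (nonneg_of_mul_nonneg_right hmu hN')

theorem BDivisor.IsConcaveFunction.isCartier (h : D.IsConcaveFunction φ)
    (hP : IsRationalPolytope (stabilitySet φ)) : D.IsCartier := by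
  classical
  obtain ⟨s, hs⟩ := hP
  choose N m hN hm using exists_toReal_eq_smul_ratToReal (n := n)
  have hle : ∀ q ∈ s, ∀ v, φ v ≤ ratToReal q ⬝ᵥ v := fun q hq =>
    h.isConical.mem_stabilitySet.1 (hs ▸ subset_convexHull ℝ _ ⟨q, hq, rfl⟩)
  have hmin : ∀ v, ∃ q ∈ s, ratToReal q ⬝ᵥ v = φ v := fun v => by
    simpa using h.isConical.exists_mem_dotProduct_eq h.concave hs v
  obtain ⟨S', hS', hside⟩ := S.exists_subdivides_oneSided
    ((s ×ˢ s).image fun p => m (p.1 - p.2))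
  refine h.isCartier_iff.2 ⟨⟨S', hS'⟩, fun σ hσ => ?_⟩
  obtain ⟨F, hF, rfl⟩ := isSmoothCone_iff.1 (S'.smooth σ hσ)
  obtain ⟨c, hc, rfl⟩ := exists_nonneg_support_eq F
  obtain ⟨q, hq, hqc⟩ := hmin (realize c)
  refine ⟨q, fun u hu => le_antisymm (hle q hq u) ?_⟩
  obtain ⟨p, hp, hpu⟩ := hmin u
  rw [← hpu]
  exact (hside _ hσ _ (Finset.mem_image_of_mem _ (Finset.mk_mem_product hp hq))
    ).ratToReal_dotProduct_le (hN _) (hm _) hc (hqc.trans_le (hle p hp _)) hu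

end Cartier

/-! ### Rational affine hulls -/

theorem affineSpan_ratToReal_subset_closure (s : Set (Fin n → ℚ)) :
    (affineSpan ℝ (ratToReal '' s) : Set (Fin n → ℝ)) ⊆
      closure (affineSpan ℝ (ratToReal '' s) ∩ Set.range ratToReal) := by
  set A := affineSpan ℝ (ratToReal '' s)
  set T : Set (Fin n → ℝ) := A ∩ Set.range ratToReal
  intro x hx
  refine affineSpan_induction hx (fun x hx => subset_closure
    ⟨subset_affineSpan ℝ _ hx, Set.image_subset_range _ _ hx⟩) fun c u v w hu hv hw => ?_
  refine map_mem_closure (f := fun p : ℝ × (Fin n → ℝ) × (Fin n → ℝ) × (Fin n → ℝ) =>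
    p.1 • (p.2.1 -ᵥ p.2.2.1) +ᵥ p.2.2.2) (s := Set.range ((↑) : ℚ → ℝ) ×ˢ T ×ˢ T ×ˢ T)
    (by fun_prop) (x := (c, u, v, w)) ?_ ?_
  · simp only [closure_prod_eq]
    exact ⟨Rat.denseRange_cast c, hu, hv, hw⟩
  · rintro ⟨_, _, _, _⟩ ⟨⟨t, rfl⟩, ⟨hu, a, rfl⟩, ⟨hv, b, rfl⟩, ⟨hw, e, rfl⟩⟩
    refine ⟨A.smul_vsub_vadd_mem _ hu hv hw, t • (a - b) + e, ?_⟩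
    ext i
    simp [ratToReal]

theorem subset_closure_inter_of_affineSpan_subset {E : Type*} [NormedAddCommGroup E]
    [NormedSpace ℝ E] [FiniteDimensional ℝ E] {P Q : Set E} (hP : Convex ℝ P)
    (h : (affineSpan ℝ P : Set E) ⊆ closure (affineSpan ℝ P ∩ Q)) : P ⊆ closure (P ∩ Q) := by
  intro x hx
  obtain ⟨_, ⟨x₀, hx₀, rfl⟩⟩ := Set.Nonempty.intrinsicInterior hP ⟨x, hx⟩
  obtain ⟨U, hU, hUP⟩ := (mem_nhds_subtype _ _ _).1 (mem_interior_iff_mem_nhds.1 hx₀)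
  have hxA : x ∈ affineSpan ℝ P := subset_affineSpan ℝ P hx
  have hline : ∀ t ∈ Set.Ioc (0 : ℝ) 1, AffineMap.lineMap x (x₀ : E) t ∈ closure (P ∩ Q) := by
    rintro t ⟨ht, ht1⟩
    have hfreq := mem_closure_iff_frequently.1 (h (AffineMap.lineMap_mem t hxA x₀.2))
    have hU' : ∀ᶠ z in nhds (AffineMap.lineMap x (x₀ : E) t), AffineMap.lineMap x z t⁻¹ ∈ U := by
      refine ContinuousAt.eventually_mem (by fun_prop) ?_
      rwa [AffineMap.lineMap_lineMap_right, inv_mul_cancel₀ ht.ne', AffineMap.lineMap_apply_one]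
    refine mem_closure_iff_frequently.2 ((hfreq.and_eventually hU').mono ?_)
    rintro z ⟨⟨hzA, hzQ⟩, hzU⟩
    refine ⟨?_, hzQ⟩
    have hz : AffineMap.lineMap x z t⁻¹ ∈ P :=
      hUP (a := ⟨_, AffineMap.lineMap_mem t⁻¹ hxA hzA⟩) hzU
    have hmem := hP.lineMap_mem hx hz ⟨ht.le, ht1⟩
    rwa [AffineMap.lineMap_lineMap_right, mul_inv_cancel₀ ht.ne', AffineMap.lineMap_apply_one]
      at hmem
  have hlim : Filter.Tendsto (AffineMap.lineMap x (x₀ : E)) (nhdsWithin (0 : ℝ) (Set.Ioi 0))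
      (nhds x) := by
    refine tendsto_nhdsWithin_of_tendsto_nhds ?_
    simpa only [AffineMap.lineMap_apply_zero] using
      (AffineMap.lineMap_continuous (R := ℝ) (p := x) (q := (x₀ : E))).tendsto 0
  exact isClosed_closure.mem_of_tendsto hlim
    (Filter.eventually_of_mem (Ioc_mem_nhdsGT zero_lt_one) hline)

theorem HasRationalAffineHull.subset_closure {P : Set (Fin n → ℝ)}
    (h : HasRationalAffineHull P) (hP : Convex ℝ P) : P ⊆ closure (P ∩ Set.range ratToReal) := by
  obtain ⟨s, hs⟩ := h
  exact subset_closure_inter_of_affineSpan_subset hP (hs ▸ affineSpan_ratToReal_subset_closure s)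

theorem hasRationalAffineHull_of_eq_top {P : Set (Fin n → ℝ)} (h : affineSpan ℝ P = ⊤) :
    HasRationalAffineHull P := by
  refine ⟨Set.univ, ?_⟩
  rw [h, Set.image_univ, ← SetLike.coe_set_eq, AffineSubspace.top_coe]
  exact (denseRange_ratToReal.mono (subset_affineSpan ℝ _)).closure_eq ▸
    (AffineSubspace.closed_of_finiteDimensional _).closure_eq.symm

theorem exists_ratToReal_eq {m : Fin n → ℝ} (h : ∀ v : Fin n → ℤ, ∃ q : ℚ, m ⬝ᵥ toReal v = q) :
    ∃ q, ratToReal q = m := by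
  choose q hq using fun i : Fin n => h (Pi.single i 1)
  refine ⟨q, funext fun i => ?_⟩
  rw [ratToReal, ← hq i, toReal_single, dotProduct_single_one]

section Line

variable {φ : (Fin n → ℝ) → ℝ} {d : Fin n → ℝ}

theorem IsConical.exists_eq_add_smul (h : IsConical φ) {p : Fin n → ℝ} (hp : p ∈ stabilitySet φ)
    (hpd : p ⬝ᵥ d = φ d)
    (hd : ∀ x ∈ stabilitySet φ, ∀ y ∈ stabilitySet φ, ∃ t : ℝ, y - x = t • d)
    {x : Fin n → ℝ} (hx : x ∈ stabilitySet φ) : ∃ t : ℝ, 0 ≤ t ∧ x = p + t • d := by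
  obtain ⟨t, ht⟩ := hd p hp x hx
  rw [sub_eq_iff_eq_add'] at ht
  rcases eq_or_ne d 0 with rfl | hd0
  · exact ⟨0, le_rfl, by rw [ht, smul_zero, smul_zero]⟩
  have hdd : 0 < d ⬝ᵥ d := lt_of_le_of_ne (Finset.sum_nonneg fun i _ => mul_self_nonneg _)
    fun h' => hd0 (dotProduct_self_eq_zero.1 h'.symm)
  have hxd := h.mem_stabilitySet.1 hx d
  rw [← hpd, ht, add_dotProduct, smul_dotProduct, smul_eq_mul, le_add_iff_nonneg_right] at hxd
  exact ⟨t, nonneg_of_mul_nonneg_left hxd hdd, ht⟩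

theorem IsConical.apply_eq_of_ray (h : IsConical φ) (hc : ConcaveOn ℝ Set.univ φ)
    {p : Fin n → ℝ} (hp : p ∈ stabilitySet φ)
    (hpx : ∀ x ∈ stabilitySet φ, ∃ t : ℝ, 0 ≤ t ∧ x = p + t • d) {v : Fin n → ℝ}
    (hv : 0 ≤ d ⬝ᵥ v) : φ v = p ⬝ᵥ v := by
  obtain ⟨m, hm, hmv⟩ := h.exists_mem_stabilitySet hc v
  obtain ⟨t, ht, rfl⟩ := hpx m hm
  rw [add_dotProduct, smul_dotProduct, smul_eq_mul] at hmv
  exact le_antisymm (h.mem_stabilitySet.1 hp v)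
    (hmv ▸ le_add_of_nonneg_right (mul_nonneg ht hv))

theorem IsConical.exists_ratToReal_eq_of_ray (h : IsConical φ) (hc : ConcaveOn ℝ Set.univ φ)
    (hrat : ∀ w : Fin n → ℤ, ∃ q : ℚ, φ (toReal w) = q) {p : Fin n → ℝ}
    (hp : p ∈ stabilitySet φ) (hpx : ∀ x ∈ stabilitySet φ, ∃ t : ℝ, 0 ≤ t ∧ x = p + t • d) :
    ∃ q, ratToReal q = p := by
  refine exists_ratToReal_eq fun v => ?_
  rcases le_total 0 (d ⬝ᵥ toReal v) with hv | hv
  · rw [← h.apply_eq_of_ray hc hp hpx hv]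
    exact hrat v
  · obtain ⟨q, hq⟩ := hrat (-v)
    rw [toReal_neg, h.apply_eq_of_ray hc hp hpx (by rwa [dotProduct_neg, neg_nonneg]),
      dotProduct_neg, neg_eq_iff_eq_neg] at hq
    exact ⟨-q, by rw [hq, Rat.cast_neg]⟩

theorem IsConical.hasRationalAffineHull_of_line (h : IsConical φ) (hc : ConcaveOn ℝ Set.univ φ)
    (hrat : ∀ w : Fin n → ℤ, ∃ q : ℚ, φ (toReal w) = q)
    (hd : ∀ x ∈ stabilitySet φ, ∀ y ∈ stabilitySet φ, ∃ t : ℝ, y - x = t • d) :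
    HasRationalAffineHull (stabilitySet φ) := by
  obtain ⟨m₁, hm₁, hm₁d⟩ := h.exists_mem_stabilitySet hc d
  obtain ⟨m₂, hm₂, hm₂d⟩ := h.exists_mem_stabilitySet hc (-d)
  have hray₁ := fun x => h.exists_eq_add_smul hm₁ hm₁d hd (x := x)
  have hray₂ := fun x => h.exists_eq_add_smul hm₂ hm₂d (fun x hx y hy =>
    let ⟨t, ht⟩ := hd x hx y hy
    ⟨-t, by rw [ht, neg_smul_neg]⟩) (x := x)
  obtain ⟨q₁, rfl⟩ := h.exists_ratToReal_eq_of_ray hc hrat hm₁ hray₁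
  obtain ⟨q₂, rfl⟩ := h.exists_ratToReal_eq_of_ray hc hrat hm₂ hray₂
  refine ⟨{q₁, q₂}, ?_⟩
  rw [Set.image_pair]
  refine le_antisymm (affineSpan_mono ℝ (Set.pair_subset hm₁ hm₂)) (affineSpan_le.2 fun x hx => ?_)
  obtain ⟨t, ht, rfl⟩ := hray₁ x hx
  obtain ⟨u, hu, hux⟩ := hray₂ _ hx
  have hq₂ : ratToReal q₂ = ratToReal q₁ + (t + u) • d := by
    rw [add_smul, ← add_assoc, hux, smul_neg, neg_add_cancel_right]
  rw [SetLike.mem_coe, show ratToReal q₁ + t • d =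
    AffineMap.lineMap (ratToReal q₁) (ratToReal q₂) (t / (t + u)) from ?_]
  · exact AffineMap.lineMap_mem_affineSpan_pair _ _ _
  rw [AffineMap.lineMap_apply, hq₂, vsub_eq_sub, add_sub_cancel_left, vadd_eq_add, smul_smul,
    div_mul_cancel_of_imp (fun h0 => by linarith), add_comm]

theorem IsConical.hasRationalAffineHull_of_le_two (h : IsConical φ) (hc : ConcaveOn ℝ Set.univ φ)
    (hrat : ∀ w : Fin n → ℤ, ∃ q : ℚ, φ (toReal w) = q) (hn : n ≤ 2) :
    HasRationalAffineHull (stabilitySet φ) := by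
  by_cases htop : affineSpan ℝ (stabilitySet φ) = ⊤
  · exact hasRationalAffineHull_of_eq_top htop
  obtain ⟨m, hm, -⟩ := h.exists_mem_stabilitySet hc 0
  have hdir : (affineSpan ℝ (stabilitySet φ)).direction ≠ ⊤ := by
    rwa [Ne, AffineSubspace.direction_eq_top_iff_of_nonempty ⟨m, subset_affineSpan ℝ _ hm⟩]
  have hlt := Submodule.finrank_lt hdir
  rw [Module.finrank_fin_fun] at hlt
  obtain ⟨d, hd⟩ := finrank_le_one_iff.1
    (show Module.finrank ℝ (affineSpan ℝ (stabilitySet φ)).direction ≤ 1 by lia)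
  refine h.hasRationalAffineHull_of_line hc hrat (d := d) fun x hx y hy => ?_
  obtain ⟨t, ht⟩ := hd ⟨y -ᵥ x, AffineSubspace.vsub_mem_direction (subset_affineSpan ℝ _ hy)
    (subset_affineSpan ℝ _ hx)⟩
  exact ⟨t, (congrArg Subtype.val ht).symm⟩

end Line

/-! ### Principal primes in domains -/

theorem height_span_singleton_eq_one {A : Type*} [CommRing A] [IsDomain A] {x : A} (hx : Prime x)
    (hfin : ∀ a : A, a ≠ 0 → FiniteMultiplicity x a) : (Ideal.span {x}).height = 1 := by
  have hp : (Ideal.span {x}).IsPrime := (Ideal.span_singleton_prime hx.ne_zero).2 hx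
  apply le_antisymm
  · refine (Ideal.height_le_iff (n := 1)).2 fun q hq hlt => ?_
    have : q = ⊥ := by
      refine eq_bot_iff.2 fun a ha => ?_
      rw [Ideal.mem_bot]
      by_contra ha0
      obtain ⟨c, hac, hxc⟩ := (hfin a ha0).exists_eq_pow_mul_and_not_dvd
      have hxq : x ∉ q := fun h => hlt.not_ge ((Ideal.span_singleton_le_iff_mem q).2 h)
      rw [hac] at ha
      rcases hq.mem_or_mem ha with h | h
      · exact hxq (hq.mem_of_pow_mem _ h)
      · exact hxc (Ideal.mem_span_singleton.1 (hlt.le h))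
    rw [Ideal.height_eq_zero_iff_eq_bot.2 this]
    norm_num
  · rw [Order.one_le_iff_pos, pos_iff_ne_zero, Ne, Ideal.height_eq_zero_iff_eq_bot,
      Ideal.span_singleton_eq_bot]
    exact hx.ne_zero

section PrimeSubring

variable {A : Type*} [CommRing A] [IsDomain A] [UniqueFactorizationMonoid A] (K : Type*) [Field K]
  [Algebra A K] [IsFractionRing A K]

/-- The localization of a unique factorization domain `A` at a prime element, as a subring of the
fraction field `K`: the local ring of a prime divisor of `Spec A`. -/
def primeSubring {x : A} (hx : Prime x) : ValuationSubring K where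
  carrier := {f | ∃ a b : A, ¬ x ∣ b ∧ f * algebraMap A K b = algebraMap A K a}
  mul_mem' := by
    rintro f g ⟨a, b, hb, h⟩ ⟨c, d, hd, h'⟩
    refine ⟨a * c, b * d, fun hbd => (hx.dvd_or_dvd hbd).elim hb hd, ?_⟩
    rw [map_mul, map_mul, ← h, ← h']
    ring
  one_mem' := ⟨1, 1, fun h => hx.not_isUnit (isUnit_of_dvd_one h), by simp⟩
  add_mem' := by
    rintro f g ⟨a, b, hb, h⟩ ⟨c, d, hd, h'⟩
    refine ⟨a * d + c * b, b * d, fun hbd => (hx.dvd_or_dvd hbd).elim hb hd, ?_⟩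
    rw [map_add, map_mul, map_mul, map_mul, ← h, ← h']
    ring
  zero_mem' := ⟨0, 1, fun h => hx.not_isUnit (isUnit_of_dvd_one h), by simp⟩
  neg_mem' := by
    rintro f ⟨a, b, hb, h⟩
    exact ⟨-a, b, hb, by rw [map_neg, ← h, neg_mul]⟩
  mem_or_inv_mem' := by
    intro f
    obtain ⟨a, b, hab, rfl⟩ := IsFractionRing.exists_reduced_fraction A f
    rw [IsFractionRing.mk'_eq_div]
    have hb0 : algebraMap A K b ≠ 0 := IsFractionRing.to_map_ne_zero_of_mem_nonZeroDivisors b.2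
    by_cases hb : x ∣ (b : A)
    · have ha : ¬ x ∣ a := fun ha => hx.not_isUnit (hab ha hb)
      have ha0 : algebraMap A K a ≠ 0 := by
        rw [Ne, IsFractionRing.to_map_eq_zero_iff]
        rintro rfl
        exact ha (dvd_zero x)
      refine Or.inr ⟨b, a, ha, ?_⟩
      rw [inv_div, div_mul_cancel₀ _ ha0]
    · exact Or.inl ⟨a, b, hb, by rw [div_mul_cancel₀ _ hb0]⟩

variable {K}

theorem algebraMap_mem_primeSubring {x : A} (hx : Prime x) (a : A) :
    algebraMap A K a ∈ primeSubring K hx :=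
  ⟨a, 1, fun h => hx.not_isUnit (isUnit_of_dvd_one h), by simp⟩

theorem isUnit_of_mul_algebraMap_eq {x : A} {hx : Prime x} {z : primeSubring K hx} {a b : A}
    (ha : ¬ x ∣ a) (h : (z : K) * algebraMap A K b = algebraMap A K a) : IsUnit z := by
  have ha0 : algebraMap A K a ≠ 0 := by
    rw [Ne, IsFractionRing.to_map_eq_zero_iff]
    rintro rfl
    exact ha (dvd_zero x)
  have hmem : algebraMap A K b / algebraMap A K a ∈ primeSubring K hx :=
    ⟨b, a, ha, div_mul_cancel₀ _ ha0⟩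
  refine IsUnit.of_mul_eq_one ⟨_, hmem⟩ (Subtype.ext ?_)
  change (z : K) * (algebraMap A K b / algebraMap A K a) = 1
  rw [← mul_div_assoc, h, div_self ha0]

theorem irreducible_algebraMap_primeSubring {x : A} (hx : Prime x) :
    Irreducible (⟨algebraMap A K x, algebraMap_mem_primeSubring hx x⟩ : primeSubring K hx) := by
  have hinj := IsFractionRing.injective A K
  refine ⟨fun hu => ?_, fun y z hyz => ?_⟩
  · obtain ⟨y, hy⟩ := hu.exists_right_inv
    obtain ⟨a, b, hb, h⟩ := y.2
    have hxy : algebraMap A K x * (y : K) = 1 := congrArg Subtype.val hy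
    refine hb ⟨a, hinj ?_⟩
    rw [map_mul, ← h, ← mul_assoc, hxy, one_mul]
  · obtain ⟨a, b, hb, h⟩ := y.2
    obtain ⟨c, d, hd, h'⟩ := z.2
    have hxyz : algebraMap A K x = (y : K) * z := congrArg Subtype.val hyz
    have hmul : x * (b * d) = a * c := by
      apply hinj
      rw [map_mul, map_mul, map_mul, ← h, ← h', hxyz]
      ring
    have hbd : ¬ x ∣ b * d := fun hbd => (hx.dvd_or_dvd hbd).elim hb hd
    rcases hx.dvd_or_dvd (Dvd.intro _ hmul) with ⟨a', rfl⟩ | ⟨c', rfl⟩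
    · have hbd' := mul_left_cancel₀ hx.ne_zero (hmul.trans (mul_assoc _ _ _))
      exact Or.inr (isUnit_of_mul_algebraMap_eq (fun hc => hbd (hbd' ▸ hc.mul_left _)) h')
    · have hbd' := mul_left_cancel₀ hx.ne_zero (hmul.trans (mul_left_comm _ _ _))
      exact Or.inl (isUnit_of_mul_algebraMap_eq (fun ha => hbd (hbd' ▸ ha.mul_right _)) h)

theorem exists_algebraMap_eq_of_forall_mem_primeSubring {f : K}
    (h : ∀ (x : A) (hx : Prime x), f ∈ primeSubring K hx) :
    ∃ a : A, algebraMap A K a = f := by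
  refine IsFractionRing.isInteger_of_isUnit_den (A := A) ?_
  by_contra hu
  have hd0 : (IsFractionRing.den A f : A) ≠ 0 :=
    nonZeroDivisors.ne_zero (IsFractionRing.den A f).2
  obtain ⟨x, hx, hxd⟩ := WfDvdMonoid.exists_irreducible_factor hu hd0
  have hxp := UniqueFactorizationMonoid.irreducible_iff_prime.1 hx
  obtain ⟨a, b, hb, hab⟩ := h x hxp
  have hden : f * algebraMap A K (IsFractionRing.den A f) =
      algebraMap A K (IsFractionRing.num A f) :=
    IsFractionRing.num_mul_den_eq_num_iff_eq.2 rfl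
  have hnum : IsFractionRing.num A f * b = a * IsFractionRing.den A f := by
    apply IsFractionRing.injective A K
    rw [map_mul, map_mul, ← hden, ← hab]
    ring
  have hxn : x ∣ IsFractionRing.num A f :=
    (hxp.dvd_or_dvd (hnum ▸ hxd.mul_left a)).resolve_right hb
  exact hx.not_isUnit (IsFractionRing.num_den_reduced A f hxn hxd)

end PrimeSubring

/-! ### Discrete valuations -/

section DiscreteValuation

variable {K : Type*} [Field K] (w : AddValuation K (WithTop ℤ))

/-- The valuation ring of an additive valuation `w`. -/
def nonnegSubring : ValuationSubring K := (AddValuation.toValuation w).valuationSubring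

variable {w}

theorem mem_nonnegSubring {f : K} : f ∈ nonnegSubring w ↔ 0 ≤ w f := Iff.rfl

theorem valuation_nonnegSubring_le_iff {f g : K} :
    (nonnegSubring w).valuation f ≤ (nonnegSubring w).valuation g ↔ w g ≤ w f :=
  ((AddValuation.toValuation w).isEquiv_valuation_valuationSubring f g).symm

theorem isUnit_nonnegSubring_iff {y : nonnegSubring w} : IsUnit y ↔ w y = 0 := by
  rw [(nonnegSubring w).valuation_eq_one_iff, ← map_one (nonnegSubring w).valuation,
    le_antisymm_iff, valuation_nonnegSubring_le_iff, valuation_nonnegSubring_le_iff, w.map_one,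
    ← le_antisymm_iff, eq_comm]

theorem irreducible_nonnegSubring {y : nonnegSubring w} (hy : w y = 1) : Irreducible y := by
  refine ⟨fun hu => ?_, fun a b hab => ?_⟩
  · rw [isUnit_nonnegSubring_iff, hy] at hu
    exact one_ne_zero hu
  · have hadd : w a + w b = 1 := by rw [← hy, hab, MulMemClass.coe_mul, w.map_mul]
    have ha : 0 ≤ w a := a.2
    have hb : 0 ≤ w b := b.2
    rw [isUnit_nonnegSubring_iff, isUnit_nonnegSubring_iff]
    generalize w a = s at *
    generalize w b = t at *
    induction s <;> induction t <;> norm_cast at *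
    omega

theorem eq_one_of_irreducible_nonnegSubring {π : K} (hπ : w π = 1) {y : nonnegSubring w}
    (hy : Irreducible y) : w y = 1 := by
  have hπ' : Irreducible (⟨π, mem_nonnegSubring.2 (hπ ▸ zero_le_one)⟩ : nonnegSubring w) :=
    irreducible_nonnegSubring hπ
  have hassoc : Associated ⟨π, _⟩ y := (ValuationRing.dvd_total _ y).elim
    (hπ'.dvd_irreducible_iff_associated hy).1 fun h =>
      ((hy.dvd_irreducible_iff_associated hπ').1 h).symm
  obtain ⟨u, hu⟩ := hassoc
  rw [← hu, MulMemClass.coe_mul, w.map_mul, isUnit_nonnegSubring_iff.1 u.isUnit, add_zero, hπ]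

theorem map_zpow_of_eq_one {π : K} (hπ : w π = 1) (j : ℤ) : w (π ^ j) = j := by
  have hpow (i : ℕ) : w (π ^ i) = (i : WithTop ℤ) := by rw [w.map_pow, hπ, nsmul_one]
  obtain ⟨i, rfl | rfl⟩ := j.eq_nat_or_neg
  · rw [zpow_natCast, hpow]
    rfl
  · rw [zpow_neg, zpow_natCast, w.map_inv, hpow]
    rfl

theorem ordGE_nonnegSubring_iff {π : K} (hπ : w π = 1) {f : K} {j : ℤ} :
    OrdGE (nonnegSubring w) j f ↔ (j : WithTop ℤ) ≤ w f := by
  have hiff {ϖ : K} (hϖ : w ϖ = 1) : (nonnegSubring w).valuation f ≤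
      (nonnegSubring w).valuation ϖ ^ j ↔ (j : WithTop ℤ) ≤ w f := by
    rw [← map_zpow₀, valuation_nonnegSubring_le_iff, map_zpow_of_eq_one hϖ]
  refine ⟨fun h => ?_, fun h ϖ hϖ => (hiff (eq_one_of_irreducible_nonnegSubring hπ hϖ)).2 h⟩
  exact (hiff hπ).1 (h ⟨π, mem_nonnegSubring.2 (hπ ▸ zero_le_one)⟩ (irreducible_nonnegSubring hπ))

theorem mem_of_ordGE_zero {V : ValuationSubring K} {ϖ : V} (hϖ : Irreducible ϖ) {f : K}
    (h : OrdGE V 0 f) : f ∈ V := by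
  simpa only [zpow_zero, V.valuation_le_one_iff] using h ϖ hϖ

end DiscreteValuation

/-! ### Characters -/

variable {k : Type*} [Field k]

theorem character_add (m m' : Fin n → ℤ) :
    character k (m + m') = character k m * character k m' := by
  rw [character, character, character, AddMonoidAlgebra.single_mul_single, one_mul]

theorem character_zero : character k (0 : Fin n → ℤ) = 1 := rfl

theorem character_natCast_smul (j : ℕ) (m : Fin n → ℤ) :
    character k ((j : ℤ) • m) = character k m ^ j := by
  rw [character, character, AddMonoidAlgebra.single_pow, one_pow, natCast_zsmul]

theorem character_sum {ι : Type*} (s : Finset ι) (m : ι → Fin n → ℤ) :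
    character k (∑ i ∈ s, m i) = ∏ i ∈ s, character k (m i) :=
  map_prod (AddMonoidAlgebra.of k (Fin n → ℤ)) (fun i => Multiplicative.ofAdd (m i)) s

theorem coeff_mul_character (f : TorusRing k n) (m l : Fin n → ℤ) :
    (f * character k m).coeff l = f.coeff (l - m) := by
  rw [character, AddMonoidAlgebra.coeff_mul_single_apply, mul_one, sub_eq_add_neg]

/-- The inclusion of the exponents of monomials into the character lattice. -/
def exponentHom (n : ℕ) : (Fin n →₀ ℕ) →+ (Fin n → ℤ) where
  toFun s i := s i
  map_zero' := by funext i; simp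
  map_add' s t := by funext i; simp

/-- The inclusion of the polynomial ring into the ring of Laurent polynomials `k[M]`. -/
def laurentHom (k : Type*) [Field k] (n : ℕ) : MvPolynomial (Fin n) k →+* TorusRing k n :=
  AddMonoidAlgebra.mapDomainRingHom k (exponentHom n)

theorem laurentHom_monomial (s : Fin n →₀ ℕ) (c : k) :
    laurentHom k n (MvPolynomial.monomial s c) = AddMonoidAlgebra.single (exponentHom n s) c :=
  AddMonoidAlgebra.mapDomain_single

theorem laurentHom_injective : Function.Injective (laurentHom k n) :=
  AddMonoidAlgebra.mapDomain_injective fun _ _ h =>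
    Finsupp.ext fun i => Int.ofNat_inj.1 (congrFun h i)

theorem exists_mul_character_eq_laurentHom (f : TorusRing k n) :
    ∃ (s : Fin n →₀ ℕ) (a : MvPolynomial (Fin n) k),
      f * character k (exponentHom n s) = laurentHom k n a := by
  induction f using AddMonoidAlgebra.induction_linear with
  | zero => exact ⟨0, 0, by rw [zero_mul, map_zero]⟩
  | add f g hf hg =>
    obtain ⟨s, a, h⟩ := hf
    obtain ⟨t, b, h'⟩ := hg
    refine ⟨s + t, a * MvPolynomial.monomial t 1 + b * MvPolynomial.monomial s 1, ?_⟩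
    rw [map_add (laurentHom k n), map_mul, map_mul, ← h, ← h', laurentHom_monomial,
      laurentHom_monomial, map_add, character_add, ← character, ← character]
    ring
  | single m c =>
    refine ⟨Finsupp.equivFunOnFinite.symm fun i => (-m i).toNat,
      MvPolynomial.monomial (Finsupp.equivFunOnFinite.symm fun i => (m i).toNat) c, ?_⟩
    rw [laurentHom_monomial, character, AddMonoidAlgebra.single_mul_single, mul_one]
    congr 1
    funext i
    simp only [exponentHom, Pi.add_apply, AddMonoidHom.coe_mk, ZeroHom.coe_mk,
      Finsupp.equivFunOnFinite_symm_apply_apply]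
    omega

instance : UniqueFactorizationMonoid (TorusRing k n) := by
  let : Algebra (MvPolynomial (Fin n) k) (TorusRing k n) := (laurentHom k n).toAlgebra
  let M : Submonoid (MvPolynomial (Fin n) k) :=
    MonoidHom.mrange (MvPolynomial.monomialOneHom k (Fin n))
  have hloc : IsLocalization M (TorusRing k n) := by
    rw [isLocalization_iff]
    refine ⟨?_, fun f => ?_, fun hxy => ⟨1, by rw [laurentHom_injective hxy]⟩⟩
    · rintro ⟨_, s, rfl⟩
      refine IsUnit.of_mul_eq_one (character k (-exponentHom n s.toAdd)) ?_
      change laurentHom k n (MvPolynomial.monomial _ 1) * _ = 1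
      rw [laurentHom_monomial, ← character, ← character_add, add_neg_cancel, character_zero]
    · obtain ⟨s, a, h⟩ := exists_mul_character_eq_laurentHom f
      refine ⟨(a, ⟨_, Multiplicative.ofAdd s, rfl⟩), ?_⟩
      change f * laurentHom k n (MvPolynomial.monomial s 1) = laurentHom k n a
      rw [← h, laurentHom_monomial, character]
  exact UniqueFactorizationMonoid.of_isLocalization M (TorusRing k n)

/-! ### The order of a rational function along a toric divisor -/

/-- The inclusion of the ring of the torus into the field of rational functions. -/
abbrev torusMap (k : Type*) [Field k] (n : ℕ) : TorusRing k n →+* FunctionField k n :=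
  algebraMap (TorusRing k n) (FunctionField k n)

theorem torusMap_injective : Function.Injective (torusMap k n) :=
  IsFractionRing.injective _ _

theorem torusMap_character_ne_zero (m : Fin n → ℤ) : torusMap k n (character k m) ≠ 0 :=
  (map_ne_zero_iff _ torusMap_injective).2 (AddMonoidAlgebra.single_ne_zero.2 one_ne_zero)

/-- The homomorphism `∑ c_m χ^m ↦ ∑ c_m χ^m t^⟨m,v⟩` to Laurent series (encoded as Hahn series) over
`k(X)`, which turns the grading of `k[M]` by the pairing with `v` into powers of `t`. -/
def weightHom (k : Type*) [Field k] {n : ℕ} (v : Fin n → ℤ) :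
    TorusRing k n →+* HahnSeries ℤ (FunctionField k n) :=
  AddMonoidAlgebra.liftNCRingHom (HahnSeries.C.comp (algebraMap k (FunctionField k n)))
    { toFun := fun m => HahnSeries.single (m.toAdd ⬝ᵥ v) (torusMap k n (character k m.toAdd))
      map_one' := by
        rw [toAdd_one, zero_dotProduct, character_zero, map_one]
        rfl
      map_mul' := fun a b => by
        rw [toAdd_mul, add_dotProduct, character_add, map_mul, HahnSeries.single_mul_single] }
    fun _ _ => Commute.all _ _

theorem torusMap_single (m : Fin n → ℤ) (c : k) :
    torusMap k n (AddMonoidAlgebra.single m c) = c • torusMap k n (character k m) := by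
  have : AddMonoidAlgebra.single m c = c • character k m := by
    rw [character, AddMonoidAlgebra.smul_single, smul_eq_mul, mul_one]
  rw [this, Algebra.smul_def, map_mul, Algebra.smul_def,
    IsScalarTower.algebraMap_apply k (TorusRing k n) (FunctionField k n)]

theorem weightHom_single (v m : Fin n → ℤ) (c : k) :
    weightHom k v (AddMonoidAlgebra.single m c) =
      HahnSeries.single (m ⬝ᵥ v) (torusMap k n (AddMonoidAlgebra.single m c)) := by
  rw [torusMap_single, Algebra.smul_def, weightHom, AddMonoidAlgebra.liftNCRingHom_single]
  change HahnSeries.single 0 _ * HahnSeries.single (m ⬝ᵥ v) _ = _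
  rw [HahnSeries.single_mul_single, zero_add]
  rfl

theorem coeff_weightHom (v : Fin n → ℤ) (f : TorusRing k n) (j : ℤ) :
    (weightHom k v f).coeff j =
      torusMap k n (AddMonoidAlgebra.ofCoeff (f.coeff.filter fun m => m ⬝ᵥ v = j)) := by
  induction f using AddMonoidAlgebra.induction_linear with
  | zero => rw [map_zero, AddMonoidAlgebra.coeff_zero, Finsupp.filter_zero,
      AddMonoidAlgebra.ofCoeff_zero, map_zero, HahnSeries.coeff_zero]
  | add f g hf hg =>
    rw [map_add, HahnSeries.coeff_add, hf, hg, ← map_add, AddMonoidAlgebra.coeff_add,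
      Finsupp.filter_add, AddMonoidAlgebra.ofCoeff_add]
  | single m c =>
    rw [weightHom_single, AddMonoidAlgebra.coeff_single]
    by_cases h : m ⬝ᵥ v = j
    · rw [Finsupp.filter_single_of_pos (fun m => m ⬝ᵥ v = j) h, h, HahnSeries.coeff_single_same]
      rfl
    · rw [Finsupp.filter_single_of_neg (fun m => m ⬝ᵥ v = j) h,
        HahnSeries.coeff_single_of_ne (Ne.symm h), AddMonoidAlgebra.ofCoeff_zero, map_zero]

theorem coeff_weightHom_eq_zero {v : Fin n → ℤ} {f : TorusRing k n} {j : ℤ} :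
    (weightHom k v f).coeff j = 0 ↔ ∀ m ∈ f.coeff.support, m ⬝ᵥ v ≠ j := by
  rw [coeff_weightHom, map_eq_zero_iff _ torusMap_injective, AddMonoidAlgebra.ofCoeff_eq_zero,
    Finsupp.filter_eq_zero_iff]
  constructor
  · intro h m hm hj
    exact Finsupp.mem_support_iff.1 hm (h m hj)
  · intro h m hj
    by_contra hm
    exact h m (Finsupp.mem_support_iff.2 hm) hj

theorem weightHom_injective (v : Fin n → ℤ) : Function.Injective (weightHom k v) := by
  refine (injective_iff_map_eq_zero _).2 fun f hf => ?_
  rw [← AddMonoidAlgebra.coeff_eq_zero, ← Finsupp.support_eq_empty]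
  refine Finset.eq_empty_of_forall_notMem fun m hm => ?_
  have h : (weightHom k v f).coeff (m ⬝ᵥ v) = 0 := by
    rw [hf]
    rfl
  exact coeff_weightHom_eq_zero.1 h m hm rfl

/-- The order of vanishing of rational functions along the toric divisor of `v`, read off as the
`t`-adic order of the Laurent series given by `weightHom`. -/
def toricOrd (k : Type*) [Field k] {n : ℕ} (v : Fin n → ℤ) :
    AddValuation (FunctionField k n) (WithTop ℤ) :=
  (HahnSeries.addVal ℤ (FunctionField k n)).comap
    (IsFractionRing.lift (A := TorusRing k n) (g := weightHom k v)
      (weightHom_injective v))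

theorem le_toricOrd_torusMap {v : Fin n → ℤ} {f : TorusRing k n} {j : ℤ} :
    (j : WithTop ℤ) ≤ toricOrd k v (torusMap k n f) ↔ ∀ m ∈ f.coeff.support, j ≤ m ⬝ᵥ v := by
  have hord : toricOrd k v (torusMap k n f) = (weightHom k v f).orderTop := by
    change HahnSeries.addVal _ _ (IsFractionRing.lift _ _) = _
    rw [IsFractionRing.lift_algebraMap, HahnSeries.addVal_apply]
  rw [hord, HahnSeries.le_orderTop_iff_forall]
  constructor
  · intro h m hm
    by_contra! hlt
    exact coeff_weightHom_eq_zero.1 (h (m ⬝ᵥ v) (by exact_mod_cast hlt)) m hm rfl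
  · intro h i hi
    refine coeff_weightHom_eq_zero.2 fun m hm hmi => ?_
    exact ((WithTop.coe_lt_coe.1 hi).trans_le (h m hm)).ne' hmi

theorem toricOrd_character (v m : Fin n → ℤ) :
    toricOrd k v (torusMap k n (character k m)) = ((m ⬝ᵥ v : ℤ) : WithTop ℤ) := by
  change HahnSeries.addVal _ _ (IsFractionRing.lift _ _) = _
  rw [IsFractionRing.lift_algebraMap, HahnSeries.addVal_apply, character, weightHom_single,
    HahnSeries.orderTop_single]
  exact torusMap_character_ne_zero m

/-- The local ring of the toric divisor of `v`. -/
def toricSubring (k : Type*) [Field k] {n : ℕ} (v : Fin n → ℤ) :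
    ValuationSubring (FunctionField k n) :=
  nonnegSubring (toricOrd k v)

theorem mem_toricSubring {v : Fin n → ℤ} {f : FunctionField k n} :
    f ∈ toricSubring k v ↔ 0 ≤ toricOrd k v f :=
  mem_nonnegSubring

theorem ordGE_toricSubring_iff {v m : Fin n → ℤ} (hm : m ⬝ᵥ v = 1) {j : ℤ}
    {f : FunctionField k n} : OrdGE (toricSubring k v) j f ↔ (j : WithTop ℤ) ≤ toricOrd k v f :=
  ordGE_nonnegSubring_iff (π := torusMap k n (character k m)) (by rw [toricOrd_character, hm]; rfl)

/-! ### The rings of the charts -/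

theorem support_character (m : Fin n → ℤ) : (character k m).coeff.support = {m} := by
  rw [character, AddMonoidAlgebra.coeff_single, Finsupp.support_single _ one_ne_zero]

theorem mem_support_mul_character {f : TorusRing k n} {l m : Fin n → ℤ} :
    m ∈ (f * character k l).coeff.support ↔ m - l ∈ f.coeff.support := by
  rw [Finsupp.mem_support_iff, Finsupp.mem_support_iff, coeff_mul_character]

theorem mem_chart {σ : Cone n} {f : TorusRing k n} :
    f ∈ chart k σ ↔ ∀ m ∈ f.coeff.support, ∀ u ∈ σ, 0 ≤ toReal m ⬝ᵥ u := by
  classical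
  constructor
  · intro hf
    induction hf using Algebra.adjoin_induction with
    | mem f hf =>
      obtain ⟨m, hm, rfl⟩ := hf
      intro m' hm'
      rw [support_character, Finset.mem_singleton] at hm'
      rwa [hm']
    | algebraMap c =>
      intro m hm u _
      rw [AddMonoidAlgebra.coe_algebraMap, Function.comp_apply,
        AddMonoidAlgebra.coeff_single] at hm
      rw [Finset.mem_singleton.1 (Finsupp.support_single_subset hm), toReal_zero, zero_dotProduct]
    | add f g _ _ hf hg =>
      intro m hm
      rw [AddMonoidAlgebra.coeff_add] at hm
      exact (Finset.mem_union.1 (Finsupp.support_add hm)).elim (hf m) (hg m)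
    | mul f g _ _ hf hg =>
      intro m hm u hu
      obtain ⟨a, ha, b, hb, rfl⟩ := Finset.mem_add.1
        (AddMonoidAlgebra.support_coeff_mul_subset f g hm)
      rw [toReal_add, add_dotProduct]
      exact add_nonneg (hf a ha u hu) (hg b hb u hu)
  · intro h
    refine (Submodule.span_le (p := Subalgebra.toSubmodule (chart k σ))).2 ?_
      (AddMonoidAlgebra.mem_span_support_coeff f)
    rintro _ ⟨m, hm, rfl⟩
    exact Algebra.subset_adjoin ⟨m, h m hm, rfl⟩

theorem mem_chart_coneOf {F : Finset (Fin n → ℤ)} {f : TorusRing k n} :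
    f ∈ chart k (coneOf F) ↔ ∀ m ∈ f.coeff.support, ∀ w ∈ F, 0 ≤ m ⬝ᵥ w := by
  rw [mem_chart]
  refine forall₂_congr fun m _ =>
    ⟨fun h w hw => ?_, fun h u hu => dotProduct_nonneg_of_mem_coneOf h hu⟩
  have := h _ (toReal_mem_coneOf hw)
  rw [toReal_dotProduct] at this
  exact_mod_cast this

/-- Families of characters dual to a finite set of lattice vectors. -/
def IsDualFamily (F : Finset (Fin n → ℤ)) (μ : (Fin n → ℤ) → Fin n → ℤ) : Prop :=
  ∀ v ∈ F, ∀ w ∈ F, μ v ⬝ᵥ w = if v = w then 1 else 0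

theorem IsUnimodular.exists_isDualFamily {F : Finset (Fin n → ℤ)} (hF : IsUnimodular F) :
    ∃ μ, IsDualFamily F μ := by
  have hdual : ∀ v ∈ F, ∃ m : Fin n → ℤ, ∀ w ∈ F, m ⬝ᵥ w = if v = w then 1 else 0 := by
    intro v hv
    obtain ⟨m, hone, hzero, -⟩ := hF.exists_dual hv
    refine ⟨m, fun w hw => ?_⟩
    split_ifs with hvw
    · rw [← hvw, hone]
    · exact hzero w hw (Ne.symm hvw)
  choose! μ hμ using hdual
  exact ⟨μ, hμ⟩

namespace IsDualFamily

variable {F : Finset (Fin n → ℤ)} {μ : (Fin n → ℤ) → Fin n → ℤ} {v : Fin n → ℤ}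

theorem dotProduct_self (hμ : IsDualFamily F μ) (hv : v ∈ F) : μ v ⬝ᵥ v = 1 := by
  rw [hμ v hv v hv, if_pos rfl]

theorem sum_smul_dotProduct (hμ : IsDualFamily F μ) (a : (Fin n → ℤ) → ℤ) {w : Fin n → ℤ}
    (hw : w ∈ F) : (∑ v ∈ F, a v • μ v) ⬝ᵥ w = a w := by
  rw [sum_dotProduct, Finset.sum_congr rfl fun v hv => by rw [smul_dotProduct, hμ v hv w hw],
    Finset.sum_eq_single_of_mem w hw fun v _ hvw => by rw [if_neg hvw, smul_zero], if_pos rfl,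
    smul_eq_mul, mul_one]

theorem mul_character_mem_chart (hμ : IsDualFamily F μ) {a : (Fin n → ℤ) → ℤ} {f : TorusRing k n}
    (hf : ∀ m ∈ f.coeff.support, ∀ w ∈ F, -a w ≤ m ⬝ᵥ w) :
    f * character k (∑ w ∈ F, a w • μ w) ∈ chart k (coneOf F) := by
  refine mem_chart_coneOf.2 fun m hm w hw => ?_
  have h := hf _ (mem_support_mul_character.1 hm) w hw
  rw [sub_dotProduct, hμ.sum_smul_dotProduct a hw] at h
  omega

variable (k) in
/-- The character `χ^{μ_v}`, which is a local equation of the toric divisor of `v` in the chart of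
the cone generated by `F`. -/
def localEquation (hμ : IsDualFamily F μ) (hv : v ∈ F) : chart k (coneOf F) :=
  ⟨character k (μ v), mem_chart_coneOf.2 fun m hm w hw => by
    rw [support_character, Finset.mem_singleton] at hm
    rw [hm, hμ v hv w hw]
    split_ifs <;> norm_num⟩

end IsDualFamily

/-! ### The local rings of the toric divisors -/

theorem eq_zero_of_nonneg_of_lt_one {x : WithTop ℤ} (h0 : 0 ≤ x) (h1 : x < 1) : x = 0 := by
  induction x with
  | top => exact absurd h1 not_top_lt
  | coe i =>
    norm_cast at *
    omega

section Chart

variable {F : Finset (Fin n → ℤ)} {v : Fin n → ℤ} {μ : (Fin n → ℤ) → Fin n → ℤ}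

theorem toricOrd_nonneg_of_mem_chart (hv : v ∈ F) {f : TorusRing k n}
    (hf : f ∈ chart k (coneOf F)) : 0 ≤ toricOrd k v (torusMap k n f) :=
  le_toricOrd_torusMap.2 fun m hm => mem_chart_coneOf.1 hf m hm v hv

variable (hμ : IsDualFamily F μ) (hv : v ∈ F)

theorem toricOrd_localEquation : toricOrd k v (torusMap k n (hμ.localEquation k hv)) = 1 := by
  change toricOrd k v (torusMap k n (character k (μ v))) = 1
  rw [toricOrd_character, hμ.dotProduct_self hv]
  rfl

theorem localEquation_dvd_iff {a : chart k (coneOf F)} :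
    hμ.localEquation k hv ∣ a ↔ 1 ≤ toricOrd k v (torusMap k n a) := by
  constructor
  · rintro ⟨b, rfl⟩
    rw [MulMemClass.coe_mul, map_mul, AddValuation.map_mul, toricOrd_localEquation]
    exact le_add_of_nonneg_right (toricOrd_nonneg_of_mem_chart hv b.2)
  · intro h
    have hord := (le_toricOrd_torusMap (j := 1)).1 h
    have hmem : (a : TorusRing k n) * character k (-μ v) ∈ chart k (coneOf F) := by
      refine mem_chart_coneOf.2 fun l hl w hw => ?_
      rw [mem_support_mul_character, sub_neg_eq_add] at hl
      have hlw := mem_chart_coneOf.1 a.2 _ hl w hw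
      have hlv := hord _ hl
      rw [add_dotProduct, hμ v hv _ ‹_›] at hlw hlv
      split_ifs at hlw with hvw
      · subst hvw
        rw [if_pos rfl] at hlv
        omega
      · omega
    refine ⟨⟨_, hmem⟩, Subtype.ext ?_⟩
    change (a : TorusRing k n) = character k (μ v) * (a * character k (-μ v))
    rw [mul_left_comm, ← character_add, add_neg_cancel, character_zero, mul_one]

theorem prime_localEquation : Prime (hμ.localEquation k hv) := by
  refine ⟨fun h => ?_, fun h => ?_, fun a b h => ?_⟩
  · exact torusMap_character_ne_zero (k := k) (μ v)
      ((congrArg (torusMap k n) (congrArg Subtype.val h)).trans (map_zero _))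
  · have h1 := (localEquation_dvd_iff hμ hv).1 (isUnit_iff_dvd_one.1 h)
    rw [OneMemClass.coe_one, map_one, AddValuation.map_one] at h1
    exact absurd h1 (by norm_num)
  · by_contra! hab
    rw [localEquation_dvd_iff, localEquation_dvd_iff, not_le, not_le] at hab
    have ha := eq_zero_of_nonneg_of_lt_one (toricOrd_nonneg_of_mem_chart hv a.2) hab.1
    have hb := eq_zero_of_nonneg_of_lt_one (toricOrd_nonneg_of_mem_chart hv b.2) hab.2
    rw [localEquation_dvd_iff, MulMemClass.coe_mul, map_mul, AddValuation.map_mul, ha, hb] at h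
    exact absurd h (by norm_num)

theorem finiteMultiplicity_localEquation {a : chart k (coneOf F)} (ha : a ≠ 0) :
    FiniteMultiplicity (hμ.localEquation k hv) a := by
  have hfin : toricOrd k v (torusMap k n a) ≠ ⊤ := by
    rw [AddValuation.ne_top_iff, Ne, map_eq_zero_iff _ torusMap_injective]
    exact fun h => ha (Subtype.ext h)
  obtain ⟨j, hj⟩ := WithTop.ne_top_iff_exists.1 hfin
  refine ⟨j.toNat, ?_⟩
  rintro ⟨b, rfl⟩
  rw [MulMemClass.coe_mul, SubmonoidClass.coe_pow, map_mul, AddValuation.map_mul, map_pow,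
    AddValuation.map_pow, toricOrd_localEquation, nsmul_one] at hj
  have hle : ((j.toNat + 1 : ℕ) : WithTop ℤ) ≤ j :=
    hj ▸ le_add_of_nonneg_right (toricOrd_nonneg_of_mem_chart hv b.2)
  have hle' : ((j.toNat + 1 : ℕ) : ℤ) ≤ j := by exact_mod_cast hle
  omega

theorem isPrime_span_localEquation : (Ideal.span {hμ.localEquation k hv}).IsPrime :=
  (Ideal.span_singleton_prime (prime_localEquation hμ hv).ne_zero).2 (prime_localEquation hμ hv)

theorem height_span_localEquation : (Ideal.span {hμ.localEquation k hv}).height = 1 :=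
  height_span_singleton_eq_one (prime_localEquation hμ hv)
    fun _ => finiteMultiplicity_localEquation hμ hv

theorem toricOrd_nonneg_of_mul_eq {f : FunctionField k n} {a b : chart k (coneOf F)}
    (hb : b ∉ Ideal.span {hμ.localEquation k hv}) (h : f * torusMap k n b = torusMap k n a) :
    0 ≤ toricOrd k v f := by
  rw [Ideal.mem_span_singleton, localEquation_dvd_iff, not_le] at hb
  have hb0 := eq_zero_of_nonneg_of_lt_one (toricOrd_nonneg_of_mem_chart hv b.2) hb
  have ha := toricOrd_nonneg_of_mem_chart (k := k) hv a.2
  rwa [← h, AddValuation.map_mul, hb0, add_zero] at ha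

-- Multiplying numerator and denominator by a common character makes both regular on the chart, and
-- the denominator nonvanishing along the divisor.
theorem exists_mul_eq_of_toricOrd_nonneg {f : FunctionField k n} (hf : 0 ≤ toricOrd k v f) :
    ∃ a b : chart k (coneOf F), b ∉ Ideal.span {hμ.localEquation k hv} ∧
      f * torusMap k n b = torusMap k n a := by
  classical
  obtain ⟨g, h, hh, rfl⟩ := IsFractionRing.div_surjective (A := TorusRing k n) f
  have hh0 : torusMap k n h ≠ 0 := IsFractionRing.to_map_ne_zero_of_mem_nonZeroDivisors hh
  obtain ⟨c, hc⟩ := WithTop.ne_top_iff_exists.1 ((AddValuation.ne_top_iff (toricOrd k v)).2 hh0)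
  have hg : (c : WithTop ℤ) ≤ toricOrd k v (torusMap k n g) := by
    rw [hc, ← div_mul_cancel₀ (torusMap k n g) hh0, AddValuation.map_mul]
    exact le_add_of_nonneg_left hf
  let s := g.coeff.support ∪ h.coeff.support
  let a (w : Fin n → ℤ) : ℤ := if w = v then -c else ∑ l ∈ s, |l ⬝ᵥ w|
  let M := ∑ w ∈ F, a w • μ w
  have hmem {p : TorusRing k n} (hp : p.coeff.support ⊆ s)
      (hpc : (c : WithTop ℤ) ≤ toricOrd k v (torusMap k n p)) :
      p * character k M ∈ chart k (coneOf F) := by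
    refine hμ.mul_character_mem_chart fun l hl w _ => ?_
    by_cases hwv : w = v
    · simpa only [a, hwv, if_true, neg_neg] using le_toricOrd_torusMap.1 hpc l hl
    · simp only [a, if_neg hwv]
      exact (neg_le_neg (Finset.single_le_sum (f := fun l => |l ⬝ᵥ w|) (fun _ _ => abs_nonneg _)
        (hp hl))).trans (neg_abs_le _)
  refine ⟨⟨_, hmem Finset.subset_union_left hg⟩, ⟨_, hmem Finset.subset_union_right hc.le⟩, ?_, ?_⟩
  · have hMv : M ⬝ᵥ v = -c := (hμ.sum_smul_dotProduct a hv).trans (if_pos rfl)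
    rw [Ideal.mem_span_singleton, localEquation_dvd_iff, not_le, map_mul, AddValuation.map_mul,
      ← hc, toricOrd_character, hMv, ← WithTop.coe_add, add_neg_cancel]
    norm_num
  · rw [map_mul, map_mul, ← mul_assoc, div_mul_cancel₀ _ hh0]

theorem isLocalRingAt_localEquation_iff {V : ValuationSubring (FunctionField k n)} :
    IsLocalRingAt (chart k (coneOf F)) (Ideal.span {hμ.localEquation k hv}) V ↔
      V = toricSubring k v := by
  have hiff (f : FunctionField k n) : (∃ a b : chart k (coneOf F),
      b ∉ Ideal.span {hμ.localEquation k hv} ∧ f * torusMap k n b = torusMap k n a) ↔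
      f ∈ toricSubring k v :=
    ⟨fun ⟨_, _, hb, h⟩ => toricOrd_nonneg_of_mul_eq hμ hv hb h,
      exists_mul_eq_of_toricOrd_nonneg hμ hv⟩
  refine ⟨fun h => ?_, ?_⟩
  · ext f
    rw [h f, hiff]
  · rintro rfl f
    exact (hiff f).symm

end Chart

theorem span_character_eq_span_localEquation {v : Fin n → ℤ} {μ : (Fin n → ℤ) → Fin n → ℤ}
    (hμ : IsDualFamily {v} μ) :
    Ideal.span {a : chart k (coneOf {v}) |
        ∃ m : Fin n → ℤ, 0 < m ⬝ᵥ v ∧ (a : TorusRing k n) = character k m} =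
      Ideal.span {hμ.localEquation k (Finset.mem_singleton_self v)} := by
  apply le_antisymm <;> refine Ideal.span_le.2 ?_
  · rintro a ⟨l, hl, ha⟩
    rw [SetLike.mem_coe, Ideal.mem_span_singleton, localEquation_dvd_iff, ha, toricOrd_character]
    exact_mod_cast hl
  · rintro _ rfl
    refine Ideal.subset_span ⟨μ v, ?_, rfl⟩
    rw [hμ.dotProduct_self (Finset.mem_singleton_self v)]
    exact one_pos

-- `rayCone v` and `coneOf {v}` are equal only propositionally, and the type of ideals of the chart
-- depends on the cone; the motive transports along this equality.
theorem toricIdeal_of_span_localEquation {v : Fin n → ℤ} {μ : (Fin n → ℤ) → Fin n → ℤ}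
    (hμ : IsDualFamily {v} μ) {P : ∀ σ : Cone n, Ideal (chart k σ) → Prop}
    (h : P (coneOf {v}) (Ideal.span {hμ.localEquation k (Finset.mem_singleton_self v)})) :
    P (rayCone v) (toricIdeal k v) := by
  rw [← span_character_eq_span_localEquation] at h
  unfold toricIdeal
  revert h
  rw [coneOf_singleton]
  exact id

theorem isToricPrime_iff {v : Fin n → ℤ} (hF : IsUnimodular {v})
    {V : ValuationSubring (FunctionField k n)} : IsToricPrime v V ↔ V = toricSubring k v := by
  obtain ⟨μ, hμ⟩ := hF.exists_isDualFamily
  exact toricIdeal_of_span_localEquation hμ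
    (P := fun σ I => IsLocalRingAt (chart k σ) I V ↔ V = toricSubring k v)
    (isLocalRingAt_localEquation_iff hμ _)

theorem isPrimeDivisor_toricSubring {S : Fan n} {v : Fin n → ℤ} (hv : v ∈ S.rays) :
    IsPrimeDivisor S (toricSubring k v) := by
  obtain ⟨μ, hμ⟩ := (S.mem_rays_iff.1 hv).1.exists_isDualFamily
  exact ⟨rayCone v, hv.2, toricIdeal k v, toricIdeal_of_span_localEquation hμ
    (P := fun σ p => p.IsPrime ∧ p.height = 1 ∧ IsLocalRingAt (chart k σ) p (toricSubring k v))
    ⟨isPrime_span_localEquation hμ _, height_span_localEquation hμ _,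
      (isLocalRingAt_localEquation_iff hμ _).2 rfl⟩⟩

theorem torusMap_mem_of_localEquation_notMem {F : Finset (Fin n → ℤ)}
    {μ : (Fin n → ℤ) → Fin n → ℤ} (hμ : IsDualFamily F μ) {p : Ideal (chart k (coneOf F))}
    (hp : p.IsPrime) {V : ValuationSubring (FunctionField k n)}
    (hloc : IsLocalRingAt (chart k (coneOf F)) p V)
    (hnot : ∀ (w : Fin n → ℤ) (hw : w ∈ F), hμ.localEquation k hw ∉ p) (g : TorusRing k n) :
    torusMap k n g ∈ V := by
  let N (w : Fin n → ℤ) : ℕ := ∑ l ∈ g.coeff.support, (l ⬝ᵥ w).natAbs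
  have hmem : g * character k (∑ w ∈ F, (N w : ℤ) • μ w) ∈ chart k (coneOf F) := by
    refine hμ.mul_character_mem_chart fun l hl w _ => ?_
    have h : (l ⬝ᵥ w).natAbs ≤ N w :=
      Finset.single_le_sum (f := fun l => (l ⬝ᵥ w).natAbs) (fun _ _ => Nat.zero_le _) hl
    omega
  let b : chart k (coneOf F) := ∏ w : F, hμ.localEquation k w.2 ^ N w
  have hb : b ∉ p := by
    intro hbp
    obtain ⟨w, -, hw⟩ := (Ideal.IsPrime.prod_mem_iff (hp := hp)).1 hbp
    exact hnot w w.2 (hp.mem_of_pow_mem _ hw)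
  have hbM : (b : TorusRing k n) = character k (∑ w ∈ F, (N w : ℤ) • μ w) := by
    rw [character_sum, ← Finset.prod_coe_sort]
    simp only [b, SubmonoidClass.coe_finsetProd, SubmonoidClass.coe_pow, character_natCast_smul]
    rfl
  exact (hloc _).2 ⟨⟨_, hmem⟩, b, hb, by rw [hbM, ← map_mul]⟩

theorem IsPrimeDivisor.exists_isToricPrime_or_forall_torusMap_mem {S : Fan n}
    {V : ValuationSubring (FunctionField k n)} (hV : IsPrimeDivisor S V) :
    (∃ v : S.rays, IsToricPrime (v : Fin n → ℤ) V) ∨ ∀ g, torusMap k n g ∈ V := by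
  obtain ⟨σ, hσ, p, hp, hheight, hloc⟩ := hV
  obtain ⟨F, hF, rfl⟩ := isSmoothCone_iff.1 (S.smooth σ hσ)
  obtain ⟨μ, hμ⟩ := hF.exists_isDualFamily
  by_cases hex : ∃ (w : Fin n → ℤ) (hw : w ∈ F), hμ.localEquation k hw ∈ p
  · obtain ⟨w, hw, hwp⟩ := hex
    have hray := S.mem_rays_of_mem_face hF hσ hw
    have hspan := Ideal.eq_span_singleton_of_height_eq_one hheight hwp (prime_localEquation hμ hw)
    exact Or.inl ⟨⟨w, hray⟩, (isToricPrime_iff (S.mem_rays_iff.1 hray).1).2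
      ((isLocalRingAt_localEquation_iff hμ hw).1 (hspan ▸ hloc))⟩
  · push Not at hex
    exact Or.inr (torusMap_mem_of_localEquation_notMem hμ hp hloc hex)

/-! ### Prime divisors meeting the torus -/

theorem Fan.coneOf_empty_mem_cones (S : Fan n) : coneOf ∅ ∈ S.cones := by
  obtain ⟨σ, hσ, -⟩ := S.complete 0
  obtain ⟨F, hF, rfl⟩ := isSmoothCone_iff.1 (S.smooth σ hσ)
  exact S.face_mem _ hσ _ (isFaceOf_coneOf hF (Finset.empty_subset F))

/-- The chart of the cone `{0}` is the torus. -/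
def chartEmptyEquiv (k : Type*) [Field k] (n : ℕ) :
    chart k (coneOf (∅ : Finset (Fin n → ℤ))) ≃+* TorusRing k n :=
  RingEquiv.ofBijective (chart k (coneOf ∅)).val.toRingHom
    ⟨Subtype.val_injective, fun f => ⟨⟨f, mem_chart_coneOf.2 fun _ _ _ hw =>
      absurd hw (Finset.notMem_empty _)⟩, rfl⟩⟩

theorem isPrimeDivisor_primeSubring (S : Fan n) {x : TorusRing k n} (hx : Prime x) :
    IsPrimeDivisor S (primeSubring (FunctionField k n) hx) := by
  let e := chartEmptyEquiv k n
  obtain ⟨y, rfl⟩ := e.surjective x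
  have hy : Prime y := (MulEquiv.prime_iff e.toMulEquiv).1 hx
  refine ⟨_, S.coneOf_empty_mem_cones, Ideal.span {y},
    (Ideal.span_singleton_prime hy.ne_zero).2 hy, height_span_singleton_eq_one hy fun a ha => ?_,
    fun f => ⟨?_, ?_⟩⟩
  · obtain ⟨j, hj⟩ := FiniteMultiplicity.of_prime_left hx ((map_ne_zero_iff e e.injective).2 ha)
    exact ⟨j, fun h => hj (map_pow e y _ ▸ map_dvd e h)⟩
  · rintro ⟨a, b, hb, h⟩
    obtain ⟨a, rfl⟩ := e.surjective a
    obtain ⟨b, rfl⟩ := e.surjective b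
    exact ⟨a, b, fun hyb => hb (map_dvd e (Ideal.mem_span_singleton.1 hyb)), h⟩
  · rintro ⟨a, b, hb, h⟩
    exact ⟨e a, e b, fun hyb => hb (Ideal.mem_span_singleton.2 ((map_dvd_iff e).1 hyb)), h⟩

theorem not_isToricPrime_primeSubring {S : Fan n} {x : TorusRing k n} (hx : Prime x)
    (v : S.rays) : ¬ IsToricPrime (v : Fin n → ℤ) (primeSubring (FunctionField k n) hx) := by
  intro h
  have hF := (S.mem_rays_iff.1 v.2).1
  rw [isToricPrime_iff hF] at h
  obtain ⟨m, hm, -⟩ := hF.exists_dual (Finset.mem_singleton_self _)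
  have hmem := algebraMap_mem_primeSubring (K := FunctionField k n) hx (character k (-m))
  rw [h, mem_toricSubring, toricOrd_character, neg_dotProduct, hm] at hmem
  exact absurd hmem (by decide)

/-! ### Global sections -/

theorem isSection_iff {S : Fan n} {D : ToricDivisor S} {f : FunctionField k n} :
    IsSection D f ↔ ∃ g : TorusRing k n, torusMap k n g = f ∧
      ∀ m ∈ g.coeff.support, ∀ v : S.rays, -⌊D v⌋ ≤ m ⬝ᵥ (v : Fin n → ℤ) := by
  have hord (v : S.rays) (g : TorusRing k n) :
      OrdGE (toricSubring k (v : Fin n → ℤ)) (-⌊D v⌋) (torusMap k n g) ↔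
        ∀ m ∈ g.coeff.support, -⌊D v⌋ ≤ m ⬝ᵥ (v : Fin n → ℤ) := by
    obtain ⟨l, hl, -⟩ := (S.mem_rays_iff.1 v.2).1.exists_dual (Finset.mem_singleton_self _)
    rw [ordGE_toricSubring_iff hl, le_toricOrd_torusMap]
  constructor
  · intro hf
    obtain ⟨g, rfl⟩ := exists_algebraMap_eq_of_forall_mem_primeSubring fun x hx =>
      mem_of_ordGE_zero (irreducible_algebraMap_primeSubring hx)
        ((hf _ (isPrimeDivisor_primeSubring S hx)).2 (not_isToricPrime_primeSubring hx))
    refine ⟨g, rfl, fun m hm v => (hord v g).1 ?_ m hm⟩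
    exact (hf _ (isPrimeDivisor_toricSubring v.2)).1 v
      ((isToricPrime_iff (S.mem_rays_iff.1 v.2).1).2 rfl)
  · rintro ⟨g, rfl, hg⟩ V hV
    refine ⟨fun v hv => ?_, fun hnot => ?_⟩
    · rw [isToricPrime_iff (S.mem_rays_iff.1 v.2).1] at hv
      rw [hv, hord]
      exact fun m hm => hg m hm v
    · rcases hV.exists_isToricPrime_or_forall_torusMap_mem with ⟨v, hv⟩ | h
      · exact absurd hv (hnot v)
      · exact ordGE_of_mem (h g)

theorem BDivisor.mem_H0_iff {S : Fan n} {D : BDivisor S} {f : FunctionField k n} :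
    f ∈ D.H0 k ↔ ∃ g : TorusRing k n, torusMap k n g = f ∧
      ∀ m ∈ g.coeff.support, ∀ (S' : Model S) (v : S'.1.rays),
        -⌊D.inc S' v⌋ ≤ m ⬝ᵥ (v : Fin n → ℤ) := by
  change (∀ S' : Model S, IsSection (D.inc S') f) ↔ _
  constructor
  · intro h
    obtain ⟨g, rfl, -⟩ := isSection_iff.1 (h ⟨S, Fan.Subdivides.refl S⟩)
    refine ⟨g, rfl, fun m hm S' v => ?_⟩
    obtain ⟨g', hg', h'⟩ := isSection_iff.1 (h S')
    rw [torusMap_injective hg'] at h'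
    exact h' m hm v
  · rintro ⟨g, rfl, h⟩ S'
    exact isSection_iff.2 ⟨g, rfl, fun m hm v => h m hm S' v⟩

/-! ### Graded semigroup rings -/

/-- The monomial `χ^m t^l` attached to `(l, m)`, in the ring of which section rings are
subalgebras. -/
def gradedMonomial (k : Type*) [Field k] {n : ℕ} (p : ℕ × (Fin n → ℤ)) : (FunctionField k n)[X] :=
  Polynomial.monomial p.1 (torusMap k n (character k p.2))

theorem gradedMonomial_zero : gradedMonomial k (0 : ℕ × (Fin n → ℤ)) = 1 := by
  rw [gradedMonomial, Prod.snd_zero, character_zero, map_one, Prod.fst_zero,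
    Polynomial.monomial_zero_one]

theorem gradedMonomial_add (p q : ℕ × (Fin n → ℤ)) :
    gradedMonomial k (p + q) = gradedMonomial k p * gradedMonomial k q := by
  rw [gradedMonomial, Prod.snd_add, character_add, map_mul, Prod.fst_add, gradedMonomial,
    gradedMonomial, Polynomial.monomial_mul_monomial]

/-- The semigroup algebra of `Γ`, realized by the polynomials `∑ f_l t^l` such that every character
`χ^m` occurring in `f_l` satisfies `(l, m) ∈ Γ`. -/
def semigroupRing (k : Type*) [Field k] {n : ℕ} (Γ : AddSubmonoid (ℕ × (Fin n → ℤ))) :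
    Subalgebra k (FunctionField k n)[X] where
  carrier := {F | ∀ l, ∃ g : TorusRing k n, torusMap k n g = F.coeff l ∧
    ∀ m ∈ g.coeff.support, (l, m) ∈ Γ}
  add_mem' {F G} hF hG l := by
    classical
    obtain ⟨f, hf, hfΓ⟩ := hF l
    obtain ⟨g, hg, hgΓ⟩ := hG l
    refine ⟨f + g, by rw [map_add, hf, hg, Polynomial.coeff_add], fun m hm => ?_⟩
    exact (Finset.mem_union.1 (Finsupp.support_add hm)).elim (hfΓ m) (hgΓ m)
  mul_mem' {F G} hF hG l := by
    classical
    choose f hf hfΓ using hF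
    choose g hg hgΓ using hG
    refine ⟨∑ x ∈ Finset.HasAntidiagonal.antidiagonal l, f x.1 * g x.2, ?_, fun m hm => ?_⟩
    · rw [map_sum, Polynomial.coeff_mul]
      exact Finset.sum_congr rfl fun x _ => by rw [map_mul, hf, hg]
    · rw [AddMonoidAlgebra.coeff_sum] at hm
      obtain ⟨x, hx, hmx⟩ := Finset.mem_biUnion.1 (Finsupp.support_finsetSum hm)
      obtain ⟨a, ha, b, hb, rfl⟩ :=
        Finset.mem_add.1 (AddMonoidAlgebra.support_coeff_mul_subset _ _ hmx)
      rw [← Finset.HasAntidiagonal.mem_antidiagonal.1 hx]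
      exact Γ.add_mem (hfΓ _ _ ha) (hgΓ _ _ hb)
  algebraMap_mem' c l := by
    rw [Polynomial.algebraMap_apply, Polynomial.coeff_C]
    split_ifs with hl
    · refine ⟨AddMonoidAlgebra.single 0 c, ?_, fun m hm => ?_⟩
      · rw [torusMap_single, character_zero, map_one, Algebra.algebraMap_eq_smul_one]
      · rw [AddMonoidAlgebra.coeff_single] at hm
        rw [hl, Finset.mem_singleton.1 (Finsupp.support_single_subset hm)]
        exact Γ.zero_mem
    · exact ⟨0, map_zero _, by simp⟩

variable {Γ Γ' : AddSubmonoid (ℕ × (Fin n → ℤ))} {F : (FunctionField k n)[X]}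

theorem mem_semigroupRing : F ∈ semigroupRing k Γ ↔
    ∀ l, ∃ g : TorusRing k n, torusMap k n g = F.coeff l ∧ ∀ m ∈ g.coeff.support, (l, m) ∈ Γ :=
  Iff.rfl

theorem semigroupRing_mono (h : Γ ≤ Γ') : semigroupRing k Γ ≤ semigroupRing k Γ' :=
  fun _ hF l => let ⟨g, hg, hgΓ⟩ := hF l; ⟨g, hg, fun m hm => h (hgΓ m hm)⟩

theorem gradedMonomial_mem_semigroupRing {p : ℕ × (Fin n → ℤ)} :
    gradedMonomial k p ∈ semigroupRing k Γ ↔ p ∈ Γ := by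
  rw [mem_semigroupRing]
  refine ⟨fun h => ?_, fun h l => ?_⟩
  · obtain ⟨g, hg, hgΓ⟩ := h p.1
    rw [gradedMonomial, Polynomial.coeff_monomial_same] at hg
    rw [torusMap_injective hg, support_character] at hgΓ
    exact hgΓ _ (Finset.mem_singleton_self _)
  · rw [gradedMonomial, Polynomial.coeff_monomial]
    split_ifs with hl
    · refine ⟨_, rfl, fun m hm => ?_⟩
      rw [support_character, Finset.mem_singleton] at hm
      rwa [hm, ← hl]
    · exact ⟨0, map_zero _, by simp⟩

theorem mem_span_gradedMonomial (hF : F ∈ semigroupRing k Γ) :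
    F ∈ Submodule.span k (gradedMonomial k '' (Γ : Set (ℕ × (Fin n → ℤ)))) := by
  rw [F.as_sum_support]
  refine Submodule.sum_mem _ fun l _ => ?_
  obtain ⟨g, hg, hgΓ⟩ := hF l
  rw [← hg, ← AddMonoidAlgebra.sum_coeff_single g, Finsupp.sum, map_sum, map_sum]
  refine Submodule.sum_mem _ fun m hm => ?_
  rw [torusMap_single, ← Polynomial.smul_monomial]
  exact Submodule.smul_mem _ _ (Submodule.subset_span ⟨(l, m), hgΓ m hm, rfl⟩)

theorem adjoin_image_gradedMonomial (G : Set (ℕ × (Fin n → ℤ))) :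
    Algebra.adjoin k (gradedMonomial k '' G) = semigroupRing k (AddSubmonoid.closure G) := by
  refine le_antisymm (Algebra.adjoin_le ?_) fun F hF => ?_
  · rintro _ ⟨p, hp, rfl⟩
    exact gradedMonomial_mem_semigroupRing.2 (AddSubmonoid.subset_closure hp)
  suffices h : gradedMonomial k '' (AddSubmonoid.closure G : Set (ℕ × (Fin n → ℤ))) ⊆
      Subalgebra.toSubmodule (Algebra.adjoin k (gradedMonomial k '' G)) from
    Submodule.span_le.2 h (mem_span_gradedMonomial hF)
  rintro _ ⟨p, hp, rfl⟩
  change gradedMonomial k p ∈ Algebra.adjoin k (gradedMonomial k '' G)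
  induction hp using AddSubmonoid.closure_induction with
  | mem p hp => exact Algebra.subset_adjoin ⟨p, hp, rfl⟩
  | zero => exact gradedMonomial_zero (k := k) ▸ Subalgebra.one_mem _
  | add p q _ _ hp hq => exact gradedMonomial_add (k := k) p q ▸ Subalgebra.mul_mem _ hp hq

theorem exists_finset_mem_semigroupRing_closure (hF : F ∈ semigroupRing k Γ) :
    ∃ G : Finset (ℕ × (Fin n → ℤ)), (G : Set (ℕ × (Fin n → ℤ))) ⊆ Γ ∧
      F ∈ semigroupRing k (AddSubmonoid.closure (G : Set (ℕ × (Fin n → ℤ)))) := by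
  classical
  obtain ⟨T, hT, hFT⟩ := Submodule.mem_span_finite_of_mem_span (mem_span_gradedMonomial hF)
  obtain ⟨G, hG, rfl⟩ := Finset.subset_set_image_iff.1 hT
  refine ⟨G, hG, ?_⟩
  rw [← adjoin_image_gradedMonomial, ← Finset.coe_image]
  exact Algebra.span_le_adjoin k _ hFT

theorem fg_semigroupRing_iff : (semigroupRing k Γ).FG ↔ Γ.FG := by
  classical
  refine ⟨fun ⟨T, hT⟩ => ?_, ?_⟩
  · have hTΓ : ∀ F : T, (F : (FunctionField k n)[X]) ∈ semigroupRing k Γ :=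
      fun F => hT ▸ Algebra.subset_adjoin F.2
    choose G hGΓ hFG using fun F : T => exists_finset_mem_semigroupRing_closure (hTΓ F)
    refine ⟨Finset.univ.biUnion G, le_antisymm ?_ fun p hp => ?_⟩
    · rw [AddSubmonoid.closure_le, Finset.coe_biUnion]
      exact Set.iUnion₂_subset fun F _ => hGΓ F
    · rw [← gradedMonomial_mem_semigroupRing (k := k)] at hp ⊢
      rw [← hT] at hp
      refine Algebra.adjoin_le (fun F hF => ?_) hp
      have hGF : G ⟨F, hF⟩ ⊆ Finset.univ.biUnion G :=
        Finset.subset_biUnion_of_mem G (Finset.mem_univ _)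
      exact semigroupRing_mono (AddSubmonoid.closure_mono (Finset.coe_subset.2 hGF)) (hFG ⟨F, hF⟩)
  · rintro ⟨G, rfl⟩
    exact ⟨G.image (gradedMonomial k), by rw [Finset.coe_image, adjoin_image_gradedMonomial]⟩

/-! ### Gordan's lemma -/

/-- Rounding down the coefficients of a nonnegative real combination of the generators leaves a
remainder of bounded norm. -/
theorem fg_comap_hull_image {A E : Type*} [AddCommMonoid A] [NormedAddCommGroup E] [NormedSpace ℝ E]
    (f : A →+ E) (hfin : ∀ r : ℝ, {a | ‖f a‖ ≤ r}.Finite) {s : Set A} (hs : s.Finite)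
    (hsub : ∀ a b, f a - f b ∈ PointedCone.hull ℝ (f '' s) → ∃ c, a = b + c) :
    ((PointedCone.hull ℝ (f '' s)).toAddSubmonoid.comap f).FG := by
  set C := PointedCone.hull ℝ (f '' s) with hC
  lift s to Finset A using hs
  have hsC : ∀ a ∈ s, f a ∈ C := fun a ha => Submodule.subset_span ⟨a, ha, rfl⟩
  let G : Set A := s ∪ {a | ‖f a‖ ≤ ∑ b ∈ s, ‖f b‖} ∩ {a | f a ∈ C}
  have hG : G.Finite := s.finite_toSet.union ((hfin _).inter_of_left _)
  refine (AddSubmonoid.fg_iff _).2 ⟨G, le_antisymm ?_ fun a ha => ?_, hG⟩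
  · exact AddSubmonoid.closure_le.2 (Set.union_subset hsC fun a ha => ha.2)
  obtain ⟨c, hc, hcs, hca⟩ := mem_hull_image_iff.1 (show f a ∈ C from ha)
  rw [Finsupp.linearCombination_apply, Finsupp.sum_of_support_subset c (Finset.coe_subset.1 hcs) _
    fun b _ => zero_smul ℝ (f b)] at hca
  let b : A := ∑ i ∈ s, ⌊c i⌋₊ • i
  have hfract : f a - f b = ∑ i ∈ s, (c i - ⌊c i⌋₊) • f i := by
    simp only [b, ← hca, map_sum, map_nsmul, sub_smul, Finset.sum_sub_distrib,
      Nat.cast_smul_eq_nsmul]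
  have hfract0 : ∀ i, 0 ≤ c i - ⌊c i⌋₊ := fun i => sub_nonneg.2 (Nat.floor_le (hc i))
  have hfract1 : ∀ i, c i - ⌊c i⌋₊ ≤ 1 := fun i => by linarith [Nat.lt_floor_add_one (c i)]
  have hmem : f a - f b ∈ C :=
    hfract ▸ Submodule.sum_mem _ fun i hi => C.smul_mem (hfract0 i) (hsC i hi)
  obtain ⟨r, rfl⟩ := hsub a b hmem
  rw [map_add, add_sub_cancel_left] at hfract hmem
  have hb : b ∈ AddSubmonoid.closure G := AddSubmonoid.sum_mem _ fun i hi =>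
    AddSubmonoid.nsmul_mem _ (AddSubmonoid.subset_closure (Set.mem_union_left _ hi)) _
  refine AddSubmonoid.add_mem _ hb
    (AddSubmonoid.subset_closure (Set.mem_union_right _ ⟨?_, hmem⟩))
  rw [Set.mem_ofPred_eq, hfract]
  refine (norm_sum_le _ _).trans (Finset.sum_le_sum fun i _ => ?_)
  rw [norm_smul, Real.norm_of_nonneg (hfract0 i)]
  exact mul_le_of_le_one_left (norm_nonneg _) (hfract1 i)

/-! ### Lattice points in the dilates of a convex set -/

section Homogenization

variable {E : Type*} [AddCommGroup E] [Module ℝ E] {P : Set E}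

/-- The cone over `P`, placed at height `1`. -/
def homogenization (P : Set E) : PointedCone ℝ (ℝ × E) :=
  PointedCone.hull ℝ (Prod.mk 1 '' P)

theorem mem_homogenization_iff (hP : Convex ℝ P) {y : ℝ × E} :
    y ∈ homogenization P ↔ y = 0 ∨ 0 < y.1 ∧ y.1⁻¹ • y.2 ∈ P := by
  refine ⟨fun hy => ?_, ?_⟩
  · induction hy using Submodule.span_induction with
    | mem y hy =>
      obtain ⟨x, hx, rfl⟩ := hy
      exact Or.inr ⟨one_pos, by rwa [inv_one, one_smul]⟩
    | zero => exact Or.inl rfl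
    | add y z _ _ hy hz =>
      rcases hy with rfl | ⟨hy₀, hy⟩
      · rwa [zero_add]
      rcases hz with rfl | ⟨hz₀, hz⟩
      · rw [add_zero]
        exact Or.inr ⟨hy₀, hy⟩
      have hsum : 0 < (y + z).1 := add_pos hy₀ hz₀
      refine Or.inr ⟨hsum, ?_⟩
      convert hP hy hz (a := (y + z).1⁻¹ * y.1) (b := (y + z).1⁻¹ * z.1) (by positivity)
        (by positivity) (by rw [← mul_add, ← Prod.fst_add, inv_mul_cancel₀ hsum.ne']) using 1
      rw [mul_smul, mul_smul, smul_inv_smul₀ hy₀.ne', smul_inv_smul₀ hz₀.ne', ← smul_add,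
        Prod.snd_add]
    | smul t y _ hy =>
      rcases hy with rfl | ⟨hy₀, hy⟩
      · exact Or.inl (smul_zero t)
      rcases eq_or_ne t 0 with rfl | ht
      · exact Or.inl (zero_smul _ y)
      refine Or.inr ⟨mul_pos (t.2.lt_of_ne' (Subtype.coe_ne_coe.2 ht)) hy₀, ?_⟩
      change ((t : ℝ) * y.1)⁻¹ • (t : ℝ) • y.2 ∈ P
      rwa [mul_inv_rev, mul_smul, inv_smul_smul₀ (Subtype.coe_ne_coe.2 ht)]
  · rintro (rfl | ⟨hy₀, hy⟩)
    · exact Submodule.zero_mem _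
    · have hsmul : y = y.1 • ((1 : ℝ), y.1⁻¹ • y.2) := Prod.ext (mul_one _).symm
        (smul_inv_smul₀ hy₀.ne' _).symm
      rw [hsmul]
      exact (homogenization P).smul_mem hy₀.le (Submodule.subset_span ⟨_, hy, rfl⟩)

theorem homogenization_convexHull (s : Set E) :
    homogenization (convexHull ℝ s) = homogenization s := by
  refine le_antisymm (Submodule.span_le.2 ?_)
    (Submodule.span_mono (Set.image_mono (subset_convexHull ℝ s)))
  rw [Set.image_subset_iff]
  refine convexHull_min (fun x hx => Submodule.subset_span ⟨x, hx, rfl⟩) ?_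
  exact (homogenization s).convex.affine_preimage
    ((AffineMap.const ℝ E (1 : ℝ)).prod (AffineMap.id ℝ E))

end Homogenization

/-- The embedding of the graded lattice into the real vector space spanned by it. -/
def gradedToReal (n : ℕ) : ℕ × (Fin n → ℤ) →+ ℝ × (Fin n → ℝ) where
  toFun p := (p.1, toReal p.2)
  map_zero' := Prod.ext Nat.cast_zero toReal_zero
  map_add' _ _ := Prod.ext (Nat.cast_add _ _) (toReal_add _ _)

theorem finite_norm_gradedToReal_le (r : ℝ) : {p | ‖gradedToReal n p‖ ≤ r}.Finite := by
  refine ((Set.finite_Iic ⌊r⌋₊).prod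
    (Set.finite_Icc (fun _ : Fin n => -⌊r⌋) fun _ => ⌊r⌋)).subset fun p hp => ?_
  have hp₁ : (p.1 : ℝ) ≤ r := (le_abs_self _).trans ((norm_fst_le (gradedToReal n p)).trans hp)
  have hp₂ : ∀ i, |(p.2 i : ℝ)| ≤ r := fun i =>
    (norm_le_pi_norm (toReal p.2) i).trans ((norm_snd_le (gradedToReal n p)).trans hp)
  have hp₃ : ∀ i, |p.2 i| ≤ ⌊r⌋ := fun i => Int.le_floor.2 (by exact_mod_cast hp₂ i)
  exact ⟨Nat.le_floor hp₁, fun i => (abs_le.1 (hp₃ i)).1, fun i => (abs_le.1 (hp₃ i)).2⟩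

theorem exists_smul_eq_gradedToReal (q : Fin n → ℚ) :
    ∃ p : ℕ × (Fin n → ℤ), 0 < p.1 ∧ gradedToReal n p = (p.1 : ℝ) • (1, ratToReal q) := by
  obtain ⟨N, m, hN, hm⟩ := exists_toReal_eq_smul_ratToReal q
  exact ⟨(N, m), hN, Prod.ext (mul_one _).symm hm⟩

theorem exists_ratToReal_eq_inv_smul_toReal (p : ℕ × (Fin n → ℤ)) :
    ∃ q : Fin n → ℚ, ratToReal q = (p.1 : ℝ)⁻¹ • toReal p.2 :=
  ⟨fun i => (p.1 : ℚ)⁻¹ * p.2 i, funext fun i => by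
    simp only [ratToReal, toReal, Pi.smul_apply, smul_eq_mul, Rat.cast_mul, Rat.cast_inv,
      Rat.cast_natCast, Rat.cast_intCast]⟩

/-- The semigroup of the pairs `(l, m)` such that `m` is a lattice point of the dilate `l P` of the
convex set `P`; in degree `0` only the origin is allowed, even when `P` is unbounded. -/
def dilateSemigroup (P : Set (Fin n → ℝ)) : AddSubmonoid (ℕ × (Fin n → ℤ)) :=
  (homogenization P).toAddSubmonoid.comap (gradedToReal n)

variable {P : Set (Fin n → ℝ)} {p : ℕ × (Fin n → ℤ)}

theorem mem_dilateSemigroup (hP : Convex ℝ P) :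
    p ∈ dilateSemigroup P ↔ p = 0 ∨ 0 < p.1 ∧ (p.1 : ℝ)⁻¹ • toReal p.2 ∈ P := by
  refine (mem_homogenization_iff hP).trans (or_congr ?_ (and_congr_left' Nat.cast_pos))
  exact ⟨fun h => Prod.ext (Nat.cast_eq_zero.1 (congrArg Prod.fst h))
    (toReal_injective ((congrArg Prod.snd h).trans toReal_zero.symm)),
    fun h => h ▸ map_zero (gradedToReal n)⟩

theorem homogenization_image_ratToReal (s : Set (Fin n → ℚ)) {g : (Fin n → ℚ) → ℕ × (Fin n → ℤ)}
    (hg₀ : ∀ q, 0 < (g q).1)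
    (hg : ∀ q, gradedToReal n (g q) = ((g q).1 : ℝ) • (1, ratToReal q)) :
    homogenization (ratToReal '' s) = PointedCone.hull ℝ (gradedToReal n '' (g '' s)) := by
  have hg₀' : ∀ q, (0 : ℝ) < (g q).1 := fun q => Nat.cast_pos.2 (hg₀ q)
  refine le_antisymm (Submodule.span_le.2 ?_) (Submodule.span_le.2 ?_)
  · rintro _ ⟨_, ⟨q, hq, rfl⟩, rfl⟩
    rw [← inv_smul_smul₀ (hg₀' q).ne' (1, ratToReal q), ← hg]
    exact (PointedCone.hull ℝ _).smul_mem (inv_nonneg.2 (hg₀' q).le)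
      (Submodule.subset_span ⟨_, ⟨q, hq, rfl⟩, rfl⟩)
  · rintro _ ⟨_, ⟨q, hq, rfl⟩, rfl⟩
    rw [hg]
    exact (homogenization _).smul_mem (hg₀' q).le
      (Submodule.subset_span ⟨_, ⟨q, hq, rfl⟩, rfl⟩)

theorem IsRationalPolytope.fg_dilateSemigroup (hP : IsRationalPolytope P) :
    (dilateSemigroup P).FG := by
  obtain ⟨s, rfl⟩ := hP
  choose g hg₀ hg using exists_smul_eq_gradedToReal (n := n)
  have hhull : homogenization (convexHull ℝ (ratToReal '' (s : Set (Fin n → ℚ)))) =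
      PointedCone.hull ℝ (gradedToReal n '' (g '' s)) := by
    rw [homogenization_convexHull, homogenization_image_ratToReal _ hg₀ hg]
  rw [dilateSemigroup, hhull]
  refine fg_comap_hull_image _ finite_norm_gradedToReal_le (s.finite_toSet.image g) ?_
  intro a b hab
  rw [← hhull, mem_homogenization_iff (convex_convexHull ℝ _)] at hab
  have hle : (b.1 : ℝ) ≤ a.1 := sub_nonneg.1
    (hab.elim (fun h => (congrArg Prod.fst h).ge) fun h => h.1.le)
  exact ⟨(a.1 - b.1, a.2 - b.2), Prod.ext (Nat.add_sub_cancel' (Nat.cast_le.1 hle)).symm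
    (add_sub_cancel _ _).symm⟩

theorem isRationalPolytope_of_fg_dilateSemigroup (hP : Convex ℝ P)
    (hrat : P ⊆ closure (P ∩ Set.range ratToReal)) (hfg : (dilateSemigroup P).FG) :
    IsRationalPolytope P := by
  classical
  obtain ⟨G, hG⟩ := hfg
  have hGP : ∀ p ∈ G, p = 0 ∨ 0 < p.1 ∧ (p.1 : ℝ)⁻¹ • toReal p.2 ∈ P := fun p hp =>
    (mem_dilateSemigroup hP).1 (hG ▸ AddSubmonoid.subset_closure hp)
  choose r hr using exists_ratToReal_eq_inv_smul_toReal (n := n)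
  let s : Finset (Fin n → ℚ) := (G.filter (· ≠ 0)).image r
  set H : Set (Fin n → ℝ) := convexHull ℝ (ratToReal '' (s : Set (Fin n → ℚ)))
  have hH : Convex ℝ H := convex_convexHull ℝ _
  have hle : dilateSemigroup P ≤ dilateSemigroup H := by
    rw [← hG, AddSubmonoid.closure_le]
    refine fun p hp => (mem_dilateSemigroup hH).2 (or_iff_not_imp_left.2 fun hp₀ => ?_)
    refine ⟨((hGP p hp).resolve_left hp₀).1, hr p ▸ subset_convexHull ℝ _ ⟨r p, ?_, rfl⟩⟩
    exact Finset.mem_image_of_mem _ (Finset.mem_filter.2 ⟨hp, hp₀⟩)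
  refine ⟨s, Set.Subset.antisymm (hrat.trans (closure_minimal ?_
    ((s.finite_toSet.image _).isClosed_convexHull ℝ))) (convexHull_min ?_ hP)⟩
  · rintro _ ⟨hq, q, rfl⟩
    obtain ⟨N, m, hN, hm⟩ := exists_toReal_eq_smul_ratToReal q
    have hq' : ratToReal q = (N : ℝ)⁻¹ • toReal m := by
      rw [hm, inv_smul_smul₀ (Nat.cast_ne_zero.2 hN.ne')]
    rw [hq'] at hq ⊢
    have hmem : (N, m) ∈ dilateSemigroup H := hle ((mem_dilateSemigroup hP).2 (.inr ⟨hN, hq⟩))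
    exact (((mem_dilateSemigroup hH).1 hmem).resolve_left
      fun h => hN.ne' (congrArg Prod.fst h)).2
  · rintro _ ⟨_, hq, rfl⟩
    obtain ⟨p, hp, rfl⟩ := Finset.mem_image.1 hq
    rw [hr]
    exact ((hGP p (Finset.mem_filter.1 hp).1).resolve_left (Finset.mem_filter.1 hp).2).2

/-! ### The section ring of a nef b-divisor -/

variable {φ : (Fin n → ℝ) → ℝ}

theorem IsConical.mem_dilateSemigroup_stabilitySet (h : IsConical φ) :
    p ∈ dilateSemigroup (stabilitySet φ) ↔ ∀ x, (p.1 : ℝ) * φ x ≤ toReal p.2 ⬝ᵥ x := by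
  rw [mem_dilateSemigroup h.convex_stabilitySet]
  rcases p with ⟨l, m⟩
  rcases Nat.eq_zero_or_pos l with rfl | hl
  · refine ⟨?_, fun hm => Or.inl (Prod.ext rfl (toReal_injective ?_))⟩
    · rintro (hp | ⟨hp, -⟩)
      · rw [hp]
        simp [toReal_zero]
      · exact absurd hp (lt_irrefl 0)
    · refine (dotProduct_eq_zero _ fun x => le_antisymm ?_ ?_).trans toReal_zero.symm
      · simpa using hm (-x)
      · simpa using hm x
  · have hl' : (0 : ℝ) < l := Nat.cast_pos.2 hl
    rw [or_iff_right (fun hp => hl.ne' (congrArg Prod.fst hp)), and_iff_right hl,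
      h.mem_stabilitySet]
    refine forall_congr' fun x => ?_
    rw [smul_dotProduct, smul_eq_mul, le_inv_mul_iff₀ hl']

variable {S : Fan n} {D : BDivisor S}

theorem BDivisor.IsConcaveFunction.neg_floor_mul_le_iff (h : D.IsConcaveFunction φ) (l : ℕ)
    (m : Fin n → ℤ) (S' : Model S) (v : S'.1.rays) :
    -⌊(BDivisor.mul l D).inc S' v⌋ ≤ m ⬝ᵥ (v : Fin n → ℤ) ↔
      (l : ℝ) * φ (toReal (v : Fin n → ℤ)) ≤ toReal m ⬝ᵥ toReal (v : Fin n → ℤ) := by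
  have hinc : (BDivisor.mul l D).inc S' v = l * D.inc S' v := rfl
  rw [h.ray, toReal_dotProduct, neg_le, Int.le_floor, hinc, ← Rat.cast_le (K := ℝ)]
  push_cast
  rw [mul_neg, neg_le]

theorem BDivisor.IsConcaveFunction.forall_rays_iff (h : D.IsConcaveFunction φ) (l : ℕ)
    (m : Fin n → ℤ) :
    (∀ (S' : Model S) (v : S'.1.rays),
      -⌊(BDivisor.mul l D).inc S' v⌋ ≤ m ⬝ᵥ (v : Fin n → ℤ)) ↔
      (l, m) ∈ dilateSemigroup (stabilitySet φ) := by
  rw [h.isConical.mem_dilateSemigroup_stabilitySet]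
  refine ⟨fun hm => ?_, fun hm S' v => (h.neg_floor_mul_le_iff l m S' v).2 (hm _)⟩
  have hconical : IsConical fun x => (l : ℝ) * φ x := fun t x ht => by
    change (l : ℝ) * φ (t • x) = t * (l * φ x)
    rw [h.conical t x ht, mul_left_comm]
  have hlin : IsConical (toReal m ⬝ᵥ ·) := fun t x _ => dotProduct_smul t _ x
  refine hconical.le_of_le_primitive hlin (continuous_const.mul h.continuous) (by fun_prop)
    fun v hv => ?_
  obtain ⟨S', -, hv'⟩ := Model.exists_mem_rays ⟨S, Fan.Subdivides.refl S⟩ hv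
  exact (h.neg_floor_mul_le_iff l m S' ⟨v, hv'⟩).1 (hm S' ⟨v, hv'⟩)

theorem BDivisor.IsConcaveFunction.sectionRing_eq (h : D.IsConcaveFunction φ) :
    D.sectionRing k = semigroupRing k (dilateSemigroup (stabilitySet φ)) := by
  ext F
  change (∀ l, F.coeff l ∈ (BDivisor.mul l D).H0 k) ↔ _
  simp only [mem_semigroupRing, BDivisor.mem_H0_iff, h.forall_rays_iff]

theorem BDivisor.IsConcaveFunction.fg_sectionRing_iff (h : D.IsConcaveFunction φ) :
    (D.sectionRing k).FG ↔ (dilateSemigroup (stabilitySet φ)).FG := by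
  rw [h.sectionRing_eq, fg_semigroupRing_iff]

end ToricB

end

theorem mainTheorem8_general (k : Type*) [Field k] {n : ℕ} (S : ToricB.Fan n)
    (D : ToricB.BDivisor S) (hD : D.IsNef) :
    ∃ φ : (Fin n → ℝ) → ℝ, D.IsConcaveFunction φ ∧
      (D.IsCartier ↔ ToricB.IsRationalPolytope (ToricB.stabilitySet φ)) ∧
      (D.IsCartier → (D.sectionRing k).FG) ∧
      ((n ≤ 2 ∨ ToricB.HasRationalAffineHull (ToricB.stabilitySet φ)) →
        (D.sectionRing k).FG → D.IsCartier) := by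
  obtain ⟨φ, h⟩ := hD.exists_isConcaveFunction
  have hconvex := h.isConical.convex_stabilitySet
  refine ⟨φ, h, ⟨h.isRationalPolytope, h.isCartier⟩, fun hC => ?_, fun hrat hfg => ?_⟩
  · exact h.fg_sectionRing_iff.2 (h.isRationalPolytope hC).fg_dilateSemigroup
  · have hΔ : ToricB.HasRationalAffineHull (ToricB.stabilitySet φ) :=
      hrat.elim (h.isConical.hasRationalAffineHull_of_le_two h.concave h.exists_rat) id
    exact h.isCartier (ToricB.isRationalPolytope_of_fg_dilateSemigroup hconvex
      (hΔ.subset_closure hconvex) (h.fg_sectionRing_iff.1 hfg))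

theorem mainTheorem8 (k : Type*) [Field k] [IsAlgClosed k] {n : ℕ} (S : ToricB.Fan n)
    (D : ToricB.BDivisor S) (hD : D.IsNef) :
    ∃ φ : (Fin n → ℝ) → ℝ, D.IsConcaveFunction φ ∧
      (D.IsCartier ↔ ToricB.IsRationalPolytope (ToricB.stabilitySet φ)) ∧
      (D.IsCartier → (D.sectionRing k).FG) ∧
      ((n ≤ 2 ∨ ToricB.HasRationalAffineHull (ToricB.stabilitySet φ)) →
        (D.sectionRing k).FG → D.IsCartier) :=
  mainTheorem8_general k S D hD
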